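/- Let $\mu>0$, $W>0$, $\delta>0$, and let $t^\pm_n := W \pm (-1)^n\delta$ for $n\in\mathbb Z$. Let $t=(t_n)_{n\in\mathbb Z}$ be a real sequence which is homoclinic ($|t_n-t_n^+|\to 0$ as $n\to-\infty$ and as $n\to+\infty$) or heteroclinic ($|t_n-t_n^-|\to0$ as $n\to-\infty$ and $|t_n-t_n^+|\to0$ as $n\to+\infty$), and assume that $t_n\ge\tau$ for all $n$, for some $\tau>0$. For a bounded real sequence $a$, let the corresponding capital letter $A$ denote the bounded self-adjoint operator on $\ell^2(\mathbb Z,\mathbb C)$ with matrix entries $A_{n,n+1}=A_{n+1,n}=a_n$ and $A_{i,j}=0$ if $|i-j|\ne1$. Let $A_-=-A\,\mathbf 1(A<0)$ be the negative part of $A$, and let $\Gamma_t:=\mathbf 1(T<0)$ be the spectral projector. For $h\in\ell^1(\mathbb Z,\mathbb R)$ with $(T+H)_--T_-$ trace class, put $$\mathcal F_t(h):=\frac\mu2\sum_{n\in\mathbb Z}(h_n+2t_n-2)h_n-2\,\mathrm{Tr}\big((T+H)_--T_-\big).$$ Call a positively oriented (simple closed piecewise $C^1$) contour $\mathscr C\subset\mathbb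 C$ and a number $\eta>0$ adapted to $t$ if there is $C\ge0$ such that, for all real sequences $h$ with $\|h\|_{\ell^\infty}\le\eta$ and all $z\in\mathscr C$, the operator $z-(T+H)$ is invertible with $\|(z-(T+H))^{-1}\|_{\rm op}\le C$, and moreover $-(T+H)_-=\frac1{2i\pi}\oint_{\mathscr C}\frac{z}{z-(T+H)}\,dz$. Then there exist $\mathscr C$ and $\eta$ adapted to $t$, and for every such pair $(\mathscr C,\eta)$ the following holds. 1. For all $h\in\ell^1(\mathbb Z,\mathbb R)$ with $\|h\|_{\ell^1}\le\eta$, the operator $(T+H)_--T_-$ is trace class. The map $\mathcal F_t$ is $C^\infty$ on $\{h:\|h\|_{\ell^1}\le\eta\}$, and real analytic on $\{h:\|h\|_{\ell^1}<\eta\}$. 2. For $h\in\ell^1(\mathbb Z,\mathbb R)$ the operator $\Gamma_tH$ is trace class. The formula $$L_t(h)=\mu\sum_{n\in\mathbb Z}(t_n-1)h_n+2\,\mathrm{Tr}(\Gamma_tH)$$ defines a continuous (real-valued) linear form on $\ell^1(\mathbb Z,\mathbb R)$, which is the differential of $\mathcal F_t$ at $0$. 3. For $h,k\in\ell^1(\mathbb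 Z,\mathbb R)$ the operator $\frac1{2i\pi}\oint_{\mathscr C}H\frac1{z-T}K\frac1{z-T}\,dz$ is trace class. The formula $$H_t(h,k)=\mu\sum_{n\in\mathbb Z}h_nk_n+2\,\mathrm{Tr}\Big(\frac1{2i\pi}\oint_{\mathscr C}H\frac1{z-T}K\frac1{z-T}\,dz\Big)$$ defines a continuous (real-valued) bilinear form on $\ell^1(\mathbb Z,\mathbb R)$, which is the second derivative (Hessian) of $\mathcal F_t$ at $0$. 4. There is $C\ge0$ such that, for all $h\in\ell^1(\mathbb Z,\mathbb R)$ with $\|h\|_{\ell^1}<\eta$, $$\Big|\mathcal F_t(h)-L_t(h)-\tfrac12H_t(h,h)\Big|\le C\,\|h\|_{\ell^2}^3.$$ 5. $H_t$ extends to a continuous bilinear form on $\ell^2(\mathbb Z,\mathbb R)$. -/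

import Mathlib

open scoped ENNReal ContDiff

noncomputable section

namespace SSH

/-- The Hilbert space `ℓ²(ℤ, ℂ)`. -/
abbrev Hil : Type := lp (fun _ : ℤ => ℂ) 2

/-- The Banach space `ℓ¹(ℤ, ℝ)`. -/
abbrev L1 : Type := lp (fun _ : ℤ => ℝ) 1

/-- The Hilbert space `ℓ²(ℤ, ℝ)`. -/
abbrev L2 : Type := lp (fun _ : ℤ => ℝ) 2

/-- The inclusion `ℓ¹(ℤ, ℝ) ⊆ ℓ²(ℤ, ℝ)`. -/
def toL2 (h : L1) : L2 :=
  ⟨fun n => h n, (lp.memℓp h).of_exponent_ge (by norm_num)⟩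

/-! ### Hopping operators -/

theorem memℓp_mul_shift {a : ℤ → ℝ} {M : ℝ} (hM : ∀ n, |a n| ≤ M) (k : ℤ) (ψ : Hil) :
    Memℓp (fun n : ℤ => (a n : ℂ) * ψ (n + k)) 2 := by
  have h0 : (0 : ℝ) < (2 : ℝ≥0∞).toReal := by norm_num
  have h1 : Summable fun n : ℤ => ‖ψ (n + k)‖ ^ (2 : ℝ≥0∞).toReal :=
    ((lp.memℓp ψ).summable h0).comp_injective (add_left_injective k)
  refine memℓp_gen (Summable.of_nonneg_of_le (fun n => by positivity) (fun n => ?_)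
    (h1.mul_left (M ^ (2 : ℝ≥0∞).toReal)))
  rw [norm_mul, Real.mul_rpow (norm_nonneg _) (norm_nonneg _), Complex.norm_real,
    Real.norm_eq_abs]
  have := hM n
  gcongr

/-- For a sequence `a` bounded by `M`, the operator `ψ ↦ (n ↦ a n * ψ (n + k))` on `ℓ²(ℤ, ℂ)`. -/
def mulShift (a : ℤ → ℝ) (M : ℝ) (hM : ∀ n, |a n| ≤ M) (k : ℤ) : Hil →L[ℂ] Hil :=
  LinearMap.mkContinuous
    { toFun := fun ψ => ⟨fun n : ℤ => (a n : ℂ) * ψ (n + k), memℓp_mul_shift hM k ψ⟩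
      map_add' := fun ψ φ => by
        ext n
        exact mul_add (a n : ℂ) (ψ (n + k)) (φ (n + k))
      map_smul' := fun c ψ => by
        ext n
        exact mul_left_comm (a n : ℂ) c (ψ (n + k)) }
    M
    (fun ψ => by
      have h0 : (0 : ℝ) < (2 : ℝ≥0∞).toReal := by norm_num
      have hM0 : 0 ≤ M := (abs_nonneg _).trans (hM 0)
      refine lp.norm_le_of_tsum_le h0 (by positivity) ?_
      have h1 : Summable fun n : ℤ => ‖ψ n‖ ^ (2 : ℝ≥0∞).toReal := (lp.memℓp ψ).summable h0
      have h2 : Summable fun n : ℤ => ‖ψ (n + k)‖ ^ (2 : ℝ≥0∞).toReal :=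
        h1.comp_injective (add_left_injective k)
      have h3 : ∀ n : ℤ, ‖(a n : ℂ) * ψ (n + k)‖ ^ (2 : ℝ≥0∞).toReal ≤
          M ^ (2 : ℝ≥0∞).toReal * ‖ψ (n + k)‖ ^ (2 : ℝ≥0∞).toReal := fun n => by
        rw [norm_mul, Real.mul_rpow (norm_nonneg _) (norm_nonneg _), Complex.norm_real,
          Real.norm_eq_abs]
        have := hM n
        gcongr
      calc ∑' n : ℤ, ‖(a n : ℂ) * ψ (n + k)‖ ^ (2 : ℝ≥0∞).toReal
          ≤ ∑' n : ℤ, M ^ (2 : ℝ≥0∞).toReal * ‖ψ (n + k)‖ ^ (2 : ℝ≥0∞).toReal :=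
            (Summable.of_nonneg_of_le (fun n => by positivity) h3
              (h2.mul_left _)).tsum_le_tsum h3 (h2.mul_left _)
        _ = M ^ (2 : ℝ≥0∞).toReal * ∑' n : ℤ, ‖ψ (n + k)‖ ^ (2 : ℝ≥0∞).toReal := tsum_mul_left
        _ = M ^ (2 : ℝ≥0∞).toReal * ∑' n : ℤ, ‖ψ n‖ ^ (2 : ℝ≥0∞).toReal := by
            congr 1
            exact (Equiv.addRight k).tsum_eq fun n : ℤ => ‖ψ n‖ ^ (2 : ℝ≥0∞).toReal
        _ = (M * ‖ψ‖) ^ (2 : ℝ≥0∞).toReal := by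
            rw [Real.mul_rpow hM0 (norm_nonneg _), lp.norm_rpow_eq_tsum h0])

open Classical in
/-- The operator on `ℓ²(ℤ, ℂ)` attached to a bounded real sequence `a`: its matrix in the canonical
basis has the entries `A (n, n+1) = A (n+1, n) = a n` and `0` elsewhere, that is,
`(A ψ) n = a n * ψ (n + 1) + a (n - 1) * ψ (n - 1)` (see `hop_apply`).
For unbounded sequences the value is `0`. -/
def hop (a : ℤ → ℝ) : Hil →L[ℂ] Hil :=
  if h : ∃ M : ℝ, ∀ n, |a n| ≤ M then
    mulShift a h.choose h.choose_spec 1 +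
      mulShift (fun n => a (n - 1)) h.choose (fun n => h.choose_spec (n - 1)) (-1)
  else 0

theorem hop_apply {a : ℤ → ℝ} (h : ∃ M : ℝ, ∀ n, |a n| ≤ M) (ψ : Hil) (n : ℤ) :
    hop a ψ n = (a n : ℂ) * ψ (n + 1) + (a (n - 1) : ℂ) * ψ (n - 1) := by
  rw [hop, dif_pos h]
  rfl

/-! ### Operators on a Hilbert space -/

section Operators

variable {E : Type*} [NormedAddCommGroup E] [InnerProductSpace ℂ E] [CompleteSpace E]

/-- The negative part `A_-` of a self-adjoint operator `A`, given by the functional calculus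
with the function `x ↦ max (-x) 0`. -/
def negPart (A : E →L[ℂ] E) : E →L[ℂ] E := A⁻

/-- The absolute value `|A| = (A* A)^{1/2}`. -/
def absOp (A : E →L[ℂ] E) : E →L[ℂ] E := CFC.abs A

/-- The spectral projector `𝟙(A < 0)` of a self-adjoint operator `A`: the orthogonal projection
onto the closure of the range of `A_-`, i.e. onto `(ker A_-)ᗮ`. -/
def negProj (A : E →L[ℂ] E) : E →L[ℂ] E :=
  (LinearMap.ker (negPart A).toLinearMap)ᗮ.starProjection

end Operators

/-! ### Trace -/

/-- The canonical basis of `ℓ²(ℤ, ℂ)`. -/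
def e (n : ℤ) : Hil := lp.single 2 n (1 : ℂ)

/-- `A` is trace class: `Tr |A| < ∞`. -/
def IsTraceClass (A : Hil →L[ℂ] Hil) : Prop :=
  Summable fun n : ℤ => (inner ℂ (e n) (absOp A (e n))).re

/-- The trace (of a trace class operator). -/
def trace (A : Hil →L[ℂ] Hil) : ℂ :=
  ∑' n : ℤ, inner ℂ (e n) (A (e n))

/-! ### Configurations -/

/-- The dimerized configuration `t⁺`. -/
def tPlus (W δ : ℝ) (n : ℤ) : ℝ := W + (-1) ^ n * δ

/-- The dimerized configuration `t⁻`. -/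
def tMinus (W δ : ℝ) (n : ℤ) : ℝ := W - (-1) ^ n * δ

def IsHomoclinic (W δ : ℝ) (t : ℤ → ℝ) : Prop :=
  Filter.Tendsto (fun n => |t n - tPlus W δ n|) Filter.atBot (nhds 0) ∧
    Filter.Tendsto (fun n => |t n - tPlus W δ n|) Filter.atTop (nhds 0)

def IsHeteroclinic (W δ : ℝ) (t : ℤ → ℝ) : Prop :=
  Filter.Tendsto (fun n => |t n - tMinus W δ n|) Filter.atBot (nhds 0) ∧
    Filter.Tendsto (fun n => |t n - tPlus W δ n|) Filter.atTop (nhds 0)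

/-- The energy difference
`F_t(h) = (μ/2) ∑ (h_n + 2 t_n - 2) h_n - 2 Tr ((T + H)_- - T_-)`.
The operator in the trace is self-adjoint, so that its trace is real. -/
def energyDiff (μ : ℝ) (t : ℤ → ℝ) (h : L1) : ℝ :=
  μ / 2 * ∑' n : ℤ, (h n + 2 * t n - 2) * h n -
    2 * (trace (negPart (hop t + hop h) - negPart (hop t))).re

/-! ### Contours -/

/-- `∮ f(z) dz` along the curve `γ : [0, 1] → ℂ`. -/
def curveInt {V : Type*} [NormedAddCommGroup V] [NormedSpace ℂ V] (γ : ℝ → ℂ) (f : ℂ → V) : V :=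
  ∫ s in (0 : ℝ)..1, deriv γ s • f (γ s)

/-- `(2 i π)⁻¹ ∮ f(z) dz`. -/
def cauchyInt {V : Type*} [NormedAddCommGroup V] [NormedSpace ℂ V] (γ : ℝ → ℂ) (f : ℂ → V) : V :=
  (2 * (Real.pi : ℂ) * Complex.I)⁻¹ • curveInt γ f

/-- A positively oriented contour: a simple closed piecewise `C¹` curve, parametrized by `[0, 1]`,
which winds once counterclockwise around each point it encloses. -/
structure Contour where
  toFun : ℝ → ℂ
  closed : toFun 0 = toFun 1
  piecewise_C1 : ∃ S : Finset ℝ, (S : Set ℝ) ⊆ Set.Icc 0 1 ∧ (0 : ℝ) ∈ S ∧ (1 : ℝ) ∈ S ∧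
    ∀ a ∈ S, ∀ b ∈ S, a < b → Disjoint (Set.Ioo a b) (S : Set ℝ) →
      ContDiffOn ℝ 1 toFun (Set.Icc a b)
  simple : Set.InjOn toFun (Set.Ico 0 1)
  positive : ∀ w : ℂ, w ∉ toFun '' Set.Icc 0 1 →
    cauchyInt toFun (fun z => (z - w)⁻¹) = 0 ∨ cauchyInt toFun (fun z => (z - w)⁻¹) = 1

/-- The set of points of a contour. -/
def Contour.points (γ : Contour) : Set ℂ := γ.toFun '' Set.Icc 0 1

/-- The contour `γ` and the radius `η > 0` are adapted to the configuration `t`: for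
`‖h‖_∞ ≤ η` and `z ∈ γ`, the operator `z - (T + H)` is invertible with an inverse that is bounded
uniformly in `h` and `z`, and `-(T + H)_- = (2 i π)⁻¹ ∮ z (z - (T + H))⁻¹ dz`. -/
def IsAdapted (t : ℤ → ℝ) (γ : Contour) (η : ℝ) : Prop :=
  0 < η ∧ ∃ C : ℝ, 0 ≤ C ∧ ∀ h : ℤ → ℝ, (∀ n, |h n| ≤ η) →
    (∀ z ∈ γ.points, z ∈ resolventSet ℂ (hop t + hop h) ∧
      ‖resolvent (hop t + hop h) z‖ ≤ C) ∧
    -negPart (hop t + hop h) = cauchyInt γ.toFun (fun z => z • resolvent (hop t + hop h) z)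

/-- The operator `(2 i π)⁻¹ ∮ H (z - T)⁻¹ K (z - T)⁻¹ dz`. -/
def hessOp (t : ℤ → ℝ) (γ : Contour) (h k : L1) : Hil →L[ℂ] Hil :=
  cauchyInt γ.toFun fun z => hop h * resolvent (hop t) z * hop k * resolvent (hop t) z

end SSH

end

noncomputable section

namespace SSH

/-! ### The canonical basis -/

/-! Write `R_h(z) = (z - T - H)⁻¹`. For an adapted contour the negative part is a contour integral
of `z R_h(z)`, so the resolvent identity turns `(T + H)_- - T_-` into minus the integral of `z R_h H
R_0` (`IsAdapted.negPart_sub`). This contains `H` with `h ∈ ℓ¹` between bounded operators, hence is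
trace class. Its trace follows from `Tr (A H C) = Tr (H C A) = ∑ h n * bond n (C * A)`, a Fubini
argument on matrix entries (`hasSum_trace_mul_hop_mul`, `hasSum_trace_contourInt`). Up to explicit
linear and quadratic terms the energy is therefore a bounded bilinear pairing of `h` with a contour
integral of resolvents. That integral is analytic in `h`, because inversion is analytic in the
Banach algebra of continuous operator-valued functions on the contour.

The same formula around any base point gives the derivative of the trace at `h`: it pairs with the
integral of `z R_h²`, which equals that of `R_h` since `z R_h` is a primitive of the difference.
Differentiating `R_h` once more gives the Hessian. To identify the slope at `0` for an arbitrary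
adapted contour, note that the trace difference involves no contour. By uniqueness of derivatives
one contour suffices, and for a circle the functional calculus gives the spectral projector.

For the cubic remainder, expand the resolvent to second order. Integrating by parts and cycling the
trace shows that the quadratic term is half the Hessian term. The remainder contains three factors
`H`: two are measured in Hilbert–Schmidt norm and the third in operator norm, each bounded by the
`ℓ²` norm of `h` (`norm_pairing_mul_hop_mul_le`). The Hilbert–Schmidt bound also makes the Hessian
`ℓ²`-continuous, so that it extends by density.

Existence of an adapted contour rests on a gap below `0`. `T` exchanges the even and odd
sublattices. For `f` on even sites, `T f` gives a first-order recurrence for `f` which contracts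
near `+∞` and, in one direction or the other, near `-∞`; so `T` is bounded below there
(`exists_lower_bound`). A self-adjoint operator exchanging two complementary subspaces and bounded
below on one of them has no small spectrum except possibly `0` (`notMem_spectrum_of_gap`). This
survives small `H`, and a circle crossing the real axis inside the gap is adapted. -/

theorem inner_e (n : ℤ) (ψ : Hil) : inner ℂ (e n) ψ = ψ n := by
  simp [e, lp.inner_single_left]

theorem norm_e (n : ℤ) : ‖e n‖ = 1 := by
  simp [e, lp.norm_single]

theorem norm_sq_inner_e (n : ℤ) (ψ : Hil) : ‖inner ℂ ψ (e n)‖ = ‖ψ n‖ := by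
  rw [← inner_conj_symm, inner_e]; simp

theorem coe_default_hilbertBasis (n : ℤ) : (default : HilbertBasis ℤ ℂ Hil) n = e n := by
  rw [← HilbertBasis.repr_symm_single]; rfl

theorem hasSum_inner_e_mul (x y : Hil) :
    HasSum (fun m => inner ℂ x (e m) * inner ℂ (e m) y) (inner ℂ x y) := by
  simpa only [coe_default_hilbertBasis] using
    (default : HilbertBasis ℤ ℂ Hil).hasSum_inner_mul_inner x y

theorem hasSum_norm_sq (x : Hil) : HasSum (fun m => ‖x m‖ ^ 2) (‖x‖ ^ 2) := by
  simpa using lp.hasSum_norm (p := 2) (by norm_num) x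

theorem summable_mul_of_sq {ι : Type*} {f g : ι → ℝ}
    (hfs : Summable fun i => f i ^ 2) (hgs : Summable fun i => g i ^ 2) :
    Summable fun i => f i * g i := by
  refine Summable.of_norm_bounded ((hfs.add hgs).mul_left (1 / 2)) fun i => ?_
  rw [Real.norm_eq_abs, abs_mul]
  nlinarith [sq_nonneg (|f i| - |g i|), sq_abs (f i), sq_abs (g i)]

theorem tsum_mul_le_of_sq {ι : Type*} {f g : ι → ℝ} {a b : ℝ} (ha : 0 ≤ a) (hb : 0 ≤ b)
    (hf : ∀ i, 0 ≤ f i) (hg : ∀ i, 0 ≤ g i)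
    (hfs : Summable fun i => f i ^ 2) (hgs : Summable fun i => g i ^ 2)
    (hfa : ∑' i, f i ^ 2 ≤ a ^ 2) (hgb : ∑' i, g i ^ 2 ≤ b ^ 2) :
    ∑' i, f i * g i ≤ a * b := by
  have h := Real.inner_le_Lp_mul_Lq_tsum_of_nonneg (p := 2) (q := 2) Real.HolderConjugate.two_two
    hf hg (by simpa using hfs) (by simpa using hgs)
  simp only [Real.rpow_two, ← Real.sqrt_eq_rpow] at h
  refine h.trans (mul_le_mul ?_ ?_ (Real.sqrt_nonneg _) ha)
  · exact Real.sqrt_le_iff.2 ⟨ha, hfa⟩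
  · exact Real.sqrt_le_iff.2 ⟨hb, hgb⟩

theorem summable_norm_mul_norm (x y : Hil) : Summable fun m => ‖x m‖ * ‖y m‖ :=
  summable_mul_of_sq (hasSum_norm_sq x).summable (hasSum_norm_sq y).summable

theorem tsum_norm_mul_norm_le (x y : Hil) : ∑' m, ‖x m‖ * ‖y m‖ ≤ ‖x‖ * ‖y‖ :=
  tsum_mul_le_of_sq (norm_nonneg _) (norm_nonneg _) (fun _ => norm_nonneg _)
    (fun _ => norm_nonneg _) (hasSum_norm_sq x).summable (hasSum_norm_sq y).summable
    (hasSum_norm_sq x).tsum_eq.le (hasSum_norm_sq y).tsum_eq.le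

/-! ### Hopping operators -/

theorem norm_mulShift_le {a : ℤ → ℝ} {M : ℝ} (hM : ∀ n, |a n| ≤ M) (k : ℤ) (M' : ℝ)
    (hM' : ∀ n, |a n| ≤ M') : ‖mulShift a M hM k‖ ≤ M' := by
  -- The bound in `mulShift` only serves to prove continuity, so any other bound gives the same
  -- operator.
  have h : mulShift a M hM k = mulShift a M' hM' k := rfl
  rw [h]
  exact LinearMap.mkContinuous_norm_le _ ((abs_nonneg _).trans (hM' 0)) _

theorem norm_hop_le {a : ℤ → ℝ} {M : ℝ} (hM : ∀ n, |a n| ≤ M) : ‖hop a‖ ≤ 2 * M := by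
  have h : ∃ M : ℝ, ∀ n, |a n| ≤ M := ⟨M, hM⟩
  rw [hop, dif_pos h, two_mul]
  exact (norm_add_le _ _).trans (add_le_add (norm_mulShift_le _ _ _ hM)
    (norm_mulShift_le _ _ _ fun n => hM (n - 1)))

theorem hop_add {a b : ℤ → ℝ} (ha : ∃ M : ℝ, ∀ n, |a n| ≤ M) (hb : ∃ M : ℝ, ∀ n, |b n| ≤ M) :
    hop (a + b) = hop a + hop b := by
  have hab : ∃ M : ℝ, ∀ n, |(a + b) n| ≤ M := by
    obtain ⟨M, hM⟩ := ha
    obtain ⟨N, hN⟩ := hb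
    exact ⟨M + N, fun n => (abs_add_le _ _).trans (add_le_add (hM n) (hN n))⟩
  ext ψ n
  change hop (a + b) ψ n = hop a ψ n + hop b ψ n
  rw [hop_apply hab, hop_apply ha, hop_apply hb]
  simp only [Pi.add_apply, Complex.ofReal_add]
  ring

theorem hop_smul {a : ℤ → ℝ} (c : ℝ) (ha : ∃ M : ℝ, ∀ n, |a n| ≤ M) :
    hop (c • a) = (c : ℂ) • hop a := by
  have hca : ∃ M : ℝ, ∀ n, |(c • a) n| ≤ M := by
    obtain ⟨M, hM⟩ := ha
    refine ⟨|c| * M, fun n => ?_⟩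
    rw [Pi.smul_apply, smul_eq_mul, abs_mul]
    exact mul_le_mul_of_nonneg_left (hM n) (abs_nonneg c)
  ext ψ n
  change hop (c • a) ψ n = (c : ℂ) * hop a ψ n
  rw [hop_apply hca, hop_apply ha]
  simp only [Pi.smul_apply, smul_eq_mul, Complex.ofReal_mul]
  ring

/-- Shifting one of the two sums by one step collects everything that multiplies `a n` on the bond
`{n, n+1}`. Self-adjointness and the trace formula both start from this form. -/
theorem hasSum_inner_hop {a : ℤ → ℝ} (ha : ∃ M : ℝ, ∀ n, |a n| ≤ M) (x y : Hil) :
    HasSum (fun n => (a n : ℂ) * (inner ℂ x (e n) * y (n + 1) + inner ℂ x (e (n + 1)) * y n))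
      (inner ℂ x (hop a y)) := by
  obtain ⟨M, hM⟩ := ha
  have h1 : HasSum (fun n => inner ℂ x (e n) * ((a n : ℂ) * y (n + 1)))
      (inner ℂ x (mulShift a M hM 1 y)) := by
    have := hasSum_inner_e_mul x (mulShift a M hM 1 y)
    simp only [inner_e] at this
    exact this
  have h2 : HasSum (fun n => inner ℂ x (e n) * ((a (n - 1) : ℂ) * y (n - 1)))
      (inner ℂ x (mulShift (fun n => a (n - 1)) M (fun n => hM (n - 1)) (-1) y)) := by
    have := hasSum_inner_e_mul x (mulShift (fun n => a (n - 1)) M (fun n => hM (n - 1)) (-1) y)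
    simp only [inner_e] at this
    exact this
  have h3 := (Equiv.addRight (1 : ℤ)).hasSum_iff.2 h2
  have h4 := h1.add h3
  rw [← inner_add_right] at h4
  have h5 : mulShift a M hM 1 y + mulShift (fun n => a (n - 1)) M (fun n => hM (n - 1)) (-1) y
      = hop a y := by
    rw [hop, dif_pos ⟨M, hM⟩]; rfl
  rw [h5] at h4
  convert h4 using 2 with n
  simp
  ring

theorem isSelfAdjoint_hop {a : ℤ → ℝ} (ha : ∃ M : ℝ, ∀ n, |a n| ≤ M) :
    IsSelfAdjoint (hop a) := by
  rw [ContinuousLinearMap.isSelfAdjoint_iff_isSymmetric]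
  intro x y
  change inner ℂ (hop a x) y = inner ℂ x (hop a y)
  have h1 := hasSum_inner_hop ha x y
  have h2 := (hasSum_inner_hop ha y x).map (starRingEnd ℂ) Complex.continuous_conj
  rw [inner_conj_symm] at h2
  refine h2.unique ?_
  convert h1 using 2 with n
  simp only [Function.comp_apply, map_mul, map_add, Complex.conj_ofReal, inner_conj_symm, inner_e]
  rw [← inner_e n x, ← inner_e (n + 1) x, inner_conj_symm, inner_conj_symm]
  ring

/-! ### Summable sequences -/

theorem L1.bdd (h : L1) : ∀ n, |h n| ≤ ‖h‖ := fun n => by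
  simpa using lp.norm_apply_le_norm (by norm_num) h n

theorem L1.exists_bdd (h : L1) : ∃ M : ℝ, ∀ n, |h n| ≤ M := ⟨‖h‖, L1.bdd h⟩

theorem L1.hasSum_abs (h : L1) : HasSum (fun n => |h n|) ‖h‖ := by
  simpa using lp.hasSum_norm (p := 1) (by norm_num) h

theorem toL2_apply (h : L1) (n : ℤ) : toL2 h n = h n := rfl

theorem L2.hasSum_sq (h : L2) : HasSum (fun n => h n ^ 2) (‖h‖ ^ 2) := by
  simpa using lp.hasSum_norm (p := 2) (by norm_num) h

theorem L2.bdd (h : L2) : ∀ n, |h n| ≤ ‖h‖ := fun n => by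
  simpa using lp.norm_apply_le_norm (by norm_num) h n

theorem norm_toL2_le (h : L1) : ‖toL2 h‖ ≤ ‖h‖ := by
  refine le_of_sq_le_sq ?_ (norm_nonneg h)
  rw [sq ‖h‖]
  refine hasSum_le (fun n => ?_) (L2.hasSum_sq (toL2 h)) ((L1.hasSum_abs h).mul_left ‖h‖)
  rw [toL2_apply, ← sq_abs, sq]
  exact mul_le_mul_of_nonneg_right (L1.bdd h n) (abs_nonneg _)

/-- The inclusion `ℓ¹ ⊆ ℓ²` as a continuous linear map. -/
def toL2L : L1 →L[ℝ] L2 :=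
  LinearMap.mkContinuous
    { toFun := toL2
      map_add' := fun _ _ => rfl
      map_smul' := fun _ _ => rfl } 1 fun h => by
      rw [one_mul]; exact norm_toL2_le h

theorem denseRange_toL2L : DenseRange toL2L := by
  intro f
  have h := lp.hasSum_single (p := 2) (by norm_num) f
  refine mem_closure_of_tendsto h (Filter.Eventually.of_forall fun s => ?_)
  refine Submodule.sum_mem (LinearMap.range toL2L.toLinearMap) fun n _ => ?_
  refine ⟨lp.single 1 n (f n), ?_⟩
  ext m
  rfl

instance instRealNormedSpaceOperators : NormedSpace ℝ (Hil →L[ℂ] Hil) :=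
  NormedSpace.complexToReal

instance instRealModuleOperators : Module ℝ (Hil →L[ℂ] Hil) :=
  instRealNormedSpaceOperators.toModule

/-- The map `h ↦ H` on `ℓ¹`. -/
def hopL : L1 →L[ℝ] (Hil →L[ℂ] Hil) :=
  LinearMap.mkContinuous
    { toFun := fun h => hop h
      map_add' := fun h k => by
        rw [← hop_add (L1.exists_bdd h) (L1.exists_bdd k)]; rfl
      map_smul' := fun c h => hop_smul c (L1.exists_bdd h) } 2 fun h => norm_hop_le (L1.bdd h)

@[simp] theorem hopL_apply (h : L1) : hopL h = hop h := rfl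

/-- The pairing of a bounded sequence with a summable one. -/
theorem summable_mul_bounded {E : Type*} [NormedAddCommGroup E] [NormedSpace ℝ E] [CompleteSpace E]
    (h : L1) {b : ℤ → E} {M : ℝ} (hb : ∀ n, ‖b n‖ ≤ M) :
    Summable (fun n => h n • b n) ∧ ‖∑' n, h n • b n‖ ≤ M * ‖h‖ := by
  have h1 : ∀ n, ‖h n • b n‖ ≤ M * |h n| := fun n => by
    rw [norm_smul, Real.norm_eq_abs, mul_comm]
    exact mul_le_mul_of_nonneg_right (hb n) (abs_nonneg _)
  have h2 := (L1.hasSum_abs h).mul_left M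
  exact ⟨Summable.of_norm_bounded h2.summable h1, tsum_of_norm_bounded h2 h1⟩

/-! ### The pairing `(h, X) ↦ Tr (H X)` -/

/-- The coefficient of `h n` in `Tr (H X)`. -/
def bond (n : ℤ) (X : Hil →L[ℂ] Hil) : ℂ :=
  inner ℂ (e (n + 1)) (X (e n)) + inner ℂ (e n) (X (e (n + 1)))

theorem norm_bond_le (n : ℤ) (X : Hil →L[ℂ] Hil) : ‖bond n X‖ ≤ 2 * ‖X‖ := by
  have h : ∀ m k, ‖inner ℂ (e m) (X (e k))‖ ≤ ‖X‖ := fun m k =>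
    (norm_inner_le_norm _ _).trans <| by
      rw [norm_e, one_mul]
      simpa [norm_e] using X.le_opNorm (e k)
  rw [two_mul]
  exact (norm_add_le _ _).trans (add_le_add (h _ _) (h _ _))

theorem bond_add (n : ℤ) (X Y : Hil →L[ℂ] Hil) : bond n (X + Y) = bond n X + bond n Y := by
  simp only [bond, add_apply, inner_add_right]; ring

theorem bond_smul (n : ℤ) (c : ℂ) (X : Hil →L[ℂ] Hil) : bond n (c • X) = c * bond n X := by
  simp only [bond, smul_apply, inner_smul_right]; ring

/-- The pairing `(h, X) ↦ Tr (H X) = ∑ h n * bond n X`. -/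
def pairing : L1 →L[ℝ] (Hil →L[ℂ] Hil) →L[ℝ] ℂ :=
  LinearMap.mkContinuous₂
    (LinearMap.mk₂ ℝ (fun h X => ∑' n, h n • bond n X)
      (fun h k X => by
        rw [← (summable_mul_bounded h (norm_bond_le · X)).1.tsum_add
          (summable_mul_bounded k (norm_bond_le · X)).1]
        exact tsum_congr fun n => add_smul (h n) (k n) _)
      (fun c h X => by
        rw [← (summable_mul_bounded h (norm_bond_le · X)).1.tsum_const_smul]
        exact tsum_congr fun n => mul_smul c (h n) _)
      (fun h X Y => by
        rw [← (summable_mul_bounded h (norm_bond_le · X)).1.tsum_add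
          (summable_mul_bounded h (norm_bond_le · Y)).1]
        exact tsum_congr fun n => by rw [bond_add, smul_add])
      (fun c h X => by
        rw [← (summable_mul_bounded h (norm_bond_le · X)).1.tsum_const_smul]
        refine tsum_congr fun n => ?_
        refine (congrArg (h n • ·) (bond_smul n c X)).trans ?_
        simp only [Complex.real_smul]
        ring)) 2
    fun h X => by
      refine (summable_mul_bounded h (norm_bond_le · X)).2.trans (le_of_eq ?_)
      ring

theorem pairing_apply (h : L1) (X : Hil →L[ℂ] Hil) : pairing h X = ∑' n, h n • bond n X := rfl

theorem norm_pairing_le (h : L1) (X : Hil →L[ℂ] Hil) : ‖pairing h X‖ ≤ 2 * ‖h‖ * ‖X‖ := by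
  refine (summable_mul_bounded h (norm_bond_le · X)).2.trans (le_of_eq ?_)
  ring

theorem pairing_smul (h : L1) (c : ℂ) (X : Hil →L[ℂ] Hil) :
    pairing h (c • X) = c * pairing h X := by
  simp only [pairing_apply, bond_smul]
  rw [← tsum_mul_left]
  exact tsum_congr fun n => by simp only [Complex.real_smul]; ring

/-! ### Traces of operators `A H C` with `h ∈ ℓ¹` -/

section TraceFormula

variable (h : L1) (A C : Hil →L[ℂ] Hil)

/-- The terms of the double series for `Tr (A H C)`. -/
def traceTerm (n m : ℤ) : ℂ :=
  (h n : ℂ) * (inner ℂ (e m) (A (e n)) * (C (e m)) (n + 1)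
    + inner ℂ (e m) (A (e (n + 1))) * (C (e m)) n)

theorem hasSum_traceTerm (m : ℤ) :
    HasSum (fun n => traceTerm h A C n m) (inner ℂ (e m) ((A * hop h * C) (e m))) := by
  have h1 := hasSum_inner_hop (L1.exists_bdd h) (A.adjoint (e m)) (C (e m))
  simp only [ContinuousLinearMap.adjoint_inner_left] at h1
  exact h1

theorem hasSum_matrix_mul (i j : ℤ) :
    HasSum (fun m => inner ℂ (e m) (A (e i)) * (C (e m)) j) (inner ℂ (e j) ((C * A) (e i))) := by
  have h1 := hasSum_inner_e_mul (C.adjoint (e j)) (A (e i))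
  simp only [ContinuousLinearMap.adjoint_inner_left, inner_e j] at h1
  have h2 : inner ℂ (e j) ((C * A) (e i)) = C (A (e i)) j := inner_e _ _
  rw [h2]
  simpa only [mul_comm] using h1

theorem norm_apply_e_le (X : Hil →L[ℂ] Hil) (i : ℤ) : ‖X (e i)‖ ≤ ‖X‖ := by
  simpa [norm_e] using X.le_opNorm (e i)

/-- Cauchy–Schwarz between column `i` of `A` and row `j` of `C`; the row is a column of the adjoint.
-/
theorem summable_matrix_mul_norm (i j : ℤ) :
    Summable (fun m => ‖inner ℂ (e m) (A (e i)) * (C (e m)) j‖) ∧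
      ∑' m, ‖inner ℂ (e m) (A (e i)) * (C (e m)) j‖ ≤ ‖A‖ * ‖C‖ := by
  have h0 : ∀ m, ‖inner ℂ (e m) (A (e i)) * (C (e m)) j‖
      = ‖A (e i) m‖ * ‖(C.adjoint (e j)) m‖ := fun m => by
    rw [norm_mul, inner_e, ← norm_sq_inner_e m (C.adjoint (e j)),
      ContinuousLinearMap.adjoint_inner_left, inner_e]
  simp only [h0]
  refine ⟨summable_norm_mul_norm _ _, (tsum_norm_mul_norm_le _ _).trans ?_⟩
  refine mul_le_mul (norm_apply_e_le A i) ?_ (norm_nonneg _) (norm_nonneg _)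
  rw [← LinearIsometryEquiv.norm_map ContinuousLinearMap.adjoint C]
  exact norm_apply_e_le _ j

theorem hasSum_traceTerm_swap (n : ℤ) :
    HasSum (fun m => traceTerm h A C n m) (h n • bond n (C * A)) := by
  rw [Complex.real_smul, bond]
  exact ((hasSum_matrix_mul A C n (n + 1)).add (hasSum_matrix_mul A C (n + 1) n)).mul_left _

theorem summable_norm_traceTerm (n : ℤ) :
    Summable (fun m => ‖traceTerm h A C n m‖) ∧
      ∑' m, ‖traceTerm h A C n m‖ ≤ 2 * ‖A‖ * ‖C‖ * |h n| := by
  obtain ⟨s1, b1⟩ := summable_matrix_mul_norm A C n (n + 1)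
  obtain ⟨s2, b2⟩ := summable_matrix_mul_norm A C (n + 1) n
  have hle : ∀ m, ‖traceTerm h A C n m‖ ≤ |h n| * (‖inner ℂ (e m) (A (e n)) * (C (e m)) (n + 1)‖
      + ‖inner ℂ (e m) (A (e (n + 1))) * (C (e m)) n‖) := fun m => by
    rw [traceTerm, norm_mul, Complex.norm_real, Real.norm_eq_abs]
    exact mul_le_mul_of_nonneg_left (norm_add_le _ _) (abs_nonneg _)
  have s3 := (s1.add s2).mul_left |h n|
  have s4 := Summable.of_nonneg_of_le (fun m => norm_nonneg _) hle s3
  refine ⟨s4, (s4.tsum_le_tsum hle s3).trans ?_⟩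
  rw [tsum_mul_left, s1.tsum_add s2]
  calc _ ≤ |h n| * (‖A‖ * ‖C‖ + ‖A‖ * ‖C‖) :=
        mul_le_mul_of_nonneg_left (add_le_add b1 b2) (abs_nonneg _)
    _ = _ := by ring

theorem summable_norm_traceTerm_prod :
    Summable fun p : ℤ × ℤ => ‖traceTerm h A C p.1 p.2‖ := by
  rw [summable_prod_of_nonneg fun _ => norm_nonneg _]
  refine ⟨fun n => (summable_norm_traceTerm h A C n).1, ?_⟩
  exact Summable.of_nonneg_of_le (fun n => tsum_nonneg fun _ => norm_nonneg _)
    (fun n => (summable_norm_traceTerm h A C n).2) ((L1.hasSum_abs h).summable.mul_left _)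

/-- The double series `traceTerm` converges absolutely. Summed over bonds first it gives the
diagonal entries of `A H C`; summed over basis vectors first it gives the bond coefficients of `C
A`. This is the cyclicity of the trace, obtained by Fubini. -/
theorem hasSum_trace_mul_hop_mul :
    HasSum (fun m => inner ℂ (e m) ((A * hop h * C) (e m))) (pairing h (C * A)) := by
  have hs : Summable fun p : ℤ × ℤ => traceTerm h A C p.1 p.2 :=
    (summable_norm_traceTerm_prod h A C).of_norm
  have h1 : HasSum (fun n => h n • bond n (C * A)) (∑' p : ℤ × ℤ, traceTerm h A C p.1 p.2) :=
    hs.hasSum.prod_fiberwise fun n => hasSum_traceTerm_swap h A C n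
  have h2 : HasSum (fun m => inner ℂ (e m) ((A * hop h * C) (e m)))
      (∑' p : ℤ × ℤ, traceTerm h A C p.1 p.2) := by
    have := ((Equiv.prodComm ℤ ℤ).hasSum_iff.2 hs.hasSum)
    exact this.prod_fiberwise fun m => hasSum_traceTerm h A C m
  rw [pairing_apply, h1.tsum_eq]
  exact h2

theorem trace_mul_hop_mul : trace (A * hop h * C) = pairing h (C * A) :=
  (hasSum_trace_mul_hop_mul h A C).tsum_eq

/-- The bound does not depend on `s` and depends on `A` only through its norm, so it persists after
left multiplication by a contraction, as the trace class criterion requires. -/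
theorem sum_norm_trace_mul_hop_mul_le (s : Finset ℤ) :
    ∑ m ∈ s, ‖inner ℂ (e m) ((A * hop h * C) (e m))‖ ≤ 2 * ‖A‖ * ‖C‖ * ‖h‖ := by
  have hs := summable_norm_traceTerm_prod h A C
  have hsw : Summable fun p : ℤ × ℤ => ‖traceTerm h A C p.2 p.1‖ :=
    hs.prod_symm
  have hfib : ∀ m, Summable fun n => ‖traceTerm h A C n m‖ := fun m => hsw.prod_factor m
  have h1 : ∀ m, ‖inner ℂ (e m) ((A * hop h * C) (e m))‖ ≤ ∑' n, ‖traceTerm h A C n m‖ :=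
    fun m => by
      rw [← (hasSum_traceTerm h A C m).tsum_eq]
      exact norm_tsum_le_tsum_norm (hfib m)
  calc ∑ m ∈ s, ‖inner ℂ (e m) ((A * hop h * C) (e m))‖
      ≤ ∑ m ∈ s, ∑' n, ‖traceTerm h A C n m‖ := Finset.sum_le_sum fun m _ => h1 m
    _ ≤ ∑' m, ∑' n, ‖traceTerm h A C n m‖ :=
        Summable.sum_le_tsum (f := fun m => ∑' n, ‖traceTerm h A C n m‖) s (fun m _ => tsum_nonneg fun _ => norm_nonneg _) hsw.prod
    _ = ∑' n, ∑' m, ‖traceTerm h A C n m‖ :=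
        Summable.tsum_comm (f := fun n m => ‖traceTerm h A C n m‖) hs
    _ ≤ ∑' n, 2 * ‖A‖ * ‖C‖ * |h n| :=
        hs.prod.tsum_le_tsum (fun n => (summable_norm_traceTerm h A C n).2)
          ((L1.hasSum_abs h).summable.mul_left _)
    _ = _ := by rw [tsum_mul_left, (L1.hasSum_abs h).tsum_eq]

end TraceFormula

/-! ### A criterion for trace class operators -/

/-- For `ε > 0` there is a contraction `B` with `‖|A| - B A‖ ≤ ε`. -/
theorem exists_contraction_abs {𝔸 : Type*} [CStarAlgebra 𝔸] [PartialOrder 𝔸] [StarOrderedRing 𝔸]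
    (A : 𝔸) {ε : ℝ} (hε : 0 < ε) :
    ∃ B : 𝔸, ‖B‖ ≤ 1 ∧ ‖CFC.abs A - B * A‖ ≤ ε := by
  have hP : 0 ≤ CFC.abs A := CFC.abs_nonneg A
  have hsa : IsSelfAdjoint (CFC.abs A) := hP.isSelfAdjoint
  have hsq : CFC.abs A * CFC.abs A = star A * A := CFC.abs_mul_abs A
  have hpos : ∀ x ∈ spectrum ℝ (CFC.abs A), 0 ≤ x := fun x hx => spectrum_nonneg_of_nonneg hP hx
  set P := CFC.abs A with hPdef
  let f : ℝ → ℝ := fun x => (x + ε)⁻¹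
  have hf : ContinuousOn f (spectrum ℝ P) := by
    refine ContinuousOn.inv₀ (by fun_prop) fun x hx => ?_
    have := hpos x hx
    positivity
  set G := cfc f P with hG
  have hGsa : star G = G := (cfc_predicate f P : IsSelfAdjoint _)
  have hPid : P = cfc (fun x : ℝ => x) P := (cfc_id' ℝ P).symm
  have hGPPG : G * (P * P) * G = cfc (fun x => f x * (x * x) * f x) P := by
    rw [cfc_mul (fun x => f x * (x * x)) f P (by fun_prop) hf,
      cfc_mul f (fun x => x * x) P hf (by fun_prop),
      cfc_mul (fun x => x) (fun x => x) P (by fun_prop) (by fun_prop), cfc_id' ℝ P]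
  have hGPP : P - G * (P * P) = cfc (fun x => x - f x * (x * x)) P := by
    rw [cfc_sub (fun x => x) (fun x => f x * (x * x)) P (by fun_prop) (by fun_prop),
      cfc_mul f (fun x => x * x) P hf (by fun_prop),
      cfc_mul (fun x => x) (fun x => x) P (by fun_prop) (by fun_prop), cfc_id' ℝ P]
  -- `B = (|A| + ε)⁻¹ A*` regularizes the adjoint of the polar isometry: `B A = (|A| + ε)⁻¹ |A|²`,
  -- and both estimates reduce to `x / (x + ε) ≤ 1` on the spectrum of `|A|`.
  refine ⟨G * star A, ?_, ?_⟩
  · have h1 : ‖G * star A‖ * ‖G * star A‖ ≤ 1 := by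
      rw [← CStarRing.norm_self_mul_star, star_mul, star_star, hGsa]
      have : G * star A * (A * G) = G * (P * P) * G := by
        rw [hsq]; simp only [mul_assoc]
      rw [this, hGPPG]
      refine norm_cfc_le zero_le_one fun x hx => ?_
      have hx0 := hpos x hx
      have : f x * (x * x) * f x = (x / (x + ε)) ^ 2 := by
        simp only [f]; field_simp
      rw [this, Real.norm_eq_abs, abs_of_nonneg (by positivity)]
      refine pow_le_one₀ (by positivity) ?_
      rw [div_le_one (by positivity)]
      linarith
    nlinarith [norm_nonneg (G * star A)]
  · rw [mul_assoc, ← hsq, hGPP]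
    refine norm_cfc_le hε.le fun x hx => ?_
    have hx0 := hpos x hx
    have : x - f x * (x * x) = ε * (x / (x + ε)) := by
      simp only [f]; field_simp; ring
    rw [this, Real.norm_eq_abs, abs_of_nonneg (by positivity)]
    refine mul_le_of_le_one_right hε.le ?_
    rw [div_le_one (by positivity)]
    linarith

/-- Over finitely many basis vectors, the diagonal of `|A|` is approximated by that of `B A` with
`B` a contraction. The error per vector is taken as `ε / (card + 1)`, so the total stays below `ε`.
-/
theorem isTraceClass_of_forall_contraction {A : Hil →L[ℂ] Hil} {K : ℝ}
    (hK : ∀ B : Hil →L[ℂ] Hil, ‖B‖ ≤ 1 → ∀ s : Finset ℤ,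
      ∑ m ∈ s, ‖inner ℂ (e m) ((B * A) (e m))‖ ≤ K) : IsTraceClass A := by
  have hP : 0 ≤ absOp A := CFC.abs_nonneg A
  have hnn : ∀ m : ℤ, 0 ≤ (inner ℂ (e m) (absOp A (e m))).re := fun m =>
    ((ContinuousLinearMap.nonneg_iff_isPositive _).1 hP).re_inner_nonneg_right (e m)
  refine summable_of_sum_le hnn (c := K) fun s => ?_
  refine le_of_forall_pos_le_add fun ε hε => ?_
  have hε' : 0 < ε / (s.card + 1) := by positivity
  obtain ⟨B, hB, hBA⟩ := exists_contraction_abs A hε'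
  have h1 : ∀ m, (inner ℂ (e m) (absOp A (e m))).re ≤
      ‖inner ℂ (e m) ((B * A) (e m))‖ + ε / (s.card + 1) := fun m => by
    have h2 : inner ℂ (e m) (absOp A (e m)) = inner ℂ (e m) ((B * A) (e m))
        + inner ℂ (e m) ((absOp A - B * A) (e m)) := by
      rw [← inner_add_right]; simp
    rw [h2]
    refine (Complex.re_le_norm _).trans ((norm_add_le _ _).trans ?_)
    gcongr
    refine (norm_inner_le_norm _ _).trans ?_
    rw [norm_e, one_mul]
    exact (norm_apply_e_le _ _).trans hBA
  calc _ ≤ ∑ m ∈ s, (‖inner ℂ (e m) ((B * A) (e m))‖ + ε / (s.card + 1)) :=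
        Finset.sum_le_sum fun m _ => h1 m
    _ = ∑ m ∈ s, ‖inner ℂ (e m) ((B * A) (e m))‖ + s.card * (ε / (s.card + 1)) := by
        rw [Finset.sum_add_distrib, Finset.sum_const, nsmul_eq_mul]
    _ ≤ K + ε := by
        refine add_le_add (hK B hB s) ?_
        rw [mul_div_assoc', div_le_iff₀ (by positivity)]
        nlinarith

theorem isTraceClass_mul_hop_mul (h : L1) (A C : Hil →L[ℂ] Hil) :
    IsTraceClass (A * hop h * C) := by
  refine isTraceClass_of_forall_contraction (K := 2 * ‖A‖ * ‖C‖ * ‖h‖) fun B hB s => ?_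
  have h1 := sum_norm_trace_mul_hop_mul_le h (B * A) C s
  simp only [← mul_assoc]
  refine h1.trans ?_
  have : ‖B * A‖ ≤ ‖A‖ := (norm_mul_le _ _).trans (mul_le_of_le_one_left (norm_nonneg _) hB)
  gcongr

theorem isTraceClass_neg {A : Hil →L[ℂ] Hil} (hA : IsTraceClass A) : IsTraceClass (-A) := by
  have : absOp (-A) = absOp A := by simp [absOp, CFC.abs_neg]
  rw [IsTraceClass, this]
  exact hA

/-! ### The Hilbert–Schmidt bound -/

theorem e_apply (n m : ℤ) : e n m = if m = n then 1 else 0 := by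
  rw [e, lp.single_apply]
  by_cases h : m = n
  · subst h; simp
  · simp [h]

theorem hop_e {a : ℤ → ℝ} (ha : ∃ M : ℝ, ∀ n, |a n| ≤ M) (m : ℤ) :
    hop a (e m) = (a (m - 1) : ℂ) • e (m - 1) + (a m : ℂ) • e (m + 1) := by
  ext n
  rw [hop_apply ha]
  change _ = (a (m - 1) : ℂ) * e (m - 1) n + (a m : ℂ) * e (m + 1) n
  simp only [e_apply]
  congr 1
  · by_cases h : n = m - 1
    · subst h; simp
    · rw [if_neg h, if_neg (by omega)]; simp
  · by_cases h : n = m + 1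
    · subst h; simp
    · rw [if_neg h, if_neg (by omega)]; simp

theorem norm_hop_e_sq_le (h : L1) (m : ℤ) :
    ‖hop h (e m)‖ ^ 2 ≤ 2 * (h (m - 1) ^ 2 + h m ^ 2) := by
  have h1 : ‖hop h (e m)‖ ≤ |h (m - 1)| + |h m| := by
    rw [hop_e (L1.exists_bdd h)]
    refine (norm_add_le _ _).trans (le_of_eq ?_)
    rw [norm_smul, norm_smul, norm_e, norm_e, Complex.norm_real, Complex.norm_real, mul_one, mul_one]
    rfl
  calc _ ≤ (|h (m - 1)| + |h m|) ^ 2 := by gcongr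
    _ ≤ _ := by nlinarith [sq_nonneg (|h (m - 1)| - |h m|), sq_abs (h (m - 1)), sq_abs (h m)]

theorem hilbertSchmidt_hop (h : L1) :
    Summable (fun m => ‖hop h (e m)‖ ^ 2) ∧ ∑' m, ‖hop h (e m)‖ ^ 2 ≤ 4 * ‖toL2 h‖ ^ 2 := by
  have h1 : HasSum (fun m => h m ^ 2) (‖toL2 h‖ ^ 2) := L2.hasSum_sq (toL2 h)
  have h2 : HasSum (fun m => h (m - 1) ^ 2) (‖toL2 h‖ ^ 2) :=
    ((Equiv.subRight (1 : ℤ)).hasSum_iff (f := fun m => h m ^ 2)).2 h1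
  have h3 := (h2.add h1).mul_left 2
  have hs := Summable.of_nonneg_of_le (fun _ => sq_nonneg _) (norm_hop_e_sq_le h) h3.summable
  refine ⟨hs, (hasSum_le (norm_hop_e_sq_le h) hs.hasSum h3).trans (le_of_eq (by ring))⟩

/-- Tonelli for the squared moduli of the matrix entries, summed by columns or by rows. -/
theorem hilbertSchmidt_adjoint {X : Hil →L[ℂ] Hil} (hX : Summable fun n => ‖X (e n)‖ ^ 2) :
    HasSum (fun m => ‖X.adjoint (e m)‖ ^ 2) (∑' n, ‖X (e n)‖ ^ 2) := by
  have hs : Summable fun p : ℤ × ℤ => ‖X (e p.1) p.2‖ ^ 2 := by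
    rw [summable_prod_of_nonneg fun _ => sq_nonneg _]
    refine ⟨fun n => (hasSum_norm_sq (X (e n))).summable, ?_⟩
    simpa only [(hasSum_norm_sq _).tsum_eq] using hX
  have h1 : HasSum (fun n => ‖X (e n)‖ ^ 2) (∑' p : ℤ × ℤ, ‖X (e p.1) p.2‖ ^ 2) :=
    hs.hasSum.prod_fiberwise fun n => hasSum_norm_sq (X (e n))
  have h2 := (Equiv.prodComm ℤ ℤ).hasSum_iff.2 hs.hasSum
  rw [h1.tsum_eq]
  refine h2.prod_fiberwise fun m => ?_
  have h3 : ∀ n, ‖X (e n) m‖ = ‖X.adjoint (e m) n‖ := fun n => by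
    rw [← norm_sq_inner_e n, ContinuousLinearMap.adjoint_inner_left, inner_e]
  refine (hasSum_norm_sq (X.adjoint (e m))).congr_fun fun n => ?_
  exact congrArg (· ^ 2) (h3 n)

theorem hilbertSchmidt_mul {X : Hil →L[ℂ] Hil} {K : ℝ} (A : Hil →L[ℂ] Hil)
    (hX : Summable (fun n => ‖X (e n)‖ ^ 2) ∧ ∑' n, ‖X (e n)‖ ^ 2 ≤ K ^ 2) :
    Summable (fun n => ‖(A * X) (e n)‖ ^ 2) ∧ ∑' n, ‖(A * X) (e n)‖ ^ 2 ≤ (‖A‖ * K) ^ 2 := by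
  have h1 : ∀ n, ‖(A * X) (e n)‖ ^ 2 ≤ ‖A‖ ^ 2 * ‖X (e n)‖ ^ 2 := fun n => by
    rw [← mul_pow]
    gcongr
    exact A.le_opNorm _
  have h2 := hX.1.mul_left (‖A‖ ^ 2)
  have hs := Summable.of_nonneg_of_le (fun _ => sq_nonneg _) h1 h2
  refine ⟨hs, (hs.tsum_le_tsum h1 h2).trans ?_⟩
  rw [tsum_mul_left, mul_pow]
  exact mul_le_mul_of_nonneg_left hX.2 (sq_nonneg _)

/-- Left factors are estimated column by column. The right factor becomes a left one after taking
adjoints, `H B = (B* H)*`, because `H` is self-adjoint. -/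
theorem hilbertSchmidt_mul_hop_mul (h : L1) (A B : Hil →L[ℂ] Hil) :
    Summable (fun n => ‖(A * hop h * B) (e n)‖ ^ 2) ∧
      ∑' n, ‖(A * hop h * B) (e n)‖ ^ 2 ≤ (‖A‖ * (‖B‖ * (2 * ‖toL2 h‖))) ^ 2 := by
  have h0 : Summable (fun m => ‖hop h (e m)‖ ^ 2) ∧
      ∑' m, ‖hop h (e m)‖ ^ 2 ≤ (2 * ‖toL2 h‖) ^ 2 := by
    convert hilbertSchmidt_hop h using 2
    ring
  have h1 := hilbertSchmidt_mul B.adjoint h0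
  have h2 := hilbertSchmidt_adjoint h1.1
  have h3 : (B.adjoint * hop h).adjoint = hop h * B := by
    have hsa : star (hop h) = hop h := isSelfAdjoint_hop (L1.exists_bdd h)
    rw [← ContinuousLinearMap.star_eq_adjoint, ← ContinuousLinearMap.star_eq_adjoint, star_mul,
      star_star, hsa]
  rw [h3] at h2
  rw [LinearIsometryEquiv.norm_map] at h1
  have h4 := hilbertSchmidt_mul A ⟨h2.summable, h2.tsum_eq.le.trans h1.2⟩
  simpa only [mul_assoc] using h4

/-- Cauchy–Schwarz between `k` and the column norms of the Hilbert–Schmidt operator `A H B`. Only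
`ℓ²` norms survive, which is what the cubic remainder and the extension of the Hessian need. -/
theorem norm_pairing_mul_hop_mul_le (k h : L1) (A B : Hil →L[ℂ] Hil) :
    ‖pairing k (A * hop h * B)‖ ≤ 4 * ‖A‖ * ‖B‖ * ‖toL2 k‖ * ‖toL2 h‖ := by
  obtain ⟨hs, hb⟩ := hilbertSchmidt_mul_hop_mul h A B
  set X := A * hop h * B
  have hs' : Summable (fun n => ‖X (e (n + 1))‖ ^ 2) :=
    ((Equiv.addRight (1 : ℤ)).summable_iff (f := fun n => ‖X (e n)‖ ^ 2)).2 hs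
  have hb' : ∑' n, ‖X (e (n + 1))‖ ^ 2 ≤ (‖A‖ * (‖B‖ * (2 * ‖toL2 h‖))) ^ 2 :=
    ((Equiv.addRight (1 : ℤ)).tsum_eq fun n => ‖X (e n)‖ ^ 2).le.trans hb
  have hk : HasSum (fun n => |k n| ^ 2) (‖toL2 k‖ ^ 2) := by
    simp only [sq_abs]
    exact L2.hasSum_sq (toL2 k)
  have hK : 0 ≤ ‖A‖ * (‖B‖ * (2 * ‖toL2 h‖)) := by positivity
  have t1 := tsum_mul_le_of_sq (norm_nonneg (toL2 k)) hK (fun n => abs_nonneg (k n))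
    (fun n => norm_nonneg (X (e n))) hk.summable hs hk.tsum_eq.le hb
  have t2 := tsum_mul_le_of_sq (norm_nonneg (toL2 k)) hK (fun n => abs_nonneg (k n))
    (fun n => norm_nonneg (X (e (n + 1)))) hk.summable hs' hk.tsum_eq.le hb'
  have s1 := summable_mul_of_sq hk.summable hs
  have s2 := summable_mul_of_sq hk.summable hs'
  have hle : ∀ n, ‖k n • bond n X‖ ≤ |k n| * ‖X (e n)‖ + |k n| * ‖X (e (n + 1))‖ := fun n => by
    rw [norm_smul, Real.norm_eq_abs, ← mul_add]
    refine mul_le_mul_of_nonneg_left ((norm_add_le _ _).trans (add_le_add ?_ ?_)) (abs_nonneg _)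
    · exact (norm_inner_le_norm _ _).trans (by rw [norm_e, one_mul])
    · exact (norm_inner_le_norm _ _).trans (by rw [norm_e, one_mul])
  rw [pairing_apply]
  refine (tsum_of_norm_bounded (s1.add s2).hasSum hle).trans ?_
  rw [s1.tsum_add s2]
  refine (add_le_add t1 t2).trans (le_of_eq ?_)
  ring

/-! ### Regularity of contours -/

theorem exists_consecutive {S : Finset ℝ} (h0 : (0 : ℝ) ∈ S)
    (h1 : (1 : ℝ) ∈ S) {s : ℝ} (hs : s ∈ Set.Icc (0 : ℝ) 1) :
    ∃ a ∈ S, ∃ b ∈ S, a < b ∧ Disjoint (Set.Ioo a b) (S : Set ℝ) ∧ s ∈ Set.Icc a b := by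
  rcases hs.2.lt_or_eq with hlt | rfl
  · have hA : (S.filter (· ≤ s)).Nonempty := ⟨0, by simp [h0, hs.1]⟩
    have hB : (S.filter (s < ·)).Nonempty := ⟨1, by simp [h1, hlt]⟩
    have ha := Finset.mem_filter.1 (Finset.max'_mem _ hA)
    have hb := Finset.mem_filter.1 (Finset.min'_mem _ hB)
    refine ⟨_, ha.1, _, hb.1, ha.2.trans_lt hb.2, ?_, ha.2, hb.2.le⟩
    rw [Set.disjoint_left]
    intro x hx hxS
    rcases le_or_gt x s with h | h
    · exact absurd (Finset.le_max' _ x (Finset.mem_filter.2 ⟨hxS, h⟩)) (not_le.2 hx.1)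
    · exact absurd (Finset.min'_le _ x (Finset.mem_filter.2 ⟨hxS, h⟩)) (not_le.2 hx.2)
  · have hA : (S.filter (· < (1 : ℝ))).Nonempty := ⟨0, by simp [h0]⟩
    have ha := Finset.mem_filter.1 (Finset.max'_mem _ hA)
    refine ⟨_, ha.1, 1, h1, ha.2, ?_, ha.2.le, le_rfl⟩
    rw [Set.disjoint_left]
    intro x hx hxS
    exact absurd (Finset.le_max' _ x (Finset.mem_filter.2 ⟨hxS, hx.2⟩)) (not_le.2 hx.1)

theorem Contour.continuousOn (γ : Contour) : ContinuousOn γ.toFun (Set.Icc 0 1) := by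
  obtain ⟨S, hS, h0, h1, hC⟩ := γ.piecewise_C1
  let ι := {p : S × S // p.1.1 < p.2.1 ∧ Disjoint (Set.Ioo p.1.1 p.2.1) (S : Set ℝ)}
  have hu : ContinuousOn γ.toFun (⋃ p : ι, Set.Icc p.1.1.1 p.1.2.1) :=
    (locallyFinite_of_finite _).continuousOn_iUnion (fun _ => isClosed_Icc) fun p =>
      (hC _ p.1.1.2 _ p.1.2.2 p.2.1 p.2.2).continuousOn
  refine hu.mono fun s hs => ?_
  obtain ⟨a, ha, b, hb, hab, hd, hsab⟩ := exists_consecutive h0 h1 hs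
  exact Set.mem_iUnion.2 ⟨⟨(⟨a, ha⟩, ⟨b, hb⟩), hab, hd⟩, hsab⟩

/-- On each closed piece the one-sided derivative is continuous on a compact interval, hence
bounded; in the interior of the piece it is the derivative. The breakpoints are left out because the
two sides may disagree there. -/
theorem Contour.exists_deriv_bound (γ : Contour) : ∃ (S : Finset ℝ) (C : ℝ), 0 ≤ C ∧
    ∀ s ∈ Set.Icc (0 : ℝ) 1, s ∉ S →
      DifferentiableAt ℝ γ.toFun s ∧ ‖deriv γ.toFun s‖ ≤ C := by
  obtain ⟨S, hS, h0, h1, hC⟩ := γ.piecewise_C1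
  let ι := {p : S × S // p.1.1 < p.2.1 ∧ Disjoint (Set.Ioo p.1.1 p.2.1) (S : Set ℝ)}
  have hb : ∀ p : ι, ∃ K, ∀ s ∈ Set.Ioo p.1.1.1 p.1.2.1,
      DifferentiableAt ℝ γ.toFun s ∧ ‖deriv γ.toFun s‖ ≤ K := fun p => by
    have hcd := hC _ p.1.1.2 _ p.1.2.2 p.2.1 p.2.2
    obtain ⟨K, hK⟩ := isCompact_Icc.exists_bound_of_continuousOn
      (hcd.continuousOn_derivWithin (uniqueDiffOn_Icc p.2.1) le_rfl)
    refine ⟨K, fun s hs => ?_⟩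
    have hn : Set.Icc p.1.1.1 p.1.2.1 ∈ nhds s := Icc_mem_nhds hs.1 hs.2
    refine ⟨(hcd.differentiableOn one_ne_zero s (Set.Ioo_subset_Icc_self hs)).differentiableAt hn, ?_⟩
    rw [← derivWithin_of_mem_nhds hn]
    exact hK s (Set.Ioo_subset_Icc_self hs)
  choose K hK using hb
  obtain ⟨C, hCK⟩ := (Set.finite_range K).bddAbove
  refine ⟨S, max C 0, le_max_right _ _, fun s hs hsS => ?_⟩
  obtain ⟨a, ha, b, hb, hab, hd, hsab⟩ := exists_consecutive h0 h1 hs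
  have hmem : s ∈ Set.Ioo a b :=
    ⟨hsab.1.lt_of_ne fun h => hsS (h ▸ ha), hsab.2.lt_of_ne fun h => hsS (h ▸ hb)⟩
  obtain ⟨h2, h3⟩ := hK ⟨(⟨a, ha⟩, ⟨b, hb⟩), hab, hd⟩ s hmem
  exact ⟨h2, h3.trans ((hCK ⟨_, rfl⟩).trans (le_max_left _ _))⟩

/-- A bound for the speed of a contour. -/
def Contour.speed (γ : Contour) : ℝ := γ.exists_deriv_bound.choose_spec.choose

theorem Contour.speed_nonneg (γ : Contour) : 0 ≤ γ.speed :=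
  γ.exists_deriv_bound.choose_spec.choose_spec.1

open MeasureTheory in
theorem Contour.ae_norm_deriv_le (γ : Contour) :
    ∀ᵐ s ∂volume.restrict (Set.Ioc (0 : ℝ) 1), ‖deriv γ.toFun s‖ ≤ γ.speed := by
  have h := γ.exists_deriv_bound.choose_spec.choose_spec.2
  have hS : (volume.restrict (Set.Ioc (0 : ℝ) 1)) (γ.exists_deriv_bound.choose : Set ℝ) = 0 :=
    (Finset.countable_toSet _).measure_zero _
  filter_upwards [ae_restrict_mem measurableSet_Ioc, compl_mem_ae_iff.2 hS] with s hs hsS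
  exact (h s ⟨hs.1.le, hs.2⟩ hsS).2

/-- The contour as a continuous function on the unit interval. -/
def Contour.path (γ : Contour) : C(unitInterval, ℂ) where
  toFun s := γ.toFun s
  continuous_toFun := γ.continuousOn.domRestrict

theorem Contour.path_mem (γ : Contour) (s : unitInterval) : γ.path s ∈ γ.points := ⟨s, s.2, rfl⟩

/-! ### Contour integrals of continuous functions -/

section ContourIntegral

open MeasureTheory

variable {V : Type*} [NormedAddCommGroup V]

/-- The extension of a function on the unit interval to `ℝ`. -/
def extendI (f : C(unitInterval, V)) (s : ℝ) : V := f (Set.projIcc 0 1 zero_le_one s)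

theorem continuous_extendI (f : C(unitInterval, V)) : Continuous (extendI f) :=
  f.continuous.comp continuous_projIcc

theorem extendI_of_mem (f : C(unitInterval, V)) {s : ℝ} (hs : s ∈ Set.Icc (0 : ℝ) 1) :
    extendI f s = f ⟨s, hs⟩ := by
  rw [extendI, Set.projIcc_of_mem]

theorem integral_norm_extendI_le (f : C(unitInterval, V)) :
    ∫ s in (0 : ℝ)..1, ‖extendI f s‖ ≤ ‖f‖ := by
  have h : ∫ s in (0 : ℝ)..1, ‖extendI f s‖ ≤ ∫ _ in (0 : ℝ)..1, ‖f‖ :=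
    intervalIntegral.integral_mono_on zero_le_one
      ((continuous_extendI f).norm.intervalIntegrable 0 1) (by simp)
      fun s _ => f.norm_coe_le_norm _
  simpa using h

variable [NormedSpace ℂ V]

theorem intervalIntegrable_contour (γ : Contour) (f : C(unitInterval, V)) :
    IntervalIntegrable (fun s => deriv γ.toFun s • extendI f s) volume 0 1 := by
  rw [intervalIntegrable_iff_integrableOn_Ioc_of_le zero_le_one]
  refine Integrable.of_bound (C := γ.speed * ‖f‖) ?_ ?_
  · exact ((measurable_deriv γ.toFun).aestronglyMeasurable).smul
      (continuous_extendI f).aestronglyMeasurable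
  · filter_upwards [γ.ae_norm_deriv_le] with s hs
    rw [norm_smul]
    exact mul_le_mul hs (f.norm_coe_le_norm _) (norm_nonneg _) γ.speed_nonneg

/-- The constant in the bound for contour integrals. -/
def Contour.len (γ : Contour) : ℝ := ‖(2 * (Real.pi : ℂ) * Complex.I)⁻¹‖ * γ.speed

theorem Contour.len_nonneg (γ : Contour) : 0 ≤ γ.len :=
  mul_nonneg (norm_nonneg _) γ.speed_nonneg

/-- The integral of the norm is kept instead of the supremum: sums over diagonal coefficients can
then be moved inside the integral before they are estimated. -/
theorem norm_contour_integral_le (γ : Contour) (f : C(unitInterval, V)) :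
    ‖(2 * (Real.pi : ℂ) * Complex.I)⁻¹ • ∫ s in (0 : ℝ)..1, deriv γ.toFun s • extendI f s‖
      ≤ γ.len * ∫ s in (0 : ℝ)..1, ‖extendI f s‖ := by
  rw [norm_smul, Contour.len, mul_assoc ‖(2 * (Real.pi : ℂ) * Complex.I)⁻¹‖]
  refine mul_le_mul_of_nonneg_left ?_ (norm_nonneg _)
  rw [← intervalIntegral.integral_const_mul]
  refine intervalIntegral.norm_integral_le_of_norm_le zero_le_one ?_
    (Continuous.intervalIntegrable (by have := continuous_extendI f; fun_prop) 0 1)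
  have h := γ.ae_norm_deriv_le
  rw [ae_restrict_iff' measurableSet_Ioc] at h
  filter_upwards [h] with s hs hs'
  rw [norm_smul]
  exact mul_le_mul_of_nonneg_right (hs hs') (norm_nonneg _)

/-- The normalized contour integral `(2 i π)⁻¹ ∮ f`, for a continuous function of the parameter. -/
def contourInt (γ : Contour) : C(unitInterval, V) →L[ℂ] V :=
  LinearMap.mkContinuous
    { toFun := fun f => (2 * (Real.pi : ℂ) * Complex.I)⁻¹ •
        ∫ s in (0 : ℝ)..1, deriv γ.toFun s • extendI f s
      map_add' := fun f g => by
        rw [← smul_add, ← intervalIntegral.integral_add (intervalIntegrable_contour γ f)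
          (intervalIntegrable_contour γ g)]
        simp [extendI, smul_add]
      map_smul' := fun c f => by
        rw [RingHom.id_apply, smul_comm c]
        congr 1
        rw [← intervalIntegral.integral_smul]
        congr 1 with s
        exact smul_comm _ _ _ } γ.len
    fun f => (norm_contour_integral_le γ f).trans
      (mul_le_mul_of_nonneg_left (integral_norm_extendI_le f) γ.len_nonneg)

theorem contourInt_apply (γ : Contour) (f : C(unitInterval, V)) :
    contourInt γ f = (2 * (Real.pi : ℂ) * Complex.I)⁻¹ •
      ∫ s in (0 : ℝ)..1, deriv γ.toFun s • extendI f s := rfl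

theorem norm_contourInt_le (γ : Contour) (f : C(unitInterval, V)) :
    ‖contourInt γ f‖ ≤ γ.len * ∫ s in (0 : ℝ)..1, ‖extendI f s‖ :=
  norm_contour_integral_le γ f

theorem norm_contourInt_le_of_forall (γ : Contour) (f : C(unitInterval, V)) {K : ℝ} (hK : 0 ≤ K)
    (hf : ∀ s, ‖f s‖ ≤ K) : ‖contourInt γ f‖ ≤ γ.len * K :=
  (norm_contourInt_le γ f).trans (mul_le_mul_of_nonneg_left
    ((integral_norm_extendI_le f).trans ((ContinuousMap.norm_le _ hK).2 hf)) γ.len_nonneg)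

theorem cauchyInt_eq_contourInt (γ : Contour) (F : ℂ → V) (f : C(unitInterval, V))
    (h : ∀ s, F (γ.path s) = f s) : cauchyInt γ.toFun F = contourInt γ f := by
  rw [cauchyInt, curveInt, contourInt_apply]
  congr 1
  refine intervalIntegral.integral_congr fun s hs => ?_
  rw [Set.uIcc_of_le zero_le_one] at hs
  simp only [extendI_of_mem f hs]
  rw [← h ⟨s, hs⟩]
  rfl

theorem map_contourInt {W : Type*} [NormedAddCommGroup W] [NormedSpace ℂ W] [CompleteSpace V]
    [CompleteSpace W] (γ : Contour) (Φ : V →L[ℂ] W) (f : C(unitInterval, V)) :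
    Φ (contourInt γ f) = contourInt γ ((Φ : C(V, W)).comp f) := by
  rw [contourInt_apply, contourInt_apply, map_smul]
  congr 1
  have h := Φ.intervalIntegral_comp_comm (intervalIntegrable_contour γ f)
  rw [← h]
  simp only [map_smul]
  rfl

/-- A primitive takes equal values at the two ends of a closed curve. The fundamental theorem of
calculus tolerates the finitely many breakpoints. -/
theorem contourInt_eq_zero_of_hasDerivAt [CompleteSpace V] (γ : Contour) (F F' : ℂ → V)
    (hF : ∀ z ∈ γ.points, HasDerivAt F (F' z) z) (f : C(unitInterval, V))
    (hf : ∀ s, f s = F' (γ.path s)) : contourInt γ f = 0 := by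
  obtain ⟨S, _, -, hS⟩ := γ.exists_deriv_bound
  have h := integral_eq_of_hasDerivAt_off_countable (a := 0) (b := 1) (s := (S : Set ℝ))
    (fun s => F (γ.toFun s)) (fun s => deriv γ.toFun s • extendI f s) S.countable_toSet
    ?_ ?_ (intervalIntegrable_contour γ f)
  · rw [contourInt_apply, h, γ.closed, sub_self, smul_zero]
  · rw [Set.uIcc_of_le zero_le_one]
    exact ContinuousOn.comp (t := γ.points) (fun z hz => (hF z hz).continuousAt.continuousWithinAt)
      γ.continuousOn fun s hs => ⟨s, hs, rfl⟩
  · intro s hs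
    rw [min_eq_left zero_le_one, max_eq_right zero_le_one] at hs
    have hs' : s ∈ Set.Icc (0 : ℝ) 1 := ⟨hs.1.1.le, hs.1.2.le⟩
    rw [extendI_of_mem f hs', hf]
    exact (hF _ ⟨s, hs', rfl⟩).scomp s (hS s hs' hs.2).1.hasDerivAt

end ContourIntegral

/-! ### Resolvents along a contour -/

section Resolvent

variable {A : Type*} [NormedRing A] [NormedAlgebra ℂ A]

/-- Constant functions on the unit interval. -/
def constI : A →L[ℝ] C(unitInterval, A) :=
  LinearMap.mkContinuous
    { toFun := ContinuousMap.const unitInterval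
      map_add' := fun _ _ => rfl
      map_smul' := fun _ _ => rfl } 1 fun a => by
      rw [one_mul]
      exact (ContinuousMap.norm_le _ (norm_nonneg a)).2 fun _ => le_rfl

@[simp] theorem constI_apply (a : A) (s : unitInterval) : constI a s = a := rfl

/-- The function `z ↦ z` along the contour. -/
def zetaI (A : Type*) [NormedRing A] [NormedAlgebra ℂ A] (γ : Contour) : C(unitInterval, A) where
  toFun s := algebraMap ℂ A (γ.path s)
  continuous_toFun := (continuous_algebraMap ℂ A).comp γ.path.continuous

@[simp] theorem zetaI_apply (γ : Contour) (s : unitInterval) :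
    zetaI A γ s = algebraMap ℂ A (γ.path s) := rfl

/-- The resolvent `z ↦ (z - a)⁻¹` along the contour. -/
def resI (γ : Contour) (a : A) : C(unitInterval, A) := Ring.inverse (zetaI A γ - constI a)

theorem zetaI_commute (γ : Contour) (f : C(unitInterval, A)) : Commute (zetaI A γ) f := by
  ext s
  exact Algebra.commutes _ _

variable [CompleteSpace A]

/-- The contour does not meet the spectrum of `a`. -/
def Contour.Avoids (γ : Contour) (a : A) : Prop := ∀ z ∈ γ.points, z ∈ resolventSet ℂ a

theorem Contour.Avoids.isUnit {γ : Contour} {a : A} (h : γ.Avoids a) :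
    IsUnit (zetaI A γ - constI a) := by
  rw [ContinuousMap.isUnit_iff_forall_isUnit]
  exact fun s => h _ (γ.path_mem s)

theorem resI_mul {γ : Contour} {a : A} (h : γ.Avoids a) : resI γ a * (zetaI A γ - constI a) = 1 :=
  Ring.inverse_mul_cancel _ h.isUnit

theorem mul_resI {γ : Contour} {a : A} (h : γ.Avoids a) : (zetaI A γ - constI a) * resI γ a = 1 :=
  Ring.mul_inverse_cancel _ h.isUnit

theorem resI_apply {γ : Contour} {a : A} (h : γ.Avoids a) (s : unitInterval) :
    resI γ a s = resolvent a (γ.path s) := by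
  have h1 : resI γ a s * (algebraMap ℂ A (γ.path s) - a) = 1 := congrArg (· s) (resI_mul h)
  have h2 : IsUnit (algebraMap ℂ A (γ.path s) - a) := h _ (γ.path_mem s)
  rw [resolvent, ← mul_one (resI γ a s), ← Ring.mul_inverse_cancel _ h2, ← mul_assoc, h1, one_mul]

theorem resI_sub_resI {γ : Contour} {a b : A} (ha : γ.Avoids a) (hb : γ.Avoids b) :
    resI γ b - resI γ a = resI γ b * constI (b - a) * resI γ a := by
  have h : (constI (b - a) : C(unitInterval, A))
      = (zetaI A γ - constI a) - (zetaI A γ - constI b) := by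
    rw [map_sub]; abel
  rw [h, mul_sub, sub_mul, resI_mul hb, one_mul, mul_assoc, mul_resI ha, mul_one]

/-- The resolvents at all points of the contour form a single inverse in the Banach algebra of
curves. Analyticity of inversion there gives analyticity in `a`, uniformly along the contour. -/
theorem analyticAt_resI {γ : Contour} {a : A} (h : γ.Avoids a) :
    AnalyticAt ℝ (resI γ : A → C(unitInterval, A)) a := by
  have h1 : AnalyticAt ℝ (Ring.inverse : C(unitInterval, A) → C(unitInterval, A))
      (zetaI A γ - constI a) := analyticAt_inverse h.isUnit.unit
  exact AnalyticAt.comp (f := fun x => zetaI A γ - constI x) h1 (analyticAt_const.sub ((constI : A →L[ℝ] C(unitInterval, A)).analyticAt a))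

theorem hasFDerivAt_resI {γ : Contour} {a : A} (h : γ.Avoids a) :
    HasFDerivAt (𝕜 := ℝ) (resI γ : A → C(unitInterval, A))
      ((ContinuousLinearMap.mulLeftRight ℝ C(unitInterval, A) (resI γ a) (resI γ a)).comp constI) a := by
  have h1 := hasFDerivAt_ringInverse (𝕜 := ℝ) h.isUnit.unit
  have h2 : HasFDerivAt (𝕜 := ℝ) (fun x : A => zetaI A γ - constI x) (-constI) a :=
    (constI : A →L[ℝ] C(unitInterval, A)).hasFDerivAt.const_sub (zetaI A γ)
  have h3 : HasFDerivAt (resI γ) _ a := HasFDerivAt.comp a (g := Ring.inverse) h1 h2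
  have h4 : (↑(h.isUnit.unit⁻¹) : C(unitInterval, A)) = resI γ a := by
    rw [resI, Ring.inverse_of_isUnit h.isUnit]
  rw [h4] at h3
  exact h3.congr_fderiv (by ext; simp)

/-- Integration by parts: `z R(z)` is a primitive of `R - z R²`. -/
theorem contourInt_zetaI_mul_resI_sq {γ : Contour} {a : A} (h : γ.Avoids a) :
    contourInt γ (zetaI A γ * (resI γ a * resI γ a)) = contourInt γ (resI γ a) := by
  rw [eq_comm, ← sub_eq_zero, ← map_sub]
  refine contourInt_eq_zero_of_hasDerivAt γ (fun z => z • resolvent a z)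
    (fun z => resolvent a z + z • (-resolvent a z ^ 2)) (fun z hz => ?_) _ fun s => ?_
  · have h1 := (hasDerivAt_id z).smul (spectrum.hasDerivAt_resolvent_const_left (h z hz))
    exact h1.congr_deriv (by simp only [id, one_smul]; rw [add_comm])
  · simp only [ContinuousMap.sub_apply, ContinuousMap.mul_apply, zetaI_apply, resI_apply h, sq,
      Algebra.smul_def]
    noncomm_ring

/-- Integration by parts with the primitive `z R k R`, whose derivative is `R k R - z (R² k R + R k
R²)`. -/
theorem contourInt_resI_mul_mul_resI {γ : Contour} {a : A} (h : γ.Avoids a) (k : A) :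
    contourInt γ (resI γ a * constI k * resI γ a)
      = contourInt γ (zetaI A γ * (resI γ a * resI γ a * constI k * resI γ a))
        + contourInt γ (zetaI A γ * (resI γ a * constI k * (resI γ a * resI γ a))) := by
  rw [← map_add, ← sub_eq_zero, ← map_sub]
  refine contourInt_eq_zero_of_hasDerivAt γ (fun z => z • (resolvent a z * k * resolvent a z))
    (fun z => resolvent a z * k * resolvent a z + z • (-resolvent a z ^ 2 * k * resolvent a z
      + resolvent a z * k * -resolvent a z ^ 2)) (fun z hz => ?_) _ fun s => ?_
  · have h0 := spectrum.hasDerivAt_resolvent_const_left (h z hz)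
    have h1 := (hasDerivAt_id z).smul ((h0.mul_const k).mul h0)
    exact h1.congr_deriv (by simp only [id, one_smul, Pi.mul_apply]; rw [add_comm])
  · simp only [ContinuousMap.sub_apply, ContinuousMap.add_apply, ContinuousMap.mul_apply,
      zetaI_apply, resI_apply h, sq, Algebra.smul_def, constI_apply]
    noncomm_ring

end Resolvent

/-! ### Traces of contour integrals -/

instance instNormedRingOperatorCurves : NormedRing C(unitInterval, Hil →L[ℂ] Hil) := inferInstance

section TraceContour

open MeasureTheory

/-- The pairing with a fixed `h`, as a complex linear functional. -/
def pairingC (h : L1) : (Hil →L[ℂ] Hil) →L[ℂ] ℂ :=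
  LinearMap.mkContinuous
    { toFun := pairing h
      map_add' := map_add (pairing h)
      map_smul' := pairing_smul h } (2 * ‖h‖) (norm_pairing_le h)

@[simp] theorem pairingC_apply (h : L1) (X : Hil →L[ℂ] Hil) : pairingC h X = pairing h X := rfl

/-- The diagonal matrix coefficients. -/
def diagCoeff (m : ℤ) : (Hil →L[ℂ] Hil) →L[ℂ] ℂ :=
  (innerSL ℂ (e m)).comp (ContinuousLinearMap.apply ℂ Hil (e m))

theorem diagCoeff_apply (m : ℤ) (X : Hil →L[ℂ] Hil) : diagCoeff m X = inner ℂ (e m) (X (e m)) := rfl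

variable (γ : Contour)

theorem mul_contourInt {A : Type*} [NormedRing A] [NormedAlgebra ℂ A] [CompleteSpace A] (b : A)
    (f : C(unitInterval, A)) : b * contourInt γ f = contourInt γ (constI b * f) :=
  map_contourInt γ (ContinuousLinearMap.mul ℂ A b) f

variable (h : L1) (A C : C(unitInterval, Hil →L[ℂ] Hil))

theorem sum_norm_diagCoeff_le (s : Finset ℤ) (x : ℝ) :
    ∑ m ∈ s, ‖extendI ((diagCoeff m : C(Hil →L[ℂ] Hil, ℂ)).comp (A * constI (hop h) * C)) x‖
      ≤ 2 * ‖A‖ * ‖C‖ * ‖h‖ := by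
  set y := Set.projIcc (0 : ℝ) 1 zero_le_one x
  refine (sum_norm_trace_mul_hop_mul_le h (A y) (C y) s).trans ?_
  have h1 := A.norm_coe_le_norm y
  have h2 := C.norm_coe_le_norm y
  gcongr

theorem sum_norm_diagCoeff_contourInt_le (s : Finset ℤ) :
    ∑ m ∈ s, ‖inner ℂ (e m) (contourInt γ (A * constI (hop h) * C) (e m))‖
      ≤ γ.len * (2 * ‖A‖ * ‖C‖ * ‖h‖) := by
  have h1 : ∀ m, ‖inner ℂ (e m) (contourInt γ (A * constI (hop h) * C) (e m))‖ ≤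
      γ.len * ∫ x in (0 : ℝ)..1,
        ‖extendI ((diagCoeff m : C(Hil →L[ℂ] Hil, ℂ)).comp (A * constI (hop h) * C)) x‖ := fun m => by
    rw [← diagCoeff_apply, map_contourInt]
    exact norm_contourInt_le γ _
  refine (Finset.sum_le_sum fun m _ => h1 m).trans ?_
  rw [← Finset.mul_sum, ← intervalIntegral.integral_finsetSum fun m _ =>
    (continuous_extendI _).norm.intervalIntegrable 0 1]
  refine mul_le_mul_of_nonneg_left ?_ γ.len_nonneg
  refine (intervalIntegral.integral_mono_on (g := fun _ => 2 * ‖A‖ * ‖C‖ * ‖h‖) zero_le_one ?_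
    (by simp) fun x _ => sum_norm_diagCoeff_le h A C s x).trans (by simp)
  exact Continuous.intervalIntegrable
    (continuous_finsetSum _ fun m _ => (continuous_extendI _).norm) 0 1

theorem isTraceClass_contourInt :
    IsTraceClass (contourInt γ (A * constI (hop h) * C)) := by
  refine isTraceClass_of_forall_contraction (K := γ.len * (2 * ‖A‖ * ‖C‖ * ‖h‖)) fun B hB s => ?_
  rw [mul_contourInt, ← mul_assoc, ← mul_assoc]
  refine (sum_norm_diagCoeff_contourInt_le γ h (constI B * A) C s).trans ?_
  have hc : ‖(constI B : C(unitInterval, Hil →L[ℂ] Hil))‖ ≤ 1 :=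
    (ContinuousMap.norm_le _ zero_le_one).2 fun _ => hB
  have : ‖constI B * A‖ ≤ ‖A‖ := (norm_mul_le _ _).trans (mul_le_of_le_one_left (norm_nonneg _) hc)
  have := γ.len_nonneg
  gcongr

/-- The trace formula holds at each point of the contour. Sum and integral may be exchanged because
the partial sums of the norms of the diagonal entries are bounded uniformly along the contour. -/
theorem hasSum_trace_contourInt :
    HasSum (fun m => inner ℂ (e m) (contourInt γ (A * constI (hop h) * C) (e m)))
      (pairing h (contourInt γ (C * A))) := by
  set g : ℤ → C(unitInterval, ℂ) := fun m =>
    (diagCoeff m : C(Hil →L[ℂ] Hil, ℂ)).comp (A * constI (hop h) * C) with hg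
  have h1 : ∀ m, inner ℂ (e m) (contourInt γ (A * constI (hop h) * C) (e m))
      = contourInt γ (g m) := fun m => by
    rw [← diagCoeff_apply, map_contourInt]
  have h2 : pairing h (contourInt γ (C * A))
      = contourInt γ ((pairingC h : C(Hil →L[ℂ] Hil, ℂ)).comp (C * A)) := by
    rw [← map_contourInt, pairingC_apply]
  have h3 : ∀ x, HasSum (fun m => extendI (g m) x)
      (extendI ((pairingC h : C(Hil →L[ℂ] Hil, ℂ)).comp (C * A)) x) := fun x =>
    hasSum_trace_mul_hop_mul h (A (Set.projIcc (0 : ℝ) 1 zero_le_one x)) (C _)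
  rw [h2]
  simp only [h1]
  simp only [contourInt_apply]
  refine HasSum.const_smul _ ?_
  simp only [intervalIntegral.integral_of_le (zero_le_one (α := ℝ))]
  have h4 := hasSum_integral_of_summable_integral_norm (μ := volume.restrict (Set.Ioc (0 : ℝ) 1))
    (F := fun m x => deriv γ.toFun x • extendI (g m) x)
    (fun m => (intervalIntegrable_iff_integrableOn_Ioc_of_le zero_le_one).1
      (intervalIntegrable_contour γ (g m))) ?_
  · simp only [fun x => ((h3 x).const_smul (deriv γ.toFun x)).tsum_eq] at h4
    exact h4
  · refine summable_of_sum_le (c := γ.speed * (2 * ‖A‖ * ‖C‖ * ‖h‖))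
      (fun m => integral_nonneg fun x => norm_nonneg _) fun s => ?_
    have hint : ∀ m ∈ s, Integrable (fun x => ‖deriv γ.toFun x • extendI (g m) x‖)
        (volume.restrict (Set.Ioc (0 : ℝ) 1)) := fun m _ =>
      ((intervalIntegrable_iff_integrableOn_Ioc_of_le zero_le_one).1
        (intervalIntegrable_contour γ (g m))).norm
    rw [← integral_finsetSum s hint]
    refine (integral_mono_ae (integrable_finsetSum s hint)
      (integrable_const (γ.speed * (2 * ‖A‖ * ‖C‖ * ‖h‖))) ?_).trans (by simp)
    filter_upwards [γ.ae_norm_deriv_le] with x hx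
    simp only [norm_smul, ← Finset.mul_sum]
    exact mul_le_mul hx (sum_norm_diagCoeff_le h A C s x)
      (Finset.sum_nonneg fun _ _ => norm_nonneg _) γ.speed_nonneg

theorem trace_contourInt :
    trace (contourInt γ (A * constI (hop h) * C)) = pairing h (contourInt γ (C * A)) :=
  (hasSum_trace_contourInt γ h A C).tsum_eq

/-- Cyclicity of the trace. -/
theorem pairing_contourInt_comm (k : L1) :
    pairing k (contourInt γ (A * constI (hop h) * C))
      = pairing h (contourInt γ (C * constI (hop k) * A)) := by
  -- Both sides are the trace of the integral of `K A H C`, read once with `K` and once with `H` as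
  -- the distinguished hopping operator.
  have h1 := trace_contourInt γ k 1 (A * constI (hop h) * C)
  have h2 := trace_contourInt γ h (constI (hop k) * A) C
  rw [mul_one] at h1
  rw [← h1, mul_assoc C, ← h2]
  simp only [one_mul, mul_assoc]

theorem norm_pairing_contourInt_le (k : L1) :
    ‖pairing k (contourInt γ (A * constI (hop h) * C))‖
      ≤ γ.len * (4 * ‖A‖ * ‖C‖ * ‖toL2 k‖ * ‖toL2 h‖) := by
  rw [← pairingC_apply, map_contourInt]
  refine norm_contourInt_le_of_forall γ _ (by positivity) fun s => ?_
  refine (norm_pairing_mul_hop_mul_le k h (A s) (C s)).trans ?_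
  have h1 := A.norm_coe_le_norm s
  have h2 := C.norm_coe_le_norm s
  gcongr

end TraceContour

/-! ### Expansion of the energy for an adapted contour -/

section Generic

variable {A : Type*} [NormedRing A] [NormedAlgebra ℂ A]

/-- The contour integral as a real linear map. -/
def contourIntR (γ : Contour) : C(unitInterval, A) →L[ℝ] A := (contourInt γ).restrictScalars ℝ

@[simp] theorem contourIntR_apply (γ : Contour) (f : C(unitInterval, A)) :
    contourIntR γ f = contourInt γ f := rfl

variable [CompleteSpace A] {E : Type*} [NormedAddCommGroup E] [NormedSpace ℝ E]

/-- The second order resolvent expansion. -/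
theorem resI_expansion {γ : Contour} {a b : A} (ha : γ.Avoids a) (hb : γ.Avoids b) :
    resI γ b = resI γ a + resI γ a * constI (b - a) * resI γ a
      + resI γ a * constI (b - a) * (resI γ a * constI (b - a) * resI γ b) := by
  -- The first-order identity, with the fixed resolvent on the left, is substituted into itself
  -- once.
  have h1 : resI γ b = resI γ a + resI γ a * constI (b - a) * resI γ b := by
    have h : (constI (b - a) : C(unitInterval, A))
        = (zetaI A γ - constI a) - (zetaI A γ - constI b) := by
      rw [map_sub]; abel
    rw [h, mul_sub, sub_mul, resI_mul ha, one_mul, mul_assoc, mul_resI hb, mul_one,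
      add_sub_cancel]
  calc resI γ b = resI γ a + resI γ a * constI (b - a) * resI γ b := h1
    _ = resI γ a + resI γ a * constI (b - a) *
          (resI γ a + resI γ a * constI (b - a) * resI γ b) := congrArg _ (congrArg _ h1)
    _ = _ := by rw [mul_add, ← add_assoc]

/-- The function `h ↦ (2 i π)⁻¹ ∮ c(z) (z - a - K h)⁻¹`. -/
def resInt (γ : Contour) (c : C(unitInterval, A)) (a : A) (K : E →L[ℝ] A) (h : E) : A :=
  contourIntR γ (c * resI γ (a + K h))

theorem analyticAt_resInt {γ : Contour} (c : C(unitInterval, A)) {a : A} {K : E →L[ℝ] A} {h : E}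
    (ha : γ.Avoids (a + K h)) : AnalyticAt ℝ (resInt γ c a K) h := by
  have h1 : AnalyticAt ℝ (fun h => resI γ (a + K h)) h :=
    AnalyticAt.comp (f := fun h => a + K h) (analyticAt_resI ha)
      (analyticAt_const.add (K.analyticAt h))
  have h2 := ((contourIntR γ).comp (ContinuousLinearMap.mul ℝ C(unitInterval, A) c)).analyticAt
    (resI γ (a + K h))
  exact AnalyticAt.comp (f := fun h => resI γ (a + K h)) h2 h1

theorem hasFDerivAt_resInt {γ : Contour} {a : A} {K : E →L[ℝ] A} {h : E}
    (ha : γ.Avoids (a + K h)) :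
    HasFDerivAt (resInt γ 1 a K) ((contourIntR γ).comp
      ((ContinuousLinearMap.mulLeftRight ℝ C(unitInterval, A) (resI γ (a + K h))
        (resI γ (a + K h))).comp (constI.comp K))) h := by
  have h1 : HasFDerivAt (fun h => resI γ (a + K h)) _ h :=
    HasFDerivAt.comp (f := fun h => a + K h) h (hasFDerivAt_resI ha) (K.hasFDerivAt.const_add a)
  have h2 := (contourIntR γ).hasFDerivAt.comp h h1
  have h3 : resInt γ 1 a K = contourIntR γ ∘ fun h => resI γ (a + K h) := by
    funext h; simp [resInt]
  rw [h3]
  exact h2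

end Generic

theorem hop_zero : hop (0 : ℤ → ℝ) = 0 := hopL.map_zero

/-! ### Trace of the difference of negative parts, and its derivative -/

section Adapted

variable {t : ℤ → ℝ} {γ : Contour} {η : ℝ}

theorem IsAdapted.avoids (hA : IsAdapted t γ η) {h : L1} (hh : ‖h‖ ≤ η) :
    γ.Avoids (hop t + hopL h) := by
  obtain ⟨-, C, -, hC⟩ := hA
  exact fun z hz => ((hC h fun n => (L1.bdd h n).trans hh).1 z hz).1

theorem IsAdapted.avoids_zero (hA : IsAdapted t γ η) : γ.Avoids (hop t) := by
  simpa only [map_zero, add_zero] using hA.avoids (h := 0) (by simpa using hA.1.le)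

theorem IsAdapted.exists_norm_resI_le (hA : IsAdapted t γ η) :
    ∃ C, 0 ≤ C ∧ ∀ h : L1, ‖h‖ ≤ η → ‖resI γ (hop t + hopL h)‖ ≤ C := by
  have hav := hA
  obtain ⟨-, C, hC0, hC⟩ := hA
  refine ⟨C, hC0, fun h hh => (ContinuousMap.norm_le _ hC0).2 fun s => ?_⟩
  rw [resI_apply (hav.avoids hh)]
  exact ((hC h fun n => (L1.bdd h n).trans hh).1 _ (γ.path_mem s)).2

theorem IsAdapted.negPart_eq (hA : IsAdapted t γ η) {h : L1} (hh : ‖h‖ ≤ η) :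
    negPart (hop t + hopL h) = -contourInt γ (zetaI _ γ * resI γ (hop t + hopL h)) := by
  have hav := hA.avoids hh
  obtain ⟨-, C, -, hC⟩ := hA
  rw [eq_neg_iff_add_eq_zero, ← neg_eq_iff_add_eq_zero]
  refine ((hC h fun n => (L1.bdd h n).trans hh).2).trans ?_
  refine cauchyInt_eq_contourInt γ _ _ fun s => ?_
  rw [ContinuousMap.mul_apply, resI_apply hav, zetaI_apply, ← Algebra.smul_def]
  rfl

/-- The resolvent identity under the integral makes the increment `k - h` appear as a factor between
continuous operator-valued functions; this is the source of the trace class property. -/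
theorem IsAdapted.negPart_sub (hA : IsAdapted t γ η) {h k : L1} (hh : ‖h‖ ≤ η) (hk : ‖k‖ ≤ η) :
    negPart (hop t + hopL k) - negPart (hop t + hopL h)
      = -contourInt γ (zetaI _ γ * resI γ (hop t + hopL k) * constI (hop (k - h : L1))
          * resI γ (hop t + hopL h)) := by
  have h1 := resI_sub_resI (hA.avoids hh) (hA.avoids hk)
  have h2 : hop t + hopL k - (hop t + hopL h) = hop (k - h : L1) := by
    rw [← hopL_apply, map_sub]; abel
  rw [h2] at h1
  rw [hA.negPart_eq hh, hA.negPart_eq hk, mul_assoc, mul_assoc, ← mul_assoc (resI _ _), ← h1,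
    mul_sub, map_sub]
  abel

theorem IsAdapted.isTraceClass (hA : IsAdapted t γ η) {h : L1} (hh : ‖h‖ ≤ η) :
    IsTraceClass (negPart (hop t + hop h) - negPart (hop t)) := by
  have h1 := hA.negPart_sub (h := 0) (by simpa using hA.1.le) hh
  simp only [map_zero, add_zero] at h1
  rw [← hopL_apply, h1]
  exact isTraceClass_neg (isTraceClass_contourInt _ _ _ _)

/-- The function `h ↦ (2 i π)⁻¹ ∮ z (z - T - H)⁻¹ (z - T)⁻¹` around `h₀`. -/
def chordInt (t : ℤ → ℝ) (γ : Contour) (h₀ h : L1) : Hil →L[ℂ] Hil :=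
  resInt γ (resI γ (hop t + hopL h₀) * zetaI _ γ) (hop t) hopL h

theorem IsAdapted.hasSum_trace (hA : IsAdapted t γ η) {h k : L1} (hh : ‖h‖ ≤ η) (hk : ‖k‖ ≤ η) :
    HasSum (fun m => inner ℂ (e m) ((negPart (hop t + hopL k) - negPart (hop t + hopL h)) (e m)))
      (-pairing (k - h) (chordInt t γ h k)) := by
  rw [hA.negPart_sub hh hk]
  have h1 := (hasSum_trace_contourInt γ (k - h) (zetaI _ γ * resI γ (hop t + hopL k))
    (resI γ (hop t + hopL h))).neg
  rw [← mul_assoc] at h1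
  simp only [neg_apply, inner_neg_right]
  exact h1

/-- The trace of `(T + H)_- - T_-`. -/
def traceDiff (t : ℤ → ℝ) (h : L1) : ℂ := trace (negPart (hop t + hopL h) - negPart (hop t))

theorem IsAdapted.traceDiff_eq (hA : IsAdapted t γ η) {h : L1} (hh : ‖h‖ ≤ η) :
    traceDiff t h = -pairing h (chordInt t γ 0 h) := by
  have h1 := hA.hasSum_trace (h := 0) (by simpa using hA.1.le) hh
  simp only [map_zero, add_zero, sub_zero] at h1
  exact h1.tsum_eq

/-- The traces telescope through `(T + H)_-`. Having the chord formula at every base point lets the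
derivative be read off at every `h`, as the second derivative requires. -/
theorem IsAdapted.traceDiff_sub (hA : IsAdapted t γ η) {h k : L1} (hh : ‖h‖ ≤ η) (hk : ‖k‖ ≤ η) :
    traceDiff t k = traceDiff t h - pairing (k - h) (chordInt t γ h k) := by
  have h0 : ‖(0 : L1)‖ ≤ η := by simpa using hA.1.le
  have h1 := hA.hasSum_trace h0 hh
  have h2 := hA.hasSum_trace hh hk
  have h3 := hA.hasSum_trace h0 hk
  have h4 := h1.add h2
  simp only [map_zero, add_zero] at h1 h3 h4
  rw [traceDiff, traceDiff, trace, trace, h1.tsum_eq, h3.tsum_eq, sub_eq_add_neg _ (pairing _ _)]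
  refine h3.unique ?_
  convert h4 using 2 with m
  rw [← inner_add_right, ← add_apply]
  congr 2
  abel

/-- The derivative of `h ↦ -Tr ((T + H)_- - T_-)`. -/
def slope (t : ℤ → ℝ) (γ : Contour) (h : L1) : L1 →L[ℝ] ℂ :=
  pairing.flip (resInt γ 1 (hop t) hopL h)

theorem slope_apply (h k : L1) :
    slope t γ h k = pairing k (contourInt γ (resI γ (hop t + hopL h))) := by
  simp [slope, resInt]

/-- When the chord degenerates the integrand is `z R²`, and integration by parts leaves the Riesz
integral of `R`. -/
theorem IsAdapted.chordInt_self (hA : IsAdapted t γ η) {h : L1} (hh : ‖h‖ ≤ η) :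
    chordInt t γ h h = resInt γ 1 (hop t) hopL h := by
  rw [chordInt, resInt, resInt, one_mul, contourIntR_apply, contourIntR_apply,
    ← contourInt_zetaI_mul_resI_sq (hA.avoids hh), (zetaI_commute γ _).symm.eq, mul_assoc]

/-- In the product rule for `pairing (k - h) (chordInt t γ h k)` the first factor vanishes at `k =
h`, so only the value of `chordInt` at `h` contributes. -/
theorem IsAdapted.hasFDerivAt_traceDiff (hA : IsAdapted t γ η) {h : L1} (hh : ‖h‖ < η) :
    HasFDerivAt (traceDiff t) (-slope t γ h) h := by
  have hw : DifferentiableAt ℝ (chordInt t γ h) h :=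
    (analyticAt_resInt _ (hA.avoids hh.le)).differentiableAt
  have h1 := pairing.hasFDerivAt_of_bilinear ((hasFDerivAt_id h).sub_const h) hw.hasFDerivAt
  have h2 := h1.const_sub (traceDiff t h)
  have h3 : (fun k => traceDiff t h - pairing (k - h) (chordInt t γ h k)) =ᶠ[nhds h] traceDiff t := by
    filter_upwards [Metric.isOpen_ball.mem_nhds (show h ∈ Metric.ball 0 η by simpa using hh)] with k hk
    exact (hA.traceDiff_sub hh.le (by simpa using (Metric.mem_ball.1 hk).le)).symm
  refine (h2.congr_of_eventuallyEq h3.symm).congr_fderiv ?_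
  ext k
  simp [slope, hA.chordInt_self hh.le]

theorem hasFDerivAt_slope (hA : IsAdapted t γ η) {h : L1} (hh : ‖h‖ ≤ η) :
    HasFDerivAt (slope t γ) (pairing.flip.comp ((contourIntR γ).comp
      ((ContinuousLinearMap.mulLeftRight ℝ C(unitInterval, Hil →L[ℂ] Hil)
        (resI γ (hop t + hopL h)) (resI γ (hop t + hopL h))).comp (constI.comp hopL)))) h :=
  pairing.flip.hasFDerivAt.comp h (hasFDerivAt_resInt (hA.avoids hh))

end Adapted

/-! ### Resolvent expansion under the contour integral -/

section Generic

variable {A : Type*} [NormedRing A] [NormedAlgebra ℂ A] [CompleteSpace A]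

/-- The second-order resolvent expansion is multiplied by `z R`; integration by parts simplifies the
term of order zero, and the last term keeps the exact resolvent of `b`. -/
theorem contourInt_expansion {γ : Contour} {a b : A} (ha : γ.Avoids a) (hb : γ.Avoids b) :
    contourInt γ (resI γ a * zetaI A γ * resI γ b) = contourInt γ (resI γ a)
      + contourInt γ (zetaI A γ * (resI γ a * resI γ a) * constI (b - a) * resI γ a)
      + contourInt γ (zetaI A γ * (resI γ a * resI γ a) * constI (b - a)
          * (resI γ a * constI (b - a) * resI γ b)) := by
  rw [← contourInt_zetaI_mul_resI_sq ha, ← map_add, ← map_add, ← (zetaI_commute γ (resI γ a)).eq]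
  congr 1
  conv_lhs => rw [resI_expansion ha hb]
  simp only [mul_add, mul_assoc]

theorem contourInt_resI_mul_mul_resI' {γ : Contour} {a : A} (h : γ.Avoids a) (k : A) :
    contourInt γ (resI γ a * constI k * resI γ a)
      = contourInt γ (zetaI A γ * (resI γ a * resI γ a) * constI k * resI γ a)
        + contourInt γ (resI γ a * constI k * (zetaI A γ * (resI γ a * resI γ a))) := by
  rw [contourInt_resI_mul_mul_resI h, ← mul_assoc (zetaI A γ) (resI γ a * constI k),
    (zetaI_commute γ (resI γ a * constI k)).eq]
  simp only [mul_assoc]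

end Generic

/-! ### The energy difference -/

theorem isSelfAdjoint_negPart (A : Hil →L[ℂ] Hil) : IsSelfAdjoint (negPart A) :=
  (CFC.negPart_nonneg A).isSelfAdjoint

theorem trace_im_of_isSelfAdjoint {A : Hil →L[ℂ] Hil} (hA : IsSelfAdjoint A) : (trace A).im = 0 := by
  rw [← Complex.conj_eq_iff_im, trace, Complex.conj_tsum]
  refine tsum_congr fun m => ?_
  rw [inner_conj_symm, ← ContinuousLinearMap.adjoint_inner_right, hA.adjoint_eq]

theorem traceDiff_im (t : ℤ → ℝ) (h : L1) : (traceDiff t h).im = 0 :=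
  trace_im_of_isSelfAdjoint ((isSelfAdjoint_negPart _).sub (isSelfAdjoint_negPart _))

/-- The form `(h, k) ↦ ∑ h n * k n` on `ℓ¹`. -/
def dotForm : L1 →L[ℝ] L1 →L[ℝ] ℝ := (innerSL ℝ).bilinearComp toL2L toL2L

theorem dotForm_apply (h k : L1) : dotForm h k = inner ℝ (toL2 h) (toL2 k) := rfl

theorem hasSum_dotForm (h k : L1) : HasSum (fun n => h n * k n) (dotForm h k) := by
  have := lp.hasSum_inner (𝕜 := ℝ) (toL2 h) (toL2 k)
  simp only [toL2_apply, RCLike.inner_apply, conj_trivial] at this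
  simpa only [mul_comm, dotForm_apply] using this

/-- The linear form on `ℓ¹` attached to a bounded sequence. -/
def boundedForm (b : ℤ → ℝ) {M : ℝ} (hb : ∀ n, ‖b n‖ ≤ M) : L1 →L[ℝ] ℝ :=
  LinearMap.mkContinuous
    { toFun := fun h => ∑' n, h n • b n
      map_add' := fun h k => by
        rw [← (summable_mul_bounded h hb).1.tsum_add (summable_mul_bounded k hb).1]
        exact tsum_congr fun n => add_smul (h n) (k n) _
      map_smul' := fun c h => by
        rw [RingHom.id_apply, ← (summable_mul_bounded h hb).1.tsum_const_smul]
        exact tsum_congr fun n => mul_smul c (h n) _ } M fun h => (summable_mul_bounded h hb).2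

theorem hasSum_boundedForm (b : ℤ → ℝ) {M : ℝ} (hb : ∀ n, ‖b n‖ ≤ M) (h : L1) :
    HasSum (fun n => b n * h n) (boundedForm b hb h) := by
  have h1 : HasSum (fun n => h n • b n) (boundedForm b hb h) := (summable_mul_bounded h hb).1.hasSum
  simpa only [smul_eq_mul, mul_comm] using h1

section Energy

variable {μ : ℝ} {t : ℤ → ℝ} {γ : Contour} {η M : ℝ} (hb : ∀ n, ‖t n - 1‖ ≤ M)

theorem energyDiff_eq (h : L1) :
    energyDiff μ t h = μ / 2 * dotForm h h + μ * boundedForm (fun n => t n - 1) hb h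
      - 2 * (traceDiff t h).re := by
  have h1 := (hasSum_dotForm h h).add ((hasSum_boundedForm _ hb h).mul_left 2)
  have h2 : ∑' n : ℤ, (h n + 2 * t n - 2) * h n
      = dotForm h h + 2 * boundedForm (fun n => t n - 1) hb h := by
    rw [← h1.tsum_eq]
    exact tsum_congr fun n => by ring
  rw [energyDiff, h2, traceDiff, hopL_apply]
  ring

/-- The right-hand formula is analytic even at the boundary `‖h‖ = η`, where the resolvents still
exist. The energy is known to agree with it only inside the closed ball, which is enough for
smoothness on that ball. -/
theorem IsAdapted.analyticAt_extension (hA : IsAdapted t γ η) {h : L1} (hh : ‖h‖ ≤ η) :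
    AnalyticAt ℝ (fun h : L1 => μ / 2 * dotForm h h + μ * boundedForm (fun n => t n - 1) hb h
      - 2 * (-pairing h (chordInt t γ 0 h)).re) h := by
  have h1 : AnalyticAt ℝ (fun h : L1 => dotForm h h) h :=
    AnalyticAt.comp (f := fun h : L1 => (h, h)) (dotForm.analyticAt_bilinear (h, h))
      (analyticAt_id.prod analyticAt_id)
  have hc : AnalyticAt ℝ (chordInt t γ 0) h := analyticAt_resInt _ (hA.avoids hh)
  have h2 : AnalyticAt ℝ (fun h : L1 => pairing h (chordInt t γ 0 h)) h :=
    AnalyticAt.comp (f := fun h : L1 => (h, chordInt t γ 0 h))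
      (pairing.analyticAt_bilinear (h, chordInt t γ 0 h)) (analyticAt_id.prod hc)
  have h3 : AnalyticAt ℝ (fun h : L1 => (-pairing h (chordInt t γ 0 h)).re) h :=
    AnalyticAt.comp (f := fun h : L1 => -pairing h (chordInt t γ 0 h))
      (Complex.reCLM.analyticAt _) h2.neg
  exact ((analyticAt_const.mul h1).add (analyticAt_const.mul
    ((boundedForm (fun n => t n - 1) hb).analyticAt h))).sub (analyticAt_const.mul h3)

theorem IsAdapted.energyDiff_eq_extension (hA : IsAdapted t γ η) {h : L1} (hh : ‖h‖ ≤ η) :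
    energyDiff μ t h = μ / 2 * dotForm h h + μ * boundedForm (fun n => t n - 1) hb h
      - 2 * (-pairing h (chordInt t γ 0 h)).re := by
  rw [energyDiff_eq hb, hA.traceDiff_eq hh]

theorem IsAdapted.contDiffOn_energyDiff (hA : IsAdapted t γ η) (hb : ∀ n, ‖t n - 1‖ ≤ M) :
    ContDiffOn ℝ ∞ (energyDiff μ t) (Metric.closedBall 0 η) := by
  intro h hh
  rw [mem_closedBall_zero_iff] at hh
  refine ((hA.analyticAt_extension (μ := μ) hb hh).contDiffAt.contDiffWithinAt).congr (fun k hk => ?_) ?_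
  · exact hA.energyDiff_eq_extension hb (mem_closedBall_zero_iff.1 hk)
  · exact hA.energyDiff_eq_extension hb hh

theorem IsAdapted.analyticOnNhd_energyDiff (hA : IsAdapted t γ η) (hb : ∀ n, ‖t n - 1‖ ≤ M) :
    AnalyticOnNhd ℝ (energyDiff μ t) (Metric.ball 0 η) := by
  intro h hh
  refine (hA.analyticAt_extension (μ := μ) hb (mem_ball_zero_iff.1 hh).le).congr ?_
  filter_upwards [Metric.isOpen_ball.mem_nhds hh] with k hk
  exact (hA.energyDiff_eq_extension hb (mem_ball_zero_iff.1 hk).le).symm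

/-- The gradient of the energy difference. -/
def energyGrad (μ : ℝ) (γ : Contour) (hb : ∀ n, ‖t n - 1‖ ≤ M) (h : L1) : L1 →L[ℝ] ℝ :=
  μ • dotForm h + μ • boundedForm (fun n => t n - 1) hb
    + (2 : ℝ) • ContinuousLinearMap.compL ℝ L1 ℂ ℝ Complex.reCLM (slope t γ h)

theorem dotForm_comm (h k : L1) : dotForm h k = dotForm k h := by
  rw [dotForm_apply, dotForm_apply, real_inner_comm]

theorem IsAdapted.hasFDerivAt_energyDiff (hA : IsAdapted t γ η) {h : L1} (hh : ‖h‖ < η) :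
    HasFDerivAt (energyDiff μ t) (energyGrad μ γ hb h) h := by
  have h1 := dotForm.hasFDerivAt_of_bilinear (hasFDerivAt_id h) (hasFDerivAt_id h)
  have h2 := Complex.reCLM.hasFDerivAt.comp h (hA.hasFDerivAt_traceDiff hh)
  have h3 := ((h1.const_mul (μ / 2)).add
    ((boundedForm (fun n => t n - 1) hb).hasFDerivAt.const_mul μ)).sub (h2.const_mul 2)
  have h4 : energyDiff μ t = fun h => μ / 2 * dotForm h h +
      μ * boundedForm (fun n => t n - 1) hb h - 2 * (traceDiff t h).re :=
    funext fun h => energyDiff_eq hb h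
  rw [h4]
  refine HasFDerivAt.congr_fderiv h3 ?_
  ext k
  simp [energyGrad, dotForm_comm k h]
  ring

/-- The Hessian of the energy difference. -/
def energyHess (μ : ℝ) (t : ℤ → ℝ) (γ : Contour) : L1 →L[ℝ] L1 →L[ℝ] ℝ :=
  μ • dotForm + (2 : ℝ) • (ContinuousLinearMap.compL ℝ L1 ℂ ℝ Complex.reCLM).comp
    (pairing.flip.comp ((contourIntR γ).comp
      ((ContinuousLinearMap.mulLeftRight ℝ C(unitInterval, Hil →L[ℂ] Hil)
        (resI γ (hop t)) (resI γ (hop t))).comp (constI.comp hopL))))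

theorem energyHess_apply (h k : L1) :
    energyHess μ t γ h k = μ * dotForm h k
      + 2 * (pairing h (contourInt γ (resI γ (hop t) * constI (hop k) * resI γ (hop t)))).re := by
  -- Differentiating the slope in the direction `h` pairs `k` with the integral of `R H R`;
  -- cyclicity exchanges the roles of `h` and `k`.
  rw [← pairing_contourInt_comm]
  rfl

theorem IsAdapted.hasFDerivAt_slope_zero (hA : IsAdapted t γ η) :
    HasFDerivAt (slope t γ) (pairing.flip.comp ((contourIntR γ).comp
      ((ContinuousLinearMap.mulLeftRight ℝ C(unitInterval, Hil →L[ℂ] Hil)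
        (resI γ (hop t)) (resI γ (hop t))).comp (constI.comp hopL)))) 0 := by
  simpa only [map_zero, add_zero] using hasFDerivAt_slope hA (h := 0) (by simpa using hA.1.le)

theorem IsAdapted.hasFDerivAt_fderiv_energyDiff (hA : IsAdapted t γ η)
    (hb : ∀ n, ‖t n - 1‖ ≤ M) :
    HasFDerivAt (fderiv ℝ (energyDiff μ t)) (energyHess μ t γ) 0 := by
  have h1 : HasFDerivAt (energyGrad μ γ hb) (energyHess μ t γ) 0 := by
    have h2 := (ContinuousLinearMap.compL ℝ L1 ℂ ℝ Complex.reCLM).hasFDerivAt.comp 0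
      hA.hasFDerivAt_slope_zero
    exact ((((μ • dotForm).hasFDerivAt).add_const _).add (h2.const_smul (2 : ℝ)))
  refine h1.congr_of_eventuallyEq ?_
  filter_upwards [Metric.ball_mem_nhds (0 : L1) hA.1] with k hk
  exact (hA.hasFDerivAt_energyDiff hb (mem_ball_zero_iff.1 hk)).fderiv

/-- The trace difference is real, being the trace of a self-adjoint operator, so the imaginary part
of its derivative is the derivative of zero. -/
theorem IsAdapted.slope_im (hA : IsAdapted t γ η) {h : L1} (hh : ‖h‖ < η) (k : L1) :
    (slope t γ h k).im = 0 := by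
  have h1 := Complex.imCLM.hasFDerivAt.comp h (hA.hasFDerivAt_traceDiff hh)
  have h2 : Complex.imCLM ∘ traceDiff t = fun _ => 0 := funext fun h => traceDiff_im t h
  rw [h2] at h1
  have h3 := congrArg (· k) (h1.unique (hasFDerivAt_const (0 : ℝ) h))
  simpa using h3

theorem IsAdapted.hess_im (hA : IsAdapted t γ η) (h k : L1) :
    (pairing h (contourInt γ (resI γ (hop t) * constI (hop k) * resI γ (hop t)))).im = 0 := by
  have h1 := (ContinuousLinearMap.compL ℝ L1 ℂ ℝ Complex.imCLM).hasFDerivAt.comp 0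
      hA.hasFDerivAt_slope_zero
  have h2 : (fun _ => 0) =ᶠ[nhds 0]
      (ContinuousLinearMap.compL ℝ L1 ℂ ℝ Complex.imCLM) ∘ slope t γ := by
    filter_upwards [Metric.ball_mem_nhds (0 : L1) hA.1] with k hk
    ext h
    exact (hA.slope_im (mem_ball_zero_iff.1 hk) h).symm
  have h3 := (h1.congr_of_eventuallyEq h2).unique (hasFDerivAt_const _ _)
  exact congrArg (fun f => f k h) h3

theorem hessOp_eq (hA : IsAdapted t γ η) (h k : L1) :
    hessOp t γ h k = contourInt γ (1 * constI (hop h) *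
      (resI γ (hop t) * constI (hop k) * resI γ (hop t))) := by
  refine cauchyInt_eq_contourInt γ _ _ fun s => ?_
  rw [one_mul, ← mul_assoc, ← mul_assoc]
  simp only [ContinuousMap.mul_apply, constI_apply, resI_apply hA.avoids_zero]

theorem trace_hessOp (hA : IsAdapted t γ η) (h k : L1) :
    trace (hessOp t γ h k)
      = pairing h (contourInt γ (resI γ (hop t) * constI (hop k) * resI γ (hop t))) := by
  rw [hessOp_eq hA, trace_contourInt, mul_one]

theorem energyHess_bound (hμ : 0 ≤ μ) (h k : L1) :
    ‖energyHess μ t γ h k‖ ≤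
      (μ + 8 * γ.len * ‖resI γ (hop t)‖ ^ 2) * ‖toL2 h‖ * ‖toL2 k‖ := by
  have h1 : ‖dotForm h k‖ ≤ ‖toL2 h‖ * ‖toL2 k‖ := by
    rw [dotForm_apply]; exact norm_inner_le_norm _ _
  have h2 := norm_pairing_contourInt_le γ k (resI γ (hop t)) (resI γ (hop t)) h
  rw [energyHess_apply]
  refine (norm_add_le _ _).trans ?_
  rw [norm_mul, norm_mul, Real.norm_of_nonneg hμ, Real.norm_of_nonneg zero_le_two]
  have h3 := (Complex.abs_re_le_norm _).trans h2
  rw [← Real.norm_eq_abs] at h3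
  calc _ ≤ μ * (‖toL2 h‖ * ‖toL2 k‖) + 2 * (γ.len * (4 * ‖resI γ (hop t)‖ * ‖resI γ (hop t)‖
        * ‖toL2 h‖ * ‖toL2 k‖)) :=
        add_le_add (mul_le_mul_of_nonneg_left h1 hμ) (mul_le_mul_of_nonneg_left h3 zero_le_two)
    _ = _ := by ring

/-- The factor `1 / 2` arises because the integral of `R H R` splits into those of `z R² H R` and `z
R H R²`, which have the same pairing with `h` by cyclicity; the expansion contains only the first.
-/
theorem IsAdapted.pairing_chordInt (hA : IsAdapted t γ η) {h : L1} (hh : ‖h‖ ≤ η) :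
    pairing h (chordInt t γ 0 h) = slope t γ 0 h
      + 1 / 2 * pairing h (contourInt γ (resI γ (hop t) * constI (hop h) * resI γ (hop t)))
      + pairing h (contourInt γ (zetaI _ γ * (resI γ (hop t) * resI γ (hop t)) * constI (hop h)
          * (resI γ (hop t) * constI (hop h) * resI γ (hop t + hopL h)))) := by
  have h0 := hA.avoids_zero
  have h1 := contourInt_expansion h0 (hA.avoids hh)
  have h2 := contourInt_resI_mul_mul_resI' h0 (hop h)
  have h3 := pairing_contourInt_comm γ h (zetaI _ γ * (resI γ (hop t) * resI γ (hop t)))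
    (resI γ (hop t)) h
  rw [add_sub_cancel_left, hopL_apply] at h1
  rw [chordInt, resInt, contourIntR_apply, slope_apply, map_zero, add_zero, hopL_apply, h1, map_add,
    map_add, h2, map_add, ← h3]
  ring

theorem IsAdapted.taylor_bound (hA : IsAdapted t γ η) (hb : ∀ n, ‖t n - 1‖ ≤ M) :
    ∃ C : ℝ, 0 ≤ C ∧ ∀ h : L1, ‖h‖ ≤ η →
      |energyDiff μ t h - energyGrad μ γ hb 0 h - 1 / 2 * energyHess μ t γ h h|
        ≤ C * ‖toL2 h‖ ^ 3 := by
  obtain ⟨K, hK0, hK⟩ := hA.exists_norm_resI_le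
  set r := resI γ (hop t) with hr
  set ζ := zetaI (Hil →L[ℂ] Hil) γ with hζ
  refine ⟨2 * (γ.len * (4 * ‖ζ * (r * r)‖ * (‖r‖ * 2 * K))), ?_, fun h hh => ?_⟩
  · have := γ.len_nonneg
    positivity
  have h1 := hA.pairing_chordInt hh
  have h2 := norm_pairing_contourInt_le γ h (ζ * (r * r))
    (r * constI (hop h) * resI γ (hop t + hopL h)) h
  have h3 : energyDiff μ t h - energyGrad μ γ hb 0 h - 1 / 2 * energyHess μ t γ h h
      = 2 * (pairing h (contourInt γ (ζ * (r * r) * constI (hop h)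
          * (r * constI (hop h) * resI γ (hop t + hopL h))))).re := by
    have hg : energyGrad μ γ hb 0 h
        = μ * boundedForm (fun n => t n - 1) hb h + 2 * (slope t γ 0 h).re := by
      simp [energyGrad]
    have hhalf : ∀ z : ℂ, (1 / 2 * z).re = 1 / 2 * z.re := fun z => by
      rw [show (1 / 2 : ℂ) = ((1 / 2 : ℝ) : ℂ) by norm_num, Complex.re_ofReal_mul]
    rw [hA.energyDiff_eq_extension hb hh, h1, energyHess_apply, hg, Complex.neg_re, Complex.add_re,
      Complex.add_re, hhalf]
    ring
  -- This is the third factor `H`, measured in operator norm; the supremum of `|h n|` is at most the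
  -- `ℓ²` norm.
  have h4 : ‖r * constI (hop h) * resI γ (hop t + hopL h)‖ ≤ ‖r‖ * (2 * ‖toL2 h‖) * K := by
    have hc : ‖(constI (hop h) : C(unitInterval, Hil →L[ℂ] Hil))‖ ≤ 2 * ‖toL2 h‖ :=
      (ContinuousMap.norm_le _ (by positivity)).2 fun _ => norm_hop_le (L2.bdd (toL2 h))
    refine (norm_mul_le _ _).trans (mul_le_mul ((norm_mul_le _ _).trans ?_) (hK h hh)
      (norm_nonneg _) (by positivity))
    exact mul_le_mul_of_nonneg_left hc (norm_nonneg _)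
  rw [h3, abs_mul, abs_two]
  have h5 := (Complex.abs_re_le_norm _).trans h2
  have hl := γ.len_nonneg
  calc _ ≤ 2 * (γ.len * (4 * ‖ζ * (r * r)‖ * (‖r‖ * (2 * ‖toL2 h‖) * K) * ‖toL2 h‖ * ‖toL2 h‖)) := by
        refine mul_le_mul_of_nonneg_left (h5.trans ?_) zero_le_two
        gcongr
    _ = _ := by ring

end Energy

/-- Extension of a bilinear form by continuity from a dense subspace. -/
theorem exists_bilinear_extension {E F : Type*} [NormedAddCommGroup E] [NormedSpace ℝ E]
    [NormedAddCommGroup F] [NormedSpace ℝ F] (ι : E →L[ℝ] F) (hι : DenseRange ι)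
    (B : E →L[ℝ] E →L[ℝ] ℝ) (C : ℝ) (hC : 0 ≤ C)
    (hB : ∀ h k, ‖B h k‖ ≤ C * ‖ι h‖ * ‖ι k‖) :
    ∃ B₂ : F →L[ℝ] F →L[ℝ] ℝ, ∀ h k, B₂ (ι h) (ι k) = B h k := by
  have hd : DenseRange ι.toLinearMap := hι
  have hx : ∀ h k, (B h).toLinearMap.extendOfNorm ι.toLinearMap (ι k) = B h k := fun h k =>
    LinearMap.extendOfNorm_eq (f := (B h).toLinearMap) hd ⟨_, hB h⟩ k
  -- The second variable is extended first, for each fixed `h`. The resulting functionals depend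
  -- linearly on `h`, with norm at most `C * ‖ι h‖`, and are then extended in `h`.
  let f : E →ₗ[ℝ] (F →L[ℝ] ℝ) :=
    { toFun := fun h => (B h).toLinearMap.extendOfNorm ι.toLinearMap
      map_add' := fun h h' => by
        refine ContinuousLinearMap.ext fun x => ?_
        refine hι.induction_on x (isClosed_eq (by fun_prop) (by fun_prop)) fun k => ?_
        rw [add_apply, hx, hx, hx, map_add, add_apply]
      map_smul' := fun c h => by
        refine ContinuousLinearMap.ext fun x => ?_
        refine hι.induction_on x (isClosed_eq (by fun_prop) (by fun_prop)) fun k => ?_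
        rw [RingHom.id_apply, smul_apply, hx, hx, map_smul, smul_apply] }
  have hf : ∃ C, ∀ h, ‖f h‖ ≤ C * ‖ι.toLinearMap h‖ :=
    ⟨C, fun h => LinearMap.opNorm_extendOfNorm_le hd (by positivity) (hB h)⟩
  refine ⟨f.extendOfNorm ι.toLinearMap, fun h k => ?_⟩
  have h1 : f.extendOfNorm ι.toLinearMap (ι h) = f h := LinearMap.extendOfNorm_eq hd hf h
  rw [h1]
  exact hx h k

/-! ### Recurrence inequalities -/

/-- Summing the contracting inequality over the half-line from `N` gives `S ≤ ρ S + C ∑ Y`, and `S`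
can be absorbed because it is finite. Each of the `j` further steps to the left costs a factor
controlled by `R`. -/
theorem exists_tsum_nat_le_of_recurrence {ρ R C : ℝ} (hρ : ρ < 1) (hR : 0 ≤ R)
    (hC : 0 ≤ C) (hρ0 : 0 ≤ ρ) (N j : ℕ) :
    ∃ K, 0 ≤ K ∧ ∀ X Y : ℤ → ℝ, (∀ m, 0 ≤ X m) → (∀ m, 0 ≤ Y m) →
      Summable X → Summable Y → (∀ m, X m ≤ R * X (m + 1) + C * Y m) →
      (∀ m, (N : ℤ) ≤ m → X m ≤ ρ * X (m + 1) + C * Y m) →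
      ∑' i : ℕ, X (N - j + i) ≤ K * ∑' m, Y m := by
  have hρ' : 0 < 1 - ρ := by linarith
  induction j with
  | zero =>
    refine ⟨C / (1 - ρ), by positivity, fun X Y hX hY sX sY _ h2 => ?_⟩
    have hi : Function.Injective fun i : ℕ => (N : ℤ) - (0 : ℕ) + i := fun a b h => by
      simpa using h
    have s1 : Summable fun i : ℕ => X (N - (0 : ℕ) + i) := sX.comp_injective hi
    have s2 : Summable fun i : ℕ => Y (N - (0 : ℕ) + i) := sY.comp_injective hi
    have s1' : Summable fun i : ℕ => X (N - (0 : ℕ) + ((i + 1 : ℕ) : ℤ)) :=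
      (summable_nat_add_iff (f := fun i : ℕ => X (N - (0 : ℕ) + i)) 1).2 s1
    have e1 : ∑' i : ℕ, X (N - (0 : ℕ) + i) = X (N - (0 : ℕ) + ((0 : ℕ) : ℤ))
        + ∑' i : ℕ, X (N - (0 : ℕ) + ((i + 1 : ℕ) : ℤ)) := s1.tsum_eq_zero_add
    have e2 : ∑' i : ℕ, Y (N - (0 : ℕ) + i) ≤ ∑' m, Y m :=
      tsum_comp_le_tsum_of_inj sY hY hi
    have e3 : ∑' i : ℕ, X (N - (0 : ℕ) + i) ≤ ρ * ∑' i : ℕ, X (N - (0 : ℕ) + ((i + 1 : ℕ) : ℤ))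
        + C * ∑' i : ℕ, Y (N - (0 : ℕ) + i) := by
      rw [← tsum_mul_left, ← tsum_mul_left, ← (s1'.mul_left ρ).tsum_add (s2.mul_left C)]
      refine s1.tsum_le_tsum (fun i => ?_) ((s1'.mul_left ρ).add (s2.mul_left C))
      have := h2 (N - (0 : ℕ) + i) (by simp)
      rw [show ((N : ℤ) - (0 : ℕ) + ((i + 1 : ℕ) : ℤ)) = N - (0 : ℕ) + i + 1 by push_cast; ring]
      exact this
    have e4 := hX (N - (0 : ℕ) + ((0 : ℕ) : ℤ))
    have e5 := mul_le_mul_of_nonneg_left e2 hC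
    rw [div_mul_eq_mul_div, le_div_iff₀ hρ']
    nlinarith
  | succ j ih =>
    obtain ⟨K, hK, ih⟩ := ih
    refine ⟨(R + 1) * K + C, by positivity, fun X Y hX hY sX sY h1 h2 => ?_⟩
    have ih := ih X Y hX hY sX sY h1 h2
    have hi : Function.Injective fun i : ℕ => (N : ℤ) - (j + 1 : ℕ) + i := fun a b h => by
      simpa using h
    have s1 : Summable fun i : ℕ => X (N - (j + 1 : ℕ) + i) := sX.comp_injective hi
    have hi' : Function.Injective fun i : ℕ => (N : ℤ) - j + i := fun a b h => by
      simpa using h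
    have s0 : Summable fun i : ℕ => X (N - j + i) := sX.comp_injective hi'
    have e1 : ∑' i : ℕ, X (N - (j + 1 : ℕ) + i) = X (N - (j + 1 : ℕ) + ((0 : ℕ) : ℤ))
        + ∑' i : ℕ, X (N - (j + 1 : ℕ) + ((i + 1 : ℕ) : ℤ)) := s1.tsum_eq_zero_add
    have e2 : ∀ i : ℕ, ((N : ℤ) - (j + 1 : ℕ) + ((i + 1 : ℕ) : ℤ)) = N - j + i := fun i => by
      push_cast; ring
    simp only [e2] at e1
    have e3 := h1 (N - (j + 1 : ℕ) + ((0 : ℕ) : ℤ))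
    rw [show ((N : ℤ) - (j + 1 : ℕ) + ((0 : ℕ) : ℤ) + 1) = N - j + ((0 : ℕ) : ℤ) by
      push_cast; ring] at e3
    have e4 : X (N - j + ((0 : ℕ) : ℤ)) ≤ ∑' i : ℕ, X (N - j + i) :=
      s0.le_tsum 0 fun _ _ => hX _
    have e5 : Y (N - (j + 1 : ℕ) + ((0 : ℕ) : ℤ)) ≤ ∑' m, Y m := sY.le_tsum _ fun _ _ => hY _
    have e6 := mul_le_mul_of_nonneg_left e4 hR
    have e7 := mul_le_mul_of_nonneg_left e5 hC
    have e8 := mul_le_mul_of_nonneg_left ih (by linarith : 0 ≤ R + 1)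
    nlinarith

/-- A bound for the solutions of a recurrence inequality on `ℤ` which is contracting, in one
direction or the other, near `±∞`. -/
theorem exists_tsum_le_of_recurrence {ρ R C : ℝ} (hρ0 : 0 ≤ ρ) (hρ : ρ < 1) (hR : 0 ≤ R)
    (hC : 0 ≤ C) (N : ℕ) :
    ∃ K, 0 ≤ K ∧ ∀ X Y : ℤ → ℝ, (∀ m, 0 ≤ X m) → (∀ m, 0 ≤ Y m) → Summable X → Summable Y →
      (∀ m, X m ≤ R * X (m + 1) + C * Y m) →
      (∀ m, (N : ℤ) ≤ m → X m ≤ ρ * X (m + 1) + C * Y m) →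
      ((∀ m, m < -(N : ℤ) → X m ≤ ρ * X (m + 1) + C * Y m) ∨
        (∀ m, m < -(N : ℤ) → X (m + 1) ≤ ρ * X m + C * Y m)) →
      ∑' m, X m ≤ K * ∑' m, Y m := by
  have hρ' : 0 < 1 - ρ := by linarith
  -- Taking `2 * N` steps to the left of `N` covers everything from `-N` on.
  obtain ⟨K, hK, hright⟩ := exists_tsum_nat_le_of_recurrence hρ hR hC hρ0 N (2 * N)
  refine ⟨K + (ρ * K + C) / (1 - ρ), by positivity, fun X Y hX hY sX sY h1 h2 h3 => ?_⟩
  have hS := hright X Y hX hY sX sY h1 h2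
  set S := ∑' i : ℕ, X (N - (2 * N : ℕ) + i) with hSdef
  set y := ∑' m, Y m with hy
  have hy0 : 0 ≤ y := tsum_nonneg hY
  have hiL : ∀ c : ℤ, Function.Injective fun i : ℕ => c - i := fun c a b h => by simpa using h
  have hiN : Function.Injective fun i : ℕ => (N : ℤ) - (2 * N : ℕ) + i := fun a b h => by
    simpa using h
  have sS : Summable fun i : ℕ => X (N - (2 * N : ℕ) + i) := sX.comp_injective hiN
  have sL : ∀ c : ℤ, Summable fun i : ℕ => X (c - i) := fun c => sX.comp_injective (hiL c)
  have sYL : ∀ c : ℤ, Summable fun i : ℕ => Y (c - i) := fun c => sY.comp_injective (hiL c)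
  have hYL : ∀ c : ℤ, ∑' i : ℕ, Y (c - i) ≤ y := fun c => tsum_comp_le_tsum_of_inj sY hY (hiL c)
  set L := ∑' i : ℕ, X (-N - 1 - i) with hL
  have hsplit : ∑' m, X m = S + L := by
    have s3 : Summable fun i : ℕ => X ((i : ℤ) - N) :=
      sX.comp_injective (i := fun i : ℕ => (i : ℤ) - N) fun a b h => by simpa using h
    have s4 : Summable fun i : ℕ => X (-((i : ℤ) + 1) - N) :=
      sX.comp_injective (i := fun i : ℕ => -((i : ℤ) + 1) - N) fun a b h => by simpa using h
    have e1 : ∑' m, X m = ∑' m : ℤ, X (m - N) := ((Equiv.subRight (N : ℤ)).tsum_eq X).symm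
    rw [e1, tsum_of_nat_of_neg_add_one (f := fun m : ℤ => X (m - N)) s3 s4, hSdef, hL]
    congr 1
    · exact tsum_congr fun i => congrArg X (by push_cast; ring)
    · exact tsum_congr fun i => congrArg X (by ring)
  have hXS : X (-N) ≤ S := by
    have := sS.le_tsum 0 fun _ _ => hX _
    rwa [show ((N : ℤ) - (2 * N : ℕ) + ((0 : ℕ) : ℤ)) = -N by push_cast; ring] at this
  have hLle : L ≤ (ρ * K + C) / (1 - ρ) * y := by
    rw [div_mul_eq_mul_div, le_div_iff₀ hρ']
    -- If the contraction keeps its direction, the boundary term `X (-N)` is controlled by the right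
    -- half. If it reverses, the left half closes on itself. The chosen constant covers both cases.
    rcases h3 with h3 | h3
    · have e1 : L ≤ ρ * ∑' i : ℕ, X (-N - i) + C * ∑' i : ℕ, Y (-N - 1 - i) := by
        rw [← tsum_mul_left, ← tsum_mul_left,
          ← ((sL _).mul_left ρ).tsum_add ((sYL _).mul_left C)]
        refine (sL _).tsum_le_tsum (fun i => ?_) (((sL _).mul_left ρ).add ((sYL _).mul_left C))
        have := h3 (-N - 1 - i) (by omega)
        rwa [show (-(N : ℤ) - 1 - i + 1) = -N - i by ring] at this
      have e2 : ∑' i : ℕ, X (-N - i) = X (-N) + L := by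
        rw [(sL (-N)).tsum_eq_zero_add, hL]
        congr 1
        · simp
        · exact tsum_congr fun i => congrArg X (by push_cast; ring)
      have e3 := mul_le_mul_of_nonneg_left (hYL (-N - 1)) hC
      have e4 := mul_le_mul_of_nonneg_left (hXS.trans hS) hρ0
      rw [e2] at e1
      nlinarith
    · have e1 : L ≤ ρ * ∑' i : ℕ, X (-N - 2 - i) + C * ∑' i : ℕ, Y (-N - 2 - i) := by
        rw [← tsum_mul_left, ← tsum_mul_left,
          ← ((sL _).mul_left ρ).tsum_add ((sYL _).mul_left C)]
        refine (sL _).tsum_le_tsum (fun i => ?_) (((sL _).mul_left ρ).add ((sYL _).mul_left C))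
        have := h3 (-N - 2 - i) (by omega)
        rwa [show (-(N : ℤ) - 2 - i + 1) = -N - 1 - i by ring] at this
      have e2 : L = X (-N - 1) + ∑' i : ℕ, X (-N - 2 - i) := by
        rw [hL, (sL (-N - 1)).tsum_eq_zero_add]
        congr 1
        · simp
        · exact tsum_congr fun i => congrArg X (by push_cast; ring)
      have e3 := mul_le_mul_of_nonneg_left (hYL (-N - 2)) hC
      have e4 := hX (-N - 1)
      have e5 : ∑' i : ℕ, X (-N - 2 - i) ≤ L := by linarith
      have e6 := mul_le_mul_of_nonneg_left e5 hρ0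
      have e7 : 0 ≤ ρ * K * y := by positivity
      nlinarith
  rw [hsplit, add_mul]
  exact add_le_add hS hLle

/-! ### The lower bound on the even sublattice -/

theorem tPlus_even (W δ : ℝ) (m : ℤ) : tPlus W δ (2 * m) = W + δ := by
  simp [tPlus, zpow_mul]

theorem tPlus_odd (W δ : ℝ) (m : ℤ) : tPlus W δ (2 * m + 1) = W - δ := by
  rw [tPlus, zpow_add₀ (by norm_num), zpow_mul]; simp; ring

theorem tMinus_even (W δ : ℝ) (m : ℤ) : tMinus W δ (2 * m) = W - δ := by
  simp [tMinus, zpow_mul]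

theorem tMinus_odd (W δ : ℝ) (m : ℤ) : tMinus W δ (2 * m + 1) = W + δ := by
  rw [tMinus, zpow_add₀ (by norm_num), zpow_mul]; simp

theorem tendsto_comp_of_tendsto_abs_sub {t s : ℤ → ℝ} {l l' : Filter ℤ}
    (h : Filter.Tendsto (fun n => |t n - s n|) l (nhds 0)) {φ : ℤ → ℤ} (hφ : Filter.Tendsto φ l' l)
    {a : ℝ} (hs : ∀ m, s (φ m) = a) : Filter.Tendsto (fun m => t (φ m)) l' (nhds a) := by
  have h1 := (tendsto_zero_iff_abs_tendsto_zero _).2 (h.comp hφ)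
  have h2 := h1.add_const a
  rw [zero_add] at h2
  refine h2.congr fun m => ?_
  simp [hs]

theorem tendsto_two_mul_atTop (c : ℤ) :
    Filter.Tendsto (fun m : ℤ => 2 * m + c) Filter.atTop Filter.atTop :=
  Filter.tendsto_atTop_add_const_right _ _
    (Filter.tendsto_id.const_mul_atTop' (by norm_num : (0 : ℤ) < 2))

theorem tendsto_two_mul_atBot (c : ℤ) :
    Filter.Tendsto (fun m : ℤ => 2 * m + c) Filter.atBot Filter.atBot :=
  Filter.tendsto_atBot_mono (fun m => le_rfl) <|
    Filter.tendsto_atBot_add_const_right _ _ <| Filter.tendsto_atBot.2 fun b => by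
      filter_upwards [Filter.eventually_le_atBot (min b 0)] with m hm
      have := le_min_iff.1 hm
      omega

/-- The common consequence of both boundary conditions: near `+∞` the even hoppings dominate the odd
ones by a fixed factor, and near `-∞` one of the two families dominates the other. -/
theorem exists_ratio {W δ : ℝ} (hW : 0 < W) (hδ : 0 < δ) {t : ℤ → ℝ}
    (ht : IsHomoclinic W δ t ∨ IsHeteroclinic W δ t) :
    ∃ ρ : ℝ, 0 ≤ ρ ∧ ρ < 1 ∧ ∃ N : ℕ,
      (∀ m, (N : ℤ) ≤ m → t (2 * m + 1) ≤ ρ * t (2 * m)) ∧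
      ((∀ m, m < -(N : ℤ) → t (2 * m + 1) ≤ ρ * t (2 * m)) ∨
        (∀ m, m < -(N : ℤ) → t (2 * m) ≤ ρ * t (2 * m + 1))) := by
  -- The limits of the two families are `W + δ` and `W - δ`; the ratio `W / (W + δ)` sends the
  -- larger to `W`, strictly above the smaller.
  have hρ : W / (W + δ) * (W + δ) = W := div_mul_cancel₀ _ (by positivity)
  have key : ∀ {l : Filter ℤ} {u v : ℤ → ℝ}, Filter.Tendsto u l (nhds (W + δ)) →
      Filter.Tendsto v l (nhds (W - δ)) → ∀ᶠ m in l, v m ≤ W / (W + δ) * u m := by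
    intro l u v hu hv
    have h1 := hu.const_mul (W / (W + δ))
    rw [hρ] at h1
    filter_upwards [hv.eventually_lt h1 (by linarith)] with m hm using hm.le
  have e0 : ∀ m : ℤ, 2 * m + 0 = 2 * m := fun m => add_zero _
  have hr : Filter.Tendsto (fun n => |t n - tPlus W δ n|) Filter.atTop (nhds 0) :=
    ht.elim (fun h => h.2) fun h => h.2
  have hR := key (tendsto_comp_of_tendsto_abs_sub hr (tendsto_two_mul_atTop 0)
      fun m => by rw [e0]; exact tPlus_even W δ m)
    (tendsto_comp_of_tendsto_abs_sub hr (tendsto_two_mul_atTop 1) (tPlus_odd W δ))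
  obtain ⟨b, hb⟩ := Filter.eventually_atTop.1 hR
  simp only [e0] at hb
  refine ⟨W / (W + δ), by positivity, (div_lt_one (by positivity)).2 (by linarith), ?_⟩
  rcases ht with h | h
  · have hL := key (tendsto_comp_of_tendsto_abs_sub h.1 (tendsto_two_mul_atBot 0)
        fun m => by rw [e0]; exact tPlus_even W δ m)
      (tendsto_comp_of_tendsto_abs_sub h.1 (tendsto_two_mul_atBot 1) (tPlus_odd W δ))
    obtain ⟨a, ha⟩ := Filter.eventually_atBot.1 hL
    simp only [e0] at ha
    refine ⟨b.toNat + (-a).toNat, fun m hm => hb m ?_, Or.inl fun m hm => ha m ?_⟩ <;> omega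
  · have hL := key (tendsto_comp_of_tendsto_abs_sub h.1 (tendsto_two_mul_atBot 1) (tMinus_odd W δ))
      (tendsto_comp_of_tendsto_abs_sub h.1 (tendsto_two_mul_atBot 0)
        fun m => by rw [e0]; exact tMinus_even W δ m)
    obtain ⟨a, ha⟩ := Filter.eventually_atBot.1 hL
    simp only [e0] at ha
    refine ⟨b.toNat + (-a).toNat, fun m hm => hb m ?_, Or.inr fun m hm => ha m ?_⟩ <;> omega

theorem abs_tPlus_le (W δ : ℝ) (n : ℤ) : |tPlus W δ n| ≤ |W| + |δ| := by
  refine (abs_add_le _ _).trans (le_of_eq ?_)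
  rw [abs_mul, abs_zpow]; simp

theorem abs_tMinus_le (W δ : ℝ) (n : ℤ) : |tMinus W δ n| ≤ |W| + |δ| := by
  refine (abs_sub _ _).trans (le_of_eq ?_)
  rw [abs_mul, abs_zpow]; simp

theorem exists_bound {W δ : ℝ} {t : ℤ → ℝ} (ht : IsHomoclinic W δ t ∨ IsHeteroclinic W δ t) :
    ∃ M : ℝ, ∀ n, |t n| ≤ M := by
  have key : ∀ {l : Filter ℤ} {s : ℤ → ℝ}, (∀ n, |s n| ≤ |W| + |δ|) →
      Filter.Tendsto (fun n => |t n - s n|) l (nhds 0) → ∀ᶠ n in l, |t n| ≤ |W| + |δ| + 1 := by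
    intro l s hs h
    filter_upwards [h.eventually_lt_const zero_lt_one] with n hn
    have h1 := abs_add_le (s n) (t n - s n)
    rw [add_sub_cancel] at h1
    linarith [hs n]
  have hr := key (abs_tPlus_le W δ) (ht.elim (fun h => h.2) fun h => h.2)
  have hl : ∀ᶠ n in Filter.atBot, |t n| ≤ |W| + |δ| + 1 :=
    ht.elim (fun h => key (abs_tPlus_le W δ) h.1) fun h => key (abs_tMinus_le W δ) h.1
  obtain ⟨b, hb⟩ := Filter.eventually_atTop.1 hr
  obtain ⟨a, ha⟩ := Filter.eventually_atBot.1 hl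
  obtain ⟨K, hK⟩ := ((Set.finite_Icc a b).image fun n => |t n|).bddAbove
  refine ⟨max (|W| + |δ| + 1) K, fun n => ?_⟩
  rcases le_total n a with h | h
  · exact (ha n h).trans (le_max_left _ _)
  rcases le_total b n with h' | h'
  · exact (hb n h').trans (le_max_left _ _)
  · exact (hK ⟨n, ⟨h, h'⟩, rfl⟩).trans (le_max_right _ _)

theorem hasSum_even {f : Hil} (hf : ∀ m : ℤ, f (2 * m + 1) = 0) :
    HasSum (fun m : ℤ => ‖f (2 * m)‖ ^ 2) (‖f‖ ^ 2) := by
  have hi : Function.Injective fun m : ℤ => 2 * m := fun a b h => by simpa using h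
  refine (hi.hasSum_iff (f := fun n => ‖f n‖ ^ 2) fun n hn => ?_).2 (hasSum_norm_sq f)
  rcases Int.even_or_odd' n with ⟨k, rfl | rfl⟩
  · exact absurd ⟨k, rfl⟩ hn
  · simp [hf]

/-- Convexity of the square with weights `ρ` and `1 - ρ`, so that the coefficient of `y²` remains
below `1`. -/
theorem sq_le_of_le_add {x y g r ρ : ℝ} (hx : 0 ≤ x) (hy : 0 ≤ y) (hρ : ρ < 1)
    (hr0 : 0 ≤ r) (hr : r ≤ ρ) (h : x ≤ r * y + g) :
    x ^ 2 ≤ ρ * y ^ 2 + 1 / (1 - ρ) * g ^ 2 := by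
  have h1 : 0 < 1 - ρ := by linarith
  have h2 : x ≤ ρ * y + g := h.trans (by nlinarith)
  have h3 : x ^ 2 ≤ (ρ * y + g) ^ 2 := by gcongr
  have h4 : ρ * y ^ 2 + 1 / (1 - ρ) * g ^ 2 - (ρ * y + g) ^ 2
      = ρ / (1 - ρ) * ((1 - ρ) * y - g) ^ 2 := by
    field_simp; ring
  have h5 : 0 ≤ ρ / (1 - ρ) * ((1 - ρ) * y - g) ^ 2 := by
    have : 0 ≤ ρ := hr0.trans hr
    positivity
  linarith

/-- At odd sites `T f` reads `t (2m+1) f (2m+2) + t (2m) f (2m)`, a first-order recurrence that can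
be solved in either direction since `t ≥ τ`. The ratio of hoppings selects the contracting direction
near each end. -/
theorem exists_lower_bound {W δ τ : ℝ} (hW : 0 < W) (hδ : 0 < δ) (hτ : 0 < τ) {t : ℤ → ℝ}
    (ht : IsHomoclinic W δ t ∨ IsHeteroclinic W δ t) (htτ : ∀ n, τ ≤ t n) :
    ∃ c : ℝ, 0 < c ∧ ∀ f : Hil, (∀ m : ℤ, f (2 * m + 1) = 0) → c * ‖f‖ ≤ ‖hop t f‖ := by
  obtain ⟨M, hM⟩ := exists_bound ht
  obtain ⟨ρ, hρ0, hρ, N, hright, hleft⟩ := exists_ratio hW hδ ht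
  have hρ' : 0 < 1 - ρ := by linarith
  -- `R` comes from `(a + b)² ≤ 2 a² + 2 b²` with hopping ratios at most `M / τ`; `C` dominates both
  -- the factor `2` of this inequality and the `1 / (1 - ρ)` of the contracting one.
  set R := 2 * (M / τ) ^ 2
  set C := (2 + 1 / (1 - ρ)) / τ ^ 2 with hC
  obtain ⟨K, hK, hrec⟩ := exists_tsum_le_of_recurrence (R := R) (C := C) hρ0 hρ (by positivity)
    (by positivity) N
  refine ⟨(Real.sqrt (K + 1))⁻¹, by positivity, fun f hf => ?_⟩
  set X : ℤ → ℝ := fun m => ‖f (2 * m)‖ ^ 2 with hX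
  set Y : ℤ → ℝ := fun m => ‖hop t f (2 * m + 1)‖ ^ 2 with hY
  have hi : Function.Injective fun m : ℤ => 2 * m + 1 := fun a b h => by simpa using h
  have sX := hasSum_even hf
  have sY0 := hasSum_norm_sq (hop t f)
  have sY : Summable Y := sY0.summable.comp_injective hi
  have hYle : ∑' m, Y m ≤ ‖hop t f‖ ^ 2 :=
    (tsum_comp_le_tsum_of_inj sY0.summable (fun _ => sq_nonneg _) hi).trans sY0.tsum_eq.le
  have tpos : ∀ n, 0 < t n := fun n => hτ.trans_le (htτ n)
  have hid : ∀ m : ℤ, hop t f (2 * m + 1)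
      = t (2 * m + 1) * f (2 * (m + 1)) + t (2 * m) * f (2 * m) := fun m => by
    rw [hop_apply ⟨M, hM⟩, add_sub_cancel_right, show 2 * m + 1 + 1 = 2 * (m + 1) by ring]
  have norm_t : ∀ n (z : ℂ), ‖(t n : ℂ) * z‖ = t n * ‖z‖ := fun n z => by
    rw [norm_mul, Complex.norm_real, Real.norm_of_nonneg (tpos n).le]
  have gτ : ∀ m n : ℤ, ‖hop t f (2 * m + 1)‖ / t n ≤ ‖hop t f (2 * m + 1)‖ / τ := fun m n =>
    div_le_div_of_nonneg_left (norm_nonneg _) hτ (htτ n)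
  have fwd : ∀ m : ℤ, ‖f (2 * m)‖ ≤ t (2 * m + 1) / t (2 * m) * ‖f (2 * (m + 1))‖
      + ‖hop t f (2 * m + 1)‖ / τ := fun m => by
    refine le_trans ?_ (add_le_add_right (gτ m (2 * m)) _)
    rw [div_mul_eq_mul_div, ← add_div, le_div_iff₀ (tpos _), mul_comm, ← norm_t, ← norm_t]
    have : (t (2 * m) : ℂ) * f (2 * m)
        = hop t f (2 * m + 1) - t (2 * m + 1) * f (2 * (m + 1)) := by rw [hid]; ring
    rw [this]
    exact (norm_sub_le _ _).trans (add_comm _ _).le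
  have bwd : ∀ m : ℤ, ‖f (2 * (m + 1))‖ ≤ t (2 * m) / t (2 * m + 1) * ‖f (2 * m)‖
      + ‖hop t f (2 * m + 1)‖ / τ := fun m => by
    refine le_trans ?_ (add_le_add_right (gτ m (2 * m + 1)) _)
    rw [div_mul_eq_mul_div, ← add_div, le_div_iff₀ (tpos _), mul_comm, ← norm_t, ← norm_t]
    have : (t (2 * m + 1) : ℂ) * f (2 * (m + 1))
        = hop t f (2 * m + 1) - t (2 * m) * f (2 * m) := by rw [hid]; ring
    rw [this]
    exact (norm_sub_le _ _).trans (add_comm _ _).le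
  have hCYeq : ∀ m : ℤ, C * Y m = 2 * (‖hop t f (2 * m + 1)‖ / τ) ^ 2
      + 1 / (1 - ρ) * (‖hop t f (2 * m + 1)‖ / τ) ^ 2 := fun m => by
    rw [hC, hY]; ring
  have hCY : ∀ m : ℤ, 1 / (1 - ρ) * (‖hop t f (2 * m + 1)‖ / τ) ^ 2 ≤ C * Y m := fun m => by
    rw [hCYeq]
    exact le_add_of_nonneg_left (by positivity)
  have contr : ∀ {x y r : ℝ} (m : ℤ), 0 ≤ x → 0 ≤ y → 0 ≤ r → r ≤ ρ →
      x ≤ r * y + ‖hop t f (2 * m + 1)‖ / τ → x ^ 2 ≤ ρ * y ^ 2 + C * Y m :=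
    fun m hx hy hr0 hr h => (sq_le_of_le_add hx hy hρ hr0 hr h).trans
      (add_le_add_right (hCY m) _)
  have hratio : ∀ i j : ℤ, t i ≤ ρ * t j → t i / t j ≤ ρ := fun i j h =>
    (div_le_iff₀ (tpos j)).2 h
  have hmain := hrec X Y (fun _ => sq_nonneg _) (fun _ => sq_nonneg _) sX.summable sY
    (fun m => ?_)
    (fun m hm => contr m (norm_nonneg _) (norm_nonneg _) (div_nonneg (tpos _).le (tpos _).le)
      (hratio _ _ (hright m hm)) (fwd m))
    (hleft.imp
      (fun h m hm => contr m (norm_nonneg _) (norm_nonneg _) (div_nonneg (tpos _).le (tpos _).le)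
        (hratio _ _ (h m hm)) (fwd m))
      (fun h m hm => contr m (norm_nonneg _) (norm_nonneg _) (div_nonneg (tpos _).le (tpos _).le)
        (hratio _ _ (h m hm)) (bwd m)))
  · rw [sX.tsum_eq] at hmain
    have h1 : ‖f‖ ^ 2 ≤ (K + 1) * ‖hop t f‖ ^ 2 := by nlinarith [sq_nonneg ‖hop t f‖]
    rw [inv_mul_le_iff₀ (by positivity)]
    refine le_of_sq_le_sq ?_ (by positivity)
    rwa [mul_pow, Real.sq_sqrt (by positivity)]
  · have h1 := fwd m
    have h2 : t (2 * m + 1) / t (2 * m) ≤ M / τ :=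
      div_le_div₀ ((abs_nonneg _).trans (hM 0)) ((le_abs_self _).trans (hM _)) hτ (htτ _)
    have h3 : ‖f (2 * m)‖ ≤ M / τ * ‖f (2 * (m + 1))‖ + ‖hop t f (2 * m + 1)‖ / τ :=
      h1.trans (by gcongr)
    have h4 : ‖f (2 * m)‖ ^ 2 ≤ (M / τ * ‖f (2 * (m + 1))‖ + ‖hop t f (2 * m + 1)‖ / τ) ^ 2 := by
      gcongr
    have h5 : 2 * (‖hop t f (2 * m + 1)‖ / τ) ^ 2 ≤ C * Y m := by
      rw [hCYeq]
      exact le_add_of_nonneg_right (by positivity)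
    have h6 : X (m + 1) = ‖f (2 * (m + 1))‖ ^ 2 := rfl
    rw [h6]
    change ‖f (2 * m)‖ ^ 2 ≤ 2 * (M / τ) ^ 2 * ‖f (2 * (m + 1))‖ ^ 2 + C * Y m
    nlinarith [sq_nonneg (M / τ * ‖f (2 * (m + 1))‖ - ‖hop t f (2 * m + 1)‖ / τ)]

/-! ### The spectral gap -/

section Gap

variable {E : Type*} [NormedAddCommGroup E] [InnerProductSpace ℂ E] [CompleteSpace E]

/-- `S²` is coercive because `⟨S² x, x⟩ = ‖S x‖²`, hence invertible; a factor of an invertible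
product of commuting elements is invertible. -/
theorem isUnit_of_isSelfAdjoint_of_bounded_below {S : E →L[ℂ] E} (hS : IsSelfAdjoint S) {K : ℝ}
    (hK : 0 < K) (h : ∀ ψ, ‖ψ‖ ≤ K * ‖S ψ‖) : IsUnit S := by
  have hu : IsUnit (S * S) := by
    refine ContinuousLinearMap.isUnit_of_forall_le_norm_inner_map (S * S)
      (c := ⟨(K ^ 2)⁻¹, by positivity⟩) (by change 0 < (K ^ 2)⁻¹; positivity) fun x => ?_
    have h1 : inner ℂ ((S * S) x) x = inner ℂ (S x) (S x) := by
      change inner ℂ (S (S x)) x = _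
      rw [← ContinuousLinearMap.adjoint_inner_right, hS.adjoint_eq]
    rw [h1, inner_self_eq_norm_sq_to_K]
    change ‖x‖ ^ 2 * (K ^ 2)⁻¹ ≤ _
    have h2 : ‖x‖ ^ 2 ≤ (K * ‖S x‖) ^ 2 := by
      have := h x
      gcongr
    rw [norm_pow]
    simp only [RCLike.norm_ofReal, abs_norm]
    rw [← div_eq_mul_inv, div_le_iff₀ (by positivity)]
    linarith
  exact ((Commute.refl S).isUnit_mul_iff.1 hu).1

/-- If the self-adjoint operator `D` exchanges the range and the kernel of the projection `P`, and is
bounded below by `c` on the range of `P`, then it has no spectrum in `(-c, c)` except possibly `0`. -/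
theorem notMem_spectrum_of_gap {D P : E →L[ℂ] E} (hD : IsSelfAdjoint D) (hPP : P * P = P)
    (hDP : D * P + P * D = D) {c : ℝ} (hc : ∀ f, P f = f → c * ‖f‖ ≤ ‖D f‖) {x : ℝ} (hx0 : x ≠ 0)
    (hx : |x| < c) : (x : ℂ) ∉ spectrum ℂ D := by
  have hc0 : 0 < c := (abs_nonneg x).trans_lt hx
  have hcx : 0 < c ^ 2 - x ^ 2 := by nlinarith [abs_nonneg x, sq_abs x]
  have hx' : 0 < |x| := abs_pos.2 hx0
  set S : E →L[ℂ] E := algebraMap ℂ (E →L[ℂ] E) x - D with hSdef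
  have hSsa : IsSelfAdjoint S := by
    refine IsSelfAdjoint.sub ?_ hD
    rw [IsSelfAdjoint, ← algebraMap_star_comm]
    simp
  have hSapp : ∀ ψ, S ψ = (x : ℂ) • ψ - D ψ := fun ψ => by
    simp [hSdef, Algebra.algebraMap_eq_smul_one]
  set A := (|x| * ‖P‖ + ‖D‖ * (1 + ‖P‖)) / (c ^ 2 - x ^ 2) with hA
  have hA0 : 0 ≤ A := by positivity
  rw [spectrum.mem_iff, not_not]
  refine isUnit_of_isSelfAdjoint_of_bounded_below hSsa
    (K := A + (‖D‖ * A + (1 + ‖P‖)) / |x|) (by positivity) fun ψ => ?_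
  -- With `f = P ψ` and `u = ψ - f` the equation splits into `D u = x f + P φ` and `D f = x u + (φ -
  -- P φ)`. Both components are to be bounded by `φ`.
  set φ := D ψ - (x : ℂ) • ψ with hφ
  have hnorm : ‖S ψ‖ = ‖φ‖ := by rw [hSapp, hφ, norm_sub_rev]
  rw [hnorm]
  set f := P ψ with hf
  set u := ψ - f with hu
  have hPf : P f = f := by
    have := congrArg (· ψ) hPP
    exact this
  have hDf : D f = D ψ - P (D ψ) := by
    have := congrArg (· ψ) hDP
    exact eq_sub_of_add_eq this
  have hPφ : P φ = P (D ψ) - (x : ℂ) • f := by rw [hφ, map_sub, map_smul]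
  have hDu : D u = (x : ℂ) • f + P φ := by rw [hu, map_sub, hDf, hPφ]; abel
  have hDf' : D f = (x : ℂ) • u + (φ - P φ) := by
    rw [hDf, hPφ, hφ, hu, smul_sub]; abel
  have hp : ‖P φ‖ ≤ ‖P‖ * ‖φ‖ := P.le_opNorm φ
  have hq : ‖φ - P φ‖ ≤ (1 + ‖P‖) * ‖φ‖ := by
    refine (norm_sub_le _ _).trans ?_
    linarith
  have hDfn : ‖D f‖ ≤ ‖D‖ * ‖f‖ := D.le_opNorm f
  have hsym : inner ℂ (D f) u = inner ℂ f (D u) := by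
    rw [← ContinuousLinearMap.adjoint_inner_right, hD.adjoint_eq]
  have hexp : inner ℂ (D f) (D f) = (x : ℂ) * ((x : ℂ) * inner ℂ f f + inner ℂ f (P φ))
      + inner ℂ (D f) (φ - P φ) := by
    have h1 : inner ℂ (D f) (D f) = inner ℂ (D f) ((x : ℂ) • u + (φ - P φ)) :=
      congrArg (inner ℂ (D f)) hDf'
    rw [h1, inner_add_right, inner_smul_right, hsym, hDu, inner_add_right, inner_smul_right]
  -- Together with `c² ‖f‖² ≤ ‖D f‖²` this bounds `f`, since `x² < c²`.
  have hkey : ‖D f‖ ^ 2 ≤ x ^ 2 * ‖f‖ ^ 2 + |x| * (‖f‖ * ‖P φ‖) + ‖D f‖ * ‖φ - P φ‖ := by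
    have h1 : ‖inner ℂ (D f) (D f)‖ = ‖D f‖ ^ 2 := by
      rw [inner_self_eq_norm_sq_to_K, norm_pow]; simp
    have h2 : ‖inner ℂ f f‖ = ‖f‖ ^ 2 := by
      rw [inner_self_eq_norm_sq_to_K, norm_pow]; simp
    rw [← h1, hexp]
    refine (norm_add_le _ _).trans (add_le_add ?_ (norm_inner_le_norm _ _))
    rw [norm_mul, Complex.norm_real, Real.norm_eq_abs]
    calc _ ≤ |x| * (|x| * ‖f‖ ^ 2 + ‖f‖ * ‖P φ‖) := by
          refine mul_le_mul_of_nonneg_left ((norm_add_le _ _).trans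
            (add_le_add ?_ (norm_inner_le_norm _ _))) (abs_nonneg x)
          rw [norm_mul, Complex.norm_real, Real.norm_eq_abs, h2]
      _ = _ := by rw [mul_add, ← mul_assoc, ← sq, sq_abs]
  have hlow : c ^ 2 * ‖f‖ ^ 2 ≤ ‖D f‖ ^ 2 := by
    rw [← mul_pow]
    have := hc f hPf
    gcongr
  have hfA : ‖f‖ ≤ A * ‖φ‖ := by
    rcases eq_or_lt_of_le (norm_nonneg f) with h0 | h0
    · rw [← h0]; positivity
    · rw [hA, div_mul_eq_mul_div, le_div_iff₀ hcx]
      have h1 : |x| * (‖f‖ * ‖P φ‖) ≤ |x| * (‖f‖ * (‖P‖ * ‖φ‖)) := by gcongr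
      have h2 : ‖D f‖ * ‖φ - P φ‖ ≤ (‖D‖ * ‖f‖) * ((1 + ‖P‖) * ‖φ‖) := by gcongr
      refine le_of_mul_le_mul_left ?_ h0
      nlinarith
  -- The component `u` is recovered only after division by `x`; this is where `0` must be excluded,
  -- since `D` may have a kernel inside `ker P`.
  have hun : |x| * ‖u‖ ≤ (‖D‖ * A + (1 + ‖P‖)) * ‖φ‖ := by
    have h1 : (x : ℂ) • u = D f - (φ - P φ) := by rw [hDf']; abel
    have h2 : ‖(x : ℂ) • u‖ = |x| * ‖u‖ := by
      rw [norm_smul, Complex.norm_real, Real.norm_eq_abs]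
    rw [← h2, h1]
    refine (norm_sub_le _ _).trans ?_
    have h3 : ‖D‖ * ‖f‖ ≤ ‖D‖ * (A * ‖φ‖) := by gcongr
    linarith
  have hun' : ‖u‖ ≤ (‖D‖ * A + (1 + ‖P‖)) / |x| * ‖φ‖ := by
    rw [div_mul_eq_mul_div, le_div_iff₀ hx', mul_comm]
    exact hun
  have hψ : ψ = f + u := by rw [hu]; abel
  calc ‖ψ‖ ≤ ‖f‖ + ‖u‖ := by
        conv_lhs => rw [hψ]
        exact norm_add_le _ _
    _ ≤ _ := by rw [add_mul]; exact add_le_add hfA hun'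

end Gap

/-- The projection onto the even sublattice. -/
def evenProj : Hil →L[ℂ] Hil :=
  mulShift (fun n => if Even n then 1 else 0) 1 (fun n => by split_ifs <;> simp) 0

theorem evenProj_apply (ψ : Hil) (n : ℤ) : evenProj ψ n = if Even n then ψ n else 0 := by
  have h : evenProj ψ n = ((if Even n then 1 else 0 : ℝ) : ℂ) * ψ (n + 0) := rfl
  rw [h, add_zero]
  split_ifs <;> simp

theorem evenProj_mul_self : evenProj * evenProj = evenProj := by
  ext ψ n
  change evenProj (evenProj ψ) n = evenProj ψ n
  simp only [evenProj_apply]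
  split_ifs <;> rfl

theorem hop_mul_evenProj_add {a : ℤ → ℝ} (ha : ∃ M : ℝ, ∀ n, |a n| ≤ M) :
    hop a * evenProj + evenProj * hop a = hop a := by
  ext ψ n
  change hop a (evenProj ψ) n + evenProj (hop a ψ) n = hop a ψ n
  rw [evenProj_apply, hop_apply ha, hop_apply ha, evenProj_apply, evenProj_apply]
  have h1 : Even (n + 1) ↔ ¬Even n := by rw [Int.even_add_one]
  have h2 : Even (n - 1) ↔ ¬Even n := by rw [Int.even_sub_one]
  by_cases h : Even n <;> simp [h, h1, h2]

/-- The spectrum of `T + H` has a gap around `0`, up to the point `0`, uniformly in small `h`. -/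
theorem exists_spectral_gap {W δ τ : ℝ} (hW : 0 < W) (hδ : 0 < δ) (hτ : 0 < τ) {t : ℤ → ℝ}
    (ht : IsHomoclinic W δ t ∨ IsHeteroclinic W δ t) (htτ : ∀ n, τ ≤ t n) :
    ∃ g η M : ℝ, 0 < g ∧ 0 < η ∧ 0 < M ∧ ∀ h : ℤ → ℝ, (∀ n, |h n| ≤ η) →
      IsSelfAdjoint (hop t + hop h) ∧ ∀ z ∈ spectrum ℂ (hop t + hop h),
        z.im = 0 ∧ (z.re ≤ -g ∨ 0 ≤ z.re) ∧ -M ≤ z.re := by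
  obtain ⟨M, hM⟩ := exists_bound ht
  obtain ⟨c, hc, hlow⟩ := exists_lower_bound hW hδ hτ ht htτ
  have hM0 : 0 ≤ M := (abs_nonneg _).trans (hM 0)
  -- `|h n| ≤ c / 4` gives `‖H‖ ≤ c / 2`, so half of the lower bound `c` survives; `2 * M + c`
  -- exceeds the norm of `T + H`.
  refine ⟨c / 2, c / 4, 2 * M + c, by positivity, by positivity, by positivity, fun h hh => ?_⟩
  have hhb : ∃ M : ℝ, ∀ n, |h n| ≤ M := ⟨_, hh⟩
  have hH : ‖hop h‖ ≤ c / 2 := (norm_hop_le hh).trans (by linarith)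
  have hT : ‖hop t‖ ≤ 2 * M := norm_hop_le hM
  have hsa : IsSelfAdjoint (hop t + hop h) :=
    (isSelfAdjoint_hop ⟨M, hM⟩).add (isSelfAdjoint_hop hhb)
  refine ⟨hsa, fun z hz => ?_⟩
  have him : z.im = 0 := hsa.im_eq_zero_of_mem_spectrum hz
  have hzre : ((z.re : ℝ) : ℂ) = z := Complex.ext rfl (by simp [him])
  have : Nontrivial Hil := ⟨e 0, 0, fun h0 => by simpa [h0] using norm_e 0⟩
  have hzn : ‖z‖ ≤ 2 * M + c :=
    (spectrum.norm_le_norm_of_mem hz).trans ((norm_add_le _ _).trans (by linarith))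
  have hre : |z.re| ≤ 2 * M + c := (Complex.abs_re_le_norm z).trans hzn
  refine ⟨him, ?_, (abs_le.1 hre).1⟩
  by_contra! hcon
  refine notMem_spectrum_of_gap hsa evenProj_mul_self ?_ (c := c / 2) (fun f hf => ?_)
    (x := z.re) hcon.2.ne ?_ (hzre ▸ hz)
  · rw [add_mul, mul_add]
    nth_rw 3 [← hop_mul_evenProj_add ⟨M, hM⟩]
    nth_rw 3 [← hop_mul_evenProj_add hhb]
    abel
  · have h1 := hlow f fun m => by
      rw [← hf, evenProj_apply, if_neg (by simp)]
    have h2 : ‖hop h f‖ ≤ c / 2 * ‖f‖ := (hop h).le_of_opNorm_le hH f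
    have h3 : ‖hop t f‖ ≤ ‖(hop t + hop h) f‖ + ‖hop h f‖ := by
      have : hop t f = (hop t + hop h) f - hop h f := by simp
      rw [this]
      exact norm_sub_le _ _
    linarith
  · rw [abs_of_neg hcon.2]
    linarith

/-! ### Circles as contours -/

/-- The circle of center `c` and radius `R`, parametrized by `[0, 1]`. -/
def circleFun (c : ℂ) (R : ℝ) (s : ℝ) : ℂ := circleMap c R (2 * Real.pi * s)

theorem hasDerivAt_circleFun (c : ℂ) (R s : ℝ) :
    HasDerivAt (circleFun c R) ((2 * Real.pi) • deriv (circleMap c R) (2 * Real.pi * s)) s := by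
  have h1 : HasDerivAt (fun s : ℝ => 2 * Real.pi * s) (2 * Real.pi) s := by
    simpa using (hasDerivAt_id s).const_mul (2 * Real.pi)
  have h2 := (hasDerivAt_circleMap c R (2 * Real.pi * s)).scomp s h1
  rwa [← (hasDerivAt_circleMap c R (2 * Real.pi * s)).deriv] at h2

theorem continuous_circleFun (c : ℂ) (R : ℝ) : Continuous (circleFun c R) :=
  (continuous_circleMap c R).comp (by fun_prop)

theorem continuous_deriv_circleFun (c : ℂ) (R : ℝ) : Continuous (deriv (circleFun c R)) := by
  have h : deriv (circleFun c R) = fun s => (2 * Real.pi) • (circleMap 0 R (2 * Real.pi * s) * Complex.I) := by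
    funext s
    rw [(hasDerivAt_circleFun c R s).deriv, deriv_circleMap]
  rw [h]
  have := continuous_circleMap 0 R
  fun_prop

theorem contDiff_circleFun (c : ℂ) (R : ℝ) : ContDiff ℝ 1 (circleFun c R) :=
  contDiff_one_iff_deriv.2
    ⟨fun s => (hasDerivAt_circleFun c R s).differentiableAt, continuous_deriv_circleFun c R⟩

theorem cauchyInt_circleFun {V : Type*} [NormedAddCommGroup V] [NormedSpace ℂ V] (c : ℂ) (R : ℝ)
    (f : ℂ → V) :
    cauchyInt (circleFun c R) f = (2 * (Real.pi : ℂ) * Complex.I)⁻¹ • ∮ z in C(c, R), f z := by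
  rw [cauchyInt, curveInt, circleIntegral]
  congr 1
  have h := intervalIntegral.smul_integral_comp_mul_left (a := 0) (b := 1)
    (fun θ => deriv (circleMap c R) θ • f (circleMap c R θ)) (2 * Real.pi)
  rw [mul_zero, mul_one] at h
  rw [← h, ← intervalIntegral.integral_smul]
  congr 1 with s
  rw [(hasDerivAt_circleFun c R s).deriv, smul_assoc]
  rfl

theorem circleFun_mem_sphere (c : ℂ) {R : ℝ} (hR : 0 ≤ R) (s : ℝ) :
    circleFun c R s ∈ Metric.sphere c R := circleMap_mem_sphere c hR _

theorem cauchyInt_circleFun_inv_of_mem {c w : ℂ} {R : ℝ} (hw : w ∈ Metric.ball c R) :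
    cauchyInt (circleFun c R) (fun z => (z - w)⁻¹) = 1 := by
  rw [cauchyInt_circleFun, circleIntegral.integral_sub_inv_of_mem_ball hw, smul_eq_mul,
    inv_mul_cancel₀ Complex.two_pi_I_ne_zero]

theorem cauchyInt_circleFun_of_notMem {c w : ℂ} {R : ℝ} (hR : 0 ≤ R)
    (hw : w ∉ Metric.closedBall c R) {φ : ℂ → ℂ} (hφ : Differentiable ℂ φ) :
    cauchyInt (circleFun c R) (fun z => φ z * (z - w)⁻¹) = 0 := by
  have hne : ∀ z ∈ Metric.closedBall c R, z - w ≠ 0 := fun z hz h =>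
    hw (sub_eq_zero.1 h ▸ hz)
  rw [cauchyInt_circleFun, Complex.circleIntegral_eq_zero_of_differentiable_on_off_countable hR
    Set.countable_empty, smul_zero]
  · exact hφ.continuous.continuousOn.mul ((continuousOn_id.sub continuousOn_const).inv₀ hne)
  · intro z hz
    exact (hφ z).mul ((differentiableAt_id.sub_const w).inv
      (hne z (Metric.ball_subset_closedBall hz.1)))

theorem cauchyInt_circleFun_mul_inv_of_mem {c w : ℂ} {R : ℝ} (hw : w ∈ Metric.ball c R)
    {φ : ℂ → ℂ} (hφ : Differentiable ℂ φ) :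
    cauchyInt (circleFun c R) (fun z => φ z * (z - w)⁻¹) = φ w := by
  have h := (hφ.diffContOnCl (s := Metric.ball c R)).two_pi_i_inv_smul_circleIntegral_sub_inv_smul hw
  rw [cauchyInt_circleFun]
  simpa only [smul_eq_mul, mul_comm] using h

/-- A circle, as a contour. -/
def circleContour (c : ℂ) (R : ℝ) (hR : 0 < R) : Contour where
  toFun := circleFun c R
  closed := by simp [circleFun, circleMap]
  piecewise_C1 := ⟨{0, 1}, by
      intro x hx
      simp only [Finset.coe_insert, Finset.coe_singleton, Set.mem_insert_iff,
        Set.mem_singleton_iff] at hx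
      rcases hx with rfl | rfl <;> simp, by simp, by simp,
    fun a _ b _ _ _ => (contDiff_circleFun c R).contDiffOn⟩
  simple := by
    intro a ha b hb h
    have hpi := Real.pi_pos
    have := injOn_circleMap_of_abs_sub_le' (c := c) (a := 0) (b := 2 * Real.pi) hR.ne' (by simp)
      (x₁ := 2 * Real.pi * a) ⟨by have := ha.1; positivity, by nlinarith [ha.2]⟩
      (x₂ := 2 * Real.pi * b) ⟨by have := hb.1; positivity, by nlinarith [hb.2]⟩ h
    exact mul_left_cancel₀ (by positivity) this
  positive := by
    intro w hw
    by_cases h : w ∈ Metric.ball c R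
    · exact Or.inr (cauchyInt_circleFun_inv_of_mem h)
    · left
      have hw' : w ∉ Metric.closedBall c R := by
        intro hc
        have hs : w ∈ Metric.sphere c R :=
          le_antisymm hc (not_lt.1 h)
        rw [← abs_of_pos hR, ← image_circleMap_Ioc] at hs
        obtain ⟨θ, hθ, rfl⟩ := hs
        have hpi := Real.pi_pos
        refine hw ⟨θ / (2 * Real.pi), ⟨by have := hθ.1.le; positivity, ?_⟩, ?_⟩
        · rw [div_le_one (by positivity)]; exact hθ.2
        · rw [circleFun, mul_div_cancel₀ _ (by positivity)]
      simpa using cauchyInt_circleFun_of_notMem hR.le hw' (φ := fun _ => 1)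
        (differentiable_const _)

/-! ### Functional calculus along a circle -/

theorem starProjection_congr {E : Type*} [NormedAddCommGroup E]
    [InnerProductSpace ℂ E] {U V : Submodule ℂ E} [U.HasOrthogonalProjection]
    [V.HasOrthogonalProjection] (h : U = V) : U.starProjection = V.starProjection := by
  subst h; rfl

section Calculus

variable {E : Type*} [NormedAddCommGroup E] [InnerProductSpace ℂ E] [CompleteSpace E]

theorem resolvent_eq_cfc {D : E →L[ℂ] E} (hD : IsSelfAdjoint D) {z : ℂ}
    (hz : ∀ x ∈ spectrum ℂ D, z - x ≠ 0) :
    resolvent D z = cfc (fun x : ℂ => (z - x)⁻¹) D := by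
  have hn : IsStarNormal D := hD.isStarNormal
  rw [cfc_inv (fun x => z - x) D hz, cfc_sub (fun _ => z) (fun x => x) D, cfc_const z D, cfc_id' ℂ D]
  rfl

theorem negPart_eq_cfc {D : E →L[ℂ] E} (hD : IsSelfAdjoint D) :
    negPart D = cfc (fun x : ℂ => ((max (-x.re) 0 : ℝ) : ℂ)) D := by
  rw [negPart, CFC.negPart_def, cfcₙ_eq_cfc, cfc_real_eq_complex _ hD]
  rfl

/-- The resolvent is the functional calculus of `x ↦ (z - x)⁻¹`, and the calculus commutes with the
integral because the integrand is bounded by a constant times `d⁻¹` on the spectrum. Operator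
contour integrals thereby reduce to scalar Cauchy integrals. -/
theorem cauchyInt_resolvent {D : E →L[ℂ] E} (hD : IsSelfAdjoint D) {c : ℂ} {R d : ℝ} (hR : 0 ≤ R)
    (hd : 0 < d) (hdist : ∀ z ∈ Metric.sphere c R, ∀ x ∈ spectrum ℂ D, d ≤ ‖z - x‖)
    {φ : ℂ → ℂ} (hφ : Differentiable ℂ φ) :
    cauchyInt (circleFun c R) (fun z => φ z • resolvent D z)
      = cfc (fun x => cauchyInt (circleFun c R) fun z => φ z * (z - x)⁻¹) D := by
  have hn : IsStarNormal D := hD.isStarNormal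
  have hne : ∀ z ∈ Metric.sphere c R, ∀ x ∈ spectrum ℂ D, z - x ≠ 0 := fun z hz x hx =>
    norm_pos_iff.1 (hd.trans_le (hdist z hz x hx))
  have hmem := circleFun_mem_sphere c hR
  set w : ℝ → ℂ := fun s => (2 * (Real.pi : ℂ) * Complex.I)⁻¹ * deriv (circleFun c R) s
    * φ (circleFun c R s) with hw
  have hwc : Continuous w := (continuous_const.mul (continuous_deriv_circleFun c R)).mul
    (hφ.continuous.comp (continuous_circleFun c R))
  obtain ⟨K, hK⟩ := (isCompact_Icc (a := (0 : ℝ)) (b := 1)).exists_bound_of_continuousOn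
    hwc.continuousOn
  have hcont : ContinuousOn (Function.uncurry fun (s : ℝ) (x : ℂ) => w s * (circleFun c R s - x)⁻¹)
      (Set.Ioc (0 : ℝ) 1 ×ˢ spectrum ℂ D) := by
    refine ContinuousOn.mul (hwc.comp continuous_fst).continuousOn (ContinuousOn.inv₀ ?_ ?_)
    · exact (((continuous_circleFun c R).comp continuous_fst).sub continuous_snd).continuousOn
    · exact fun p hp => hne _ (hmem _) _ hp.2
  have key := cfc_setIntegral (𝕜 := ℂ) (μ := MeasureTheory.volume) (measurableSet_Ioc)
    (fun (s : ℝ) (x : ℂ) => w s * (circleFun c R s - x)⁻¹) (fun _ => K * d⁻¹) D hcont ?_ ?_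
  · have e1 : cauchyInt (circleFun c R) (fun z => φ z • resolvent D z)
        = ∫ s in Set.Ioc (0 : ℝ) 1, cfc (fun x : ℂ => w s * (circleFun c R s - x)⁻¹) D := by
      rw [cauchyInt, curveInt, ← intervalIntegral.integral_smul,
        intervalIntegral.integral_of_le zero_le_one]
      congr 1 with s
      rw [cfc_const_mul (w s) (fun x => (circleFun c R s - x)⁻¹) D
        (ContinuousOn.inv₀ (by fun_prop) (hne _ (hmem s))),
        ← resolvent_eq_cfc hD (hne _ (hmem s)), hw, smul_smul, smul_smul]
    rw [e1, ← key]
    congr 1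
    funext x
    rw [cauchyInt, curveInt, ← intervalIntegral.integral_smul,
      intervalIntegral.integral_of_le zero_le_one]
    congr 1 with s
    simp only [hw, smul_eq_mul]
    ring
  · refine MeasureTheory.ae_restrict_of_forall_mem measurableSet_Ioc fun s hs x hx => ?_
    rw [norm_mul, norm_inv]
    have h1 := hK s ⟨hs.1.le, hs.2⟩
    have h2 := hdist _ (hmem s) x hx
    have : 0 ≤ K := (norm_nonneg _).trans h1
    gcongr
  · exact (MeasureTheory.integrable_const (K * d⁻¹)).hasFiniteIntegral

/-- The spectral projector of a self-adjoint operator with a spectral gap below `0`. -/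
theorem negProj_eq_cfc {D : E →L[ℂ] E} (hD : IsSelfAdjoint D) {g : ℝ} (hg : 0 < g)
    (hgap : ∀ x ∈ spectrum ℂ D, x.re ≤ -g ∨ 0 ≤ x.re) {χ : ℂ → ℂ}
    (hχ1 : ∀ x ∈ spectrum ℂ D, x.re ≤ -g → χ x = 1)
    (hχ0 : ∀ x ∈ spectrum ℂ D, 0 ≤ x.re → χ x = 0) : negProj D = cfc χ D := by
  have hn : IsStarNormal D := hD.isStarNormal
  -- `χ` need not be continuous off the spectrum, so a continuous cutoff agreeing with it there is
  -- used. `κ` inverts `x ↦ -x.re` on the negative spectrum; the factorizations through `Q` then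
  -- show that `negPart D` and `Q` have the same kernel.
  let χ' : ℂ → ℂ := fun x => ((max 0 (min 1 (-x.re / g)) : ℝ) : ℂ)
  let ν : ℂ → ℂ := fun x => ((max (-x.re) 0 : ℝ) : ℂ)
  let κ : ℂ → ℂ := fun x => (((max g (-x.re))⁻¹ : ℝ) : ℂ)
  have hχc : Continuous χ' := by fun_prop
  have hνc : Continuous ν := by fun_prop
  have hκc : Continuous κ := Complex.continuous_ofReal.comp
    (Continuous.inv₀ (by fun_prop) fun x => (hg.trans_le (le_max_left _ _)).ne')
  have v1 : ∀ x : ℂ, x.re ≤ -g → χ' x = 1 := fun x hx => by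
    have : 1 ≤ -x.re / g := by rw [le_div_iff₀ hg]; linarith
    simp only [χ', min_eq_left this, max_eq_right zero_le_one, Complex.ofReal_one]
  have v0 : ∀ x : ℂ, 0 ≤ x.re → χ' x = 0 := fun x hx => by
    have : -x.re / g ≤ 0 := div_nonpos_of_nonpos_of_nonneg (by linarith) hg.le
    simp only [χ', max_eq_left ((min_le_right _ _).trans this), Complex.ofReal_zero]
  have w0 : ∀ x : ℂ, 0 ≤ x.re → ν x = 0 := fun x hx => by
    simp only [ν, max_eq_right (by linarith : -x.re ≤ 0), Complex.ofReal_zero]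
  have w1 : ∀ x : ℂ, x.re ≤ -g → κ x * ν x = 1 := fun x hx => by
    have h1 : g ≤ -x.re := by linarith
    simp only [ν, κ, max_eq_right h1, max_eq_left (hg.le.trans h1)]
    rw [← Complex.ofReal_mul, inv_mul_cancel₀ (hg.trans_le h1).ne', Complex.ofReal_one]
  set Q := cfc χ' D with hQ
  have hχeq : cfc χ D = Q := cfc_congr fun x hx => by
    rcases hgap x hx with h | h
    · rw [hχ1 x hx h, v1 x h]
    · rw [hχ0 x hx h, v0 x h]
  have hQQ : Q * Q = Q := by
    rw [hQ, ← cfc_mul χ' χ' D hχc.continuousOn hχc.continuousOn]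
    refine cfc_congr fun x hx => ?_
    rcases hgap x hx with h | h
    · simp only [v1 x h, mul_one]
    · simp only [v0 x h, mul_zero]
  have hNQ : negPart D = negPart D * Q := by
    rw [negPart_eq_cfc hD, hQ, ← cfc_mul ν χ' D hνc.continuousOn hχc.continuousOn]
    refine cfc_congr fun x hx => ?_
    rcases hgap x hx with h | h
    · change ν x = ν x * χ' x
      rw [v1 x h, mul_one]
    · change ν x = ν x * χ' x
      rw [w0 x h, zero_mul]
  have hQN : Q = cfc κ D * negPart D := by
    rw [negPart_eq_cfc hD, hQ, ← cfc_mul κ ν D hκc.continuousOn hνc.continuousOn]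
    refine cfc_congr fun x hx => ?_
    rcases hgap x hx with h | h
    · change χ' x = κ x * ν x
      rw [v1 x h, w1 x h]
    · change χ' x = κ x * ν x
      rw [v0 x h, w0 x h, mul_zero]
  have hQsa : IsSelfAdjoint Q := by
    rw [IsSelfAdjoint, hQ, ← cfc_star]
    exact cfc_congr fun x _ => Complex.conj_ofReal _
  have hker : LinearMap.ker (negPart D).toLinearMap = LinearMap.ker Q.toLinearMap := by
    ext ψ
    rw [LinearMap.mem_ker, LinearMap.mem_ker]
    change negPart D ψ = 0 ↔ Q ψ = 0
    constructor
    · intro h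
      have : Q ψ = cfc κ D (negPart D ψ) := congrArg (· ψ) hQN
      rw [this, h, map_zero]
    · intro h
      have : negPart D ψ = negPart D (Q ψ) := congrArg (· ψ) hNQ
      rw [this, h, map_zero]
  obtain ⟨hproj, hQeq⟩ := isStarProjection_iff_eq_starProjection_range.1
    (⟨hQQ, hQsa⟩ : IsStarProjection Q)
  have hrange : (LinearMap.ker (negPart D).toLinearMap)ᗮ = Q.range := by
    have h1 := ContinuousLinearMap.orthogonal_range Q
    rw [hQsa.adjoint_eq] at h1
    rw [hker]
    change (Q.ker)ᗮ = _
    rw [← h1, Submodule.orthogonal_orthogonal]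
  rw [hχeq, negProj, starProjection_congr hrange, ← hQeq]

end Calculus

/-! ### The circle around the negative spectrum -/

section Gap

variable {D : Hil →L[ℂ] Hil} {g M : ℝ}

theorem norm_sub_center_of_neg
    (hgap : ∀ z ∈ spectrum ℂ D, z.im = 0 ∧ (z.re ≤ -g ∨ 0 ≤ z.re) ∧ -M ≤ z.re)
    (hg : 0 < g) {x : ℂ} (hx : x ∈ spectrum ℂ D) (h : x.re ≤ -g) :
    ‖x - ((-(M + g / 2) : ℝ) : ℂ)‖ ≤ M - g / 2 := by
  obtain ⟨him, -, hM⟩ := hgap x hx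
  have : x - ((-(M + g / 2) : ℝ) : ℂ) = ((x.re + (M + g / 2) : ℝ) : ℂ) := by
    refine Complex.ext ?_ (by simp [him])
    rw [Complex.sub_re, Complex.ofReal_re, Complex.ofReal_re, sub_neg_eq_add]
  rw [this, Complex.norm_real, Real.norm_eq_abs, abs_of_nonneg (by linarith)]
  linarith

theorem norm_sub_center_of_nonneg {x : ℂ} (h : 0 ≤ x.re) :
    M + g / 2 ≤ ‖x - ((-(M + g / 2) : ℝ) : ℂ)‖ := by
  have h1 := Complex.re_le_norm (x - ((-(M + g / 2) : ℝ) : ℂ))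
  rw [Complex.sub_re, Complex.ofReal_re] at h1
  linarith

/-- The circle meets the real axis at `-g / 2`, the middle of the gap, and at `-2 M - g / 2`, to the
left of the spectrum. Spectral points lie at distance at most `M - g / 2` or at least `M + g / 2`
from its center. -/
theorem le_norm_sub_of_mem_sphere
    (hgap : ∀ z ∈ spectrum ℂ D, z.im = 0 ∧ (z.re ≤ -g ∨ 0 ≤ z.re) ∧ -M ≤ z.re)
    (hg : 0 < g) {z x : ℂ}
    (hz : z ∈ Metric.sphere ((-(M + g / 2) : ℝ) : ℂ) M) (hx : x ∈ spectrum ℂ D) :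
    g / 2 ≤ ‖z - x‖ := by
  rw [mem_sphere_iff_norm] at hz
  set c : ℂ := ((-(M + g / 2) : ℝ) : ℂ)
  rcases (hgap x hx).2.1 with h | h
  · have h1 := norm_sub_center_of_neg hgap hg hx h
    have h2 := norm_sub_norm_le (z - c) (x - c)
    rw [sub_sub_sub_cancel_right] at h2
    linarith
  · have h1 := norm_sub_center_of_nonneg (g := g) (M := M) h
    have h2 := norm_sub_norm_le (x - c) (z - c)
    rw [sub_sub_sub_cancel_right, norm_sub_rev x z] at h2
    linarith

/-- The contour integral of `φ(z) (z - D)⁻¹` around the negative part of the spectrum. -/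
theorem cauchyInt_resolvent_of_gap (hD : IsSelfAdjoint D)
    (hgap : ∀ z ∈ spectrum ℂ D, z.im = 0 ∧ (z.re ≤ -g ∨ 0 ≤ z.re) ∧ -M ≤ z.re)
    (hg : 0 < g) (hM : 0 < M) {φ χ : ℂ → ℂ} (hφ : Differentiable ℂ φ)
    (h1 : ∀ x ∈ spectrum ℂ D, x.re ≤ -g → χ x = φ x)
    (h0 : ∀ x ∈ spectrum ℂ D, 0 ≤ x.re → χ x = 0) :
    cauchyInt (circleFun ((-(M + g / 2) : ℝ) : ℂ) M) (fun z => φ z • resolvent D z) = cfc χ D := by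
  rw [cauchyInt_resolvent hD hM.le (half_pos hg)
    (fun z hz x hx => le_norm_sub_of_mem_sphere hgap hg hz hx) hφ]
  refine cfc_congr fun x hx => ?_
  rcases (hgap x hx).2.1 with h | h
  · rw [h1 x hx h]
    refine cauchyInt_circleFun_mul_inv_of_mem ?_ hφ
    rw [mem_ball_iff_norm]
    have := norm_sub_center_of_neg hgap hg hx h
    linarith
  · rw [h0 x hx h]
    refine cauchyInt_circleFun_of_notMem hM.le ?_ hφ
    rw [mem_closedBall_iff_norm, not_le]
    have := norm_sub_center_of_nonneg (g := g) (M := M) h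
    linarith

end Gap

theorem circleContour_points_subset {c : ℂ} {R : ℝ} (hR : 0 < R) :
    (circleContour c R hR).points ⊆ Metric.sphere c R := by
  rintro _ ⟨s, -, rfl⟩
  exact circleFun_mem_sphere c hR.le s

/-- Some circle is adapted to `t`, and its Riesz projector is the spectral projector of `T`. -/
theorem exists_isAdapted {W δ τ : ℝ} (hW : 0 < W) (hδ : 0 < δ) (hτ : 0 < τ) {t : ℤ → ℝ}
    (ht : IsHomoclinic W δ t ∨ IsHeteroclinic W δ t) (htτ : ∀ n, τ ≤ t n) :
    ∃ (γ : Contour) (η : ℝ), IsAdapted t γ η ∧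
      cauchyInt γ.toFun (fun z => resolvent (hop t) z) = negProj (hop t) := by
  obtain ⟨g, η, M, hg, hη, hM, H⟩ := exists_spectral_gap hW hδ hτ ht htτ
  refine ⟨circleContour ((-(M + g / 2) : ℝ) : ℂ) M hM, η, ⟨hη, 2 / g, by positivity, ?_⟩, ?_⟩
  · intro h hh
    obtain ⟨hD, hgap⟩ := H h hh
    have hn : IsStarNormal (hop t + hop h) := hD.isStarNormal
    refine ⟨fun z hz => ?_, ?_⟩
    · have hd : ∀ x ∈ spectrum ℂ (hop t + hop h), g / 2 ≤ ‖z - x‖ := fun x hx =>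
        le_norm_sub_of_mem_sphere hgap hg (circleContour_points_subset hM hz) hx
      have hne : ∀ x ∈ spectrum ℂ (hop t + hop h), z - x ≠ 0 := fun x hx =>
        norm_pos_iff.1 ((half_pos hg).trans_le (hd x hx))
      refine ⟨?_, ?_⟩
      · by_contra hz'
        exact hne z hz' (sub_self z)
      · rw [resolvent_eq_cfc hD hne]
        refine norm_cfc_le (by positivity) fun x hx => ?_
        rw [norm_inv, ← inv_div]
        exact inv_anti₀ (half_pos hg) (hd x hx)
    · refine Eq.trans ?_ (cauchyInt_resolvent_of_gap (φ := fun z => z)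
        (χ := fun x => -((max (-x.re) 0 : ℝ) : ℂ)) hD hgap hg hM differentiable_id
        (fun x hx h => ?_) fun x _ h => ?_).symm
      · rw [cfc_neg, negPart_eq_cfc hD]
      · rw [max_eq_left (by linarith)]
        apply Complex.ext <;> simp [(hgap x hx).1]
      · rw [max_eq_right (by linarith), Complex.ofReal_zero, neg_zero]
  · obtain ⟨hD, hgap⟩ := H 0 fun n => by simpa using hη.le
    rw [hop_zero, add_zero] at hD hgap
    let χ : ℂ → ℂ := fun x => if x.re ≤ -g then 1 else 0
    have hχ1 : ∀ x ∈ spectrum ℂ (hop t), x.re ≤ -g → χ x = 1 := fun x _ h => if_pos h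
    have hχ0 : ∀ x ∈ spectrum ℂ (hop t), 0 ≤ x.re → χ x = 0 := fun x _ h =>
      if_neg (by linarith)
    rw [negProj_eq_cfc hD hg (fun x hx => (hgap x hx).2.1) hχ1 hχ0,
      ← cauchyInt_resolvent_of_gap (φ := fun _ => 1) hD hgap hg hM (differentiable_const _) hχ1 hχ0]
    simp only [one_smul]
    rfl

/-- The slope at `0` does not depend on the contour. -/
theorem IsAdapted.slope_zero_apply {W δ τ : ℝ} (hW : 0 < W) (hδ : 0 < δ) (hτ : 0 < τ) {t : ℤ → ℝ}
    (ht : IsHomoclinic W δ t ∨ IsHeteroclinic W δ t) (htτ : ∀ n, τ ≤ t n) {γ : Contour} {η : ℝ}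
    (hA : IsAdapted t γ η) (k : L1) : slope t γ 0 k = trace (negProj (hop t) * hop k) := by
  obtain ⟨γ₁, η₁, hA₁, hγ₁⟩ := exists_isAdapted hW hδ hτ ht htτ
  have h1 := hA.hasFDerivAt_traceDiff (h := 0) (by simpa using hA.1)
  have h2 := hA₁.hasFDerivAt_traceDiff (h := 0) (by simpa using hA₁.1)
  -- `traceDiff` is defined without a contour, so the slopes computed from two adapted contours are
  -- derivatives of the same function at `0`.
  have h3 := neg_injective (h1.unique h2)
  rw [h3, slope_apply, map_zero, add_zero, ← cauchyInt_eq_contourInt γ₁ (resolvent (hop t)) _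
    fun s => (resI_apply hA₁.avoids_zero s).symm, hγ₁, ← mul_one (negProj (hop t) * hop k),
    trace_mul_hop_mul, one_mul]

end SSH

theorem mainTheorem3 (μ W δ τ : ℝ) (hμ : 0 < μ) (hW : 0 < W) (hδ : 0 < δ) (hτ : 0 < τ)
    (t : ℤ → ℝ) (ht : SSH.IsHomoclinic W δ t ∨ SSH.IsHeteroclinic W δ t)
    (htτ : ∀ n, τ ≤ t n) :
    (∃ (γ : SSH.Contour) (η : ℝ), SSH.IsAdapted t γ η) ∧
    ∀ (γ : SSH.Contour) (η : ℝ), SSH.IsAdapted t γ η →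
      -- `F_t` is well defined, smooth and analytic
      (∀ h : SSH.L1, ‖h‖ ≤ η →
        SSH.IsTraceClass (SSH.negPart (SSH.hop t + SSH.hop h) - SSH.negPart (SSH.hop t))) ∧
      ContDiffOn ℝ ∞ (SSH.energyDiff μ t) (Metric.closedBall 0 η) ∧
      AnalyticOnNhd ℝ (SSH.energyDiff μ t) (Metric.ball 0 η) ∧
      ∃ (L : SSH.L1 →L[ℝ] ℝ) (B : SSH.L1 →L[ℝ] SSH.L1 →L[ℝ] ℝ),
        -- the differential
        (∀ h : SSH.L1, SSH.IsTraceClass (SSH.negProj (SSH.hop t) * SSH.hop h) ∧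
          (L h : ℂ) = ((μ * ∑' n : ℤ, (t n - 1) * h n : ℝ) : ℂ) +
            2 * SSH.trace (SSH.negProj (SSH.hop t) * SSH.hop h)) ∧
        HasFDerivAt (SSH.energyDiff μ t) L 0 ∧
        -- the Hessian
        (∀ h k : SSH.L1, SSH.IsTraceClass (SSH.hessOp t γ h k) ∧
          (B h k : ℂ) = ((μ * ∑' n : ℤ, h n * k n : ℝ) : ℂ) +
            2 * SSH.trace (SSH.hessOp t γ h k)) ∧
        HasFDerivAt (fderiv ℝ (SSH.energyDiff μ t)) B 0 ∧
        -- the Taylor remainder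
        (∃ C : ℝ, 0 ≤ C ∧ ∀ h : SSH.L1, ‖h‖ < η →
          |SSH.energyDiff μ t h - L h - 1 / 2 * B h h| ≤ C * ‖SSH.toL2 h‖ ^ 3) ∧
        -- continuous extension of the Hessian
        ∃ B₂ : SSH.L2 →L[ℝ] SSH.L2 →L[ℝ] ℝ,
          ∀ h k : SSH.L1, B₂ (SSH.toL2 h) (SSH.toL2 k) = B h k := by
  obtain ⟨γ₁, η₁, hA₁, -⟩ := SSH.exists_isAdapted hW hδ hτ ht htτ
  refine ⟨⟨γ₁, η₁, hA₁⟩, fun γ η hA => ?_⟩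
  obtain ⟨M, hM⟩ := SSH.exists_bound ht
  have hb : ∀ n, ‖t n - 1‖ ≤ M + 1 := fun n => by
    refine (norm_sub_le _ _).trans ?_
    rw [norm_one]
    exact add_le_add_left (hM n) 1
  have ofReal_re : ∀ {z : ℂ}, z.im = 0 → ((z.re : ℝ) : ℂ) = z := fun {z} hz =>
    Complex.ext (Complex.ofReal_re _) (by rw [Complex.ofReal_im, hz])
  have h0 : ‖(0 : SSH.L1)‖ < η := by simpa using hA.1
  refine ⟨fun h hh => hA.isTraceClass hh, hA.contDiffOn_energyDiff hb,
    hA.analyticOnNhd_energyDiff hb, SSH.energyGrad μ γ hb 0, SSH.energyHess μ t γ,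
    fun h => ⟨?_, ?_⟩, hA.hasFDerivAt_energyDiff hb h0, fun h k => ⟨?_, ?_⟩,
    hA.hasFDerivAt_fderiv_energyDiff hb, ?_, ?_⟩
  · have := SSH.isTraceClass_mul_hop_mul h (SSH.negProj (SSH.hop t)) 1
    rwa [mul_one] at this
  · have h1 : SSH.energyGrad μ γ hb 0 h
        = μ * SSH.boundedForm (fun n => t n - 1) hb h + 2 * (SSH.slope t γ 0 h).re := by
      simp [SSH.energyGrad]
    -- The gradient was built from real parts; `slope_im` restores the complex trace.
    rw [h1, (SSH.hasSum_boundedForm _ hb h).tsum_eq, ← hA.slope_zero_apply hW hδ hτ ht htτ,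
      Complex.ofReal_add, Complex.ofReal_mul 2, ofReal_re (hA.slope_im h0 h), Complex.ofReal_ofNat]
  · rw [SSH.hessOp_eq hA]
    exact SSH.isTraceClass_contourInt _ _ _ _
  · rw [SSH.energyHess_apply, (SSH.hasSum_dotForm h k).tsum_eq, SSH.trace_hessOp hA,
      Complex.ofReal_add, Complex.ofReal_mul 2, ofReal_re (hA.hess_im h k), Complex.ofReal_ofNat]
  · obtain ⟨C, hC, h⟩ := hA.taylor_bound (μ := μ) hb
    exact ⟨C, hC, fun k hk => h k hk.le⟩
  · refine SSH.exists_bilinear_extension SSH.toL2L SSH.denseRange_toL2L _ _ ?_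
      (SSH.energyHess_bound hμ.le)
    have := γ.len_nonneg
    positivity

end
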